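/- **Setting.** A deterministic MDP has a state space $S$, a starting state $s_0$, $k$ actions, deterministic transitions to states or to an end state $\bot$, and random (rational) rewards in $[0,1]$; its horizon $H$ bounds the number of steps to $\bot$ from every state under every stationary policy $\pi$. $V^\pi(s)$ is the expected total reward of $\pi$ from $s$ until $\bot$, $Q^\pi(s,a)$ the same when the first action is $a$; $V^*=\sup_\pi V^\pi$ and $Q^*=\sup_\pi Q^\pi$. The functions $V^*,Q^*$ are linear in features $\psi: S\cup (S\times A)\to\mathbb{Q}^d$ if for some $\theta\in\mathbb{R}^d$ we have $V^*(s)=\langle\theta,\psi(s)\rangle$ and $Q^*(s,a)=\langle\theta,\psi(s,a)\rangle$ for all $s,a$. *Linear-$k$-RL* with feature dimension $d\ge 1$: given $d$, $H$, the name of $s_0$, and oracle access (one unit of time per call) to samples of the reward of $(s,a)$, to the next state, and to the features $\psi(s)$, $\psi(s,a)$ of an MDP with $k$ actions whose $V^*,Q^*$ are linear in the $d$-dimensional features $\psi$, with $H\le\kappa d$ and with the bit lengths of state names, reward samples and feature coordinates at most $b(d)$, output a policy $\pi$, as the sequence of its actions from $s_0$ to $\bot$, with $V^\pi(s_0)>V^*(s_0)-\tfrac14$.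 Here the constant $\kappa>0$ and the polynomial $b$ with $b(d)\ge d$ are arbitrary but fixed. *Unique-3-SAT* with $v\ge 1$ variables: given a 3-CNF formula with $v$ variables and $O(v)$ clauses that has at most one satisfying assignment, decide whether it is satisfiable. A randomized algorithm (a multi-stack machine with fair coin flips) solves a problem in time $t$ with error probability $p$ if on every instance it halts after $O(t)$ steps whatever its random choices and the oracle's answers are, and: for Linear-$k$-RL, it outputs a policy as required with probability at least $1-p$; for Unique-3-SAT, it answers YES with probability at least $1-p$ on satisfiable formulas and NO with probability $1$ on unsatisfiable ones. **Proposition.** There is an absolute constant $C$ such that for all $\kappa>0$, all polynomials $b$ with natural-number coefficients and $b(d)\ge d$ for all $d$, and all real $q\ge 1$: if Linear-$2$-RL with feature dimension $d$ can be solved in time $d^q$ with error probability $1/10$, then Unique-3-SAT with $v$ variables can be solved in time $v^{Cq^2}$ with error probability $1/8$. -/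

import Mathlib

/-! ### Randomized multi-stack machines with oracles -/

namespace LinRL

/-- The alphabet of the machine: two bits and a separator. -/
inductive Sym : Type
  | bit (b : Bool)
  | sep
  deriving DecidableEq

/-- Programs of a machine with stacks indexed by `ℕ` (a program mentions only finitely many).
`Q` is the type of oracle names; `Cmd Empty` is the type of programs without oracle.
Branches and loops test only the top symbol of one stack (`none` if the stack is empty). -/
inductive Cmd (Q : Type) : Type
  | push (i : ℕ) (a : Sym)
  | pop (i : ℕ)
  | flip (i : ℕ)
  | call (o : Q) (src dst : ℕ)
  | seq (p p' : Cmd Q)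
  | ite (i : ℕ) (test : Option Sym → Bool) (p p' : Cmd Q)
  | while (i : ℕ) (test : Option Sym → Bool) (p : Cmd Q)

/-- The contents of the stacks, top symbol first. -/
abbrev Store : Type := ℕ → List Sym

/-- A configuration: the commands still to be executed, and the stacks.
The machine has halted if no command is left. -/
abbrev Config (Q : Type) : Type := List (Cmd Q) × Store

/-- A randomized oracle: a query string has a random answer string. -/
abbrev Oracle (Q : Type) : Type := Q → List Sym → PMF (List Sym)

/-- One step of the computation. `flip i` pushes a fair random bit on stack `i`, and `call o src dst`
replaces the content of stack `dst` by a fresh answer of the oracle `o` to the content of stack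
`src`. Each step, in particular each oracle call, counts one unit of time. -/
noncomputable def step {Q : Type} (O : Oracle Q) : Config Q → PMF (Config Q)
  | ([], σ) => PMF.pure ([], σ)
  | (.push i a :: K, σ) => PMF.pure (K, Function.update σ i (a :: σ i))
  | (.pop i :: K, σ) => PMF.pure (K, Function.update σ i (σ i).tail)
  | (.flip i :: K, σ) =>
      (PMF.uniformOfFintype Bool).map fun b => (K, Function.update σ i (.bit b :: σ i))
  | (.call o src dst :: K, σ) =>
      (O o (σ src)).map fun y => (K, Function.update σ dst y)
  | (.seq p p' :: K, σ) => PMF.pure (p :: p' :: K, σ)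
  | (.ite i test p p' :: K, σ) =>
      PMF.pure ((if test (σ i).head? then p else p') :: K, σ)
  | (.while i test p :: K, σ) =>
      PMF.pure (if test (σ i).head? then p :: .while i test p :: K else K, σ)

/-- The random configuration after `n` steps. -/
noncomputable def steps {Q : Type} (O : Oracle Q) : ℕ → Config Q → PMF (Config Q)
  | 0, c => PMF.pure c
  | n + 1, c => (step O c).bind (steps O n)

/-- Whatever the random choices are, the program halts after at most `T` steps. -/
def HaltsWithin {Q : Type} (O : Oracle Q) (p : Cmd Q) (σ : Store) (T : ℕ) : Prop :=
  ∀ c ∈ (steps O T ([p], σ)).support, c.1 = []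

/-- The random content of stack `0`, the output stack, after `T` steps. -/
noncomputable def output {Q : Type} (O : Oracle Q) (p : Cmd Q) (σ : Store) (T : ℕ) :
    PMF (List Sym) :=
  (steps O T ([p], σ)).map fun c => c.2 0

/-- The probability of an event. -/
noncomputable def prob {α : Type} (D : PMF α) (E : Set α) : ENNReal := D.toOuterMeasure E

/-- The oracle of a machine without oracle. -/
def noOracle : Oracle Empty := fun o => o.elim

/-! ### Encodings -/

def unary (n : ℕ) : List Sym := List.replicate n (.bit true)

/-- Binary notation, least significant bit first. -/
def natCode (n : ℕ) : List Sym := n.bits.map .bit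

/-- Sign, numerator and denominator (in lowest terms). -/
def ratCode (x : ℚ) : List Sym :=
  .bit (decide (x < 0)) :: (natCode x.num.natAbs ++ .sep :: (natCode x.den ++ [.sep]))

def vecCode {d : ℕ} (x : Fin d → ℚ) : List Sym := (List.ofFn x).flatMap ratCode

def actionsCode {k : ℕ} (l : List (Fin k)) : List Sym :=
  l.flatMap fun a => unary a ++ [.sep]

/-! ### Deterministic Markov decision processes -/

/-- The state at time `t` under the policy `π` from state `s`; `none` is the end state. -/
def trajectory {S A : Type} (next : S → A → Option S) (π : S → A) (s : S) : ℕ → Option S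
  | 0 => some s
  | t + 1 => (trajectory next π s t).bind fun s' => next s' (π s')

/-- A Markov decision process with deterministic transitions, stochastic rewards in `[0, 1]` and
finite horizon. The end state is not an element of `S`: it is the value `none` of `next`.
Rewards are rational because an algorithm receives their samples as strings. -/
structure DetMDP (S A : Type) where
  start : S
  reward : S → A → PMF ℚ
  next : S → A → Option S
  horizon : ℕ
  reward_mem : ∀ s a, ∀ x ∈ (reward s a).support, 0 ≤ x ∧ x ≤ 1
  ends : ∀ (π : S → A) (s : S), ∃ t ≤ horizon, trajectory next π s t = none

namespace DetMDP

variable {S A : Type} (M : DetMDP S A)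

/-- The expected reward of an action in a state. -/
noncomputable def meanReward (s : S) (a : A) : ℝ := ∑' x : ℚ, (M.reward s a x).toReal * (x : ℝ)

/-- The value of a policy: the expected total reward until the end state is reached. -/
noncomputable def V (π : S → A) (s : S) : ℝ :=
  ∑ t ∈ Finset.range M.horizon,
    (trajectory M.next π s t).elim 0 fun s' => M.meanReward s' (π s')

/-- The action value of a policy: the first action is `a`, then `π` is followed. -/
noncomputable def Q (π : S → A) (s : S) (a : A) : ℝ :=
  M.meanReward s a + (M.next s a).elim 0 (M.V π)

noncomputable def optV (s : S) : ℝ := ⨆ π : S → A, M.V π s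

noncomputable def optQ (s : S) (a : A) : ℝ := ⨆ π : S → A, M.Q π s a

/-- The sequence of actions `l` describes a policy (on the trajectory from the starting state to
the end state) whose value at the starting state is larger than the optimal value minus `1/4`. -/
def GoodActions (l : List A) : Prop :=
  ∃ π : S → A, (∀ t s, trajectory M.next π M.start t = some s → l[t]? = some (π s)) ∧
    M.V π M.start > M.optV M.start - 1 / 4

end DetMDP

/-! ### The problem Linear-`k`-RL -/

/-- What the algorithm has access to: a deterministic MDP with `k` actions, names of its states as
bit strings, and `d`-dimensional features of its states and of its state-action pairs. -/
structure RLOracle (k d : ℕ) where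
  S : Type
  M : DetMDP S (Fin k)
  code : S → List Bool
  code_injective : Function.Injective code
  featS : S → Fin d → ℚ
  featSA : S → Fin k → Fin d → ℚ

namespace RLOracle

variable {k d : ℕ} (I : RLOracle k d)

/-- The optimal value functions are linear in the features, with one parameter vector. -/
def LinearOpt : Prop :=
  ∃ θ : Fin d → ℝ, (∀ s, I.M.optV s = ∑ i, θ i * (I.featS s i : ℝ)) ∧
    ∀ s a, I.M.optQ s a = ∑ i, θ i * (I.featSA s a i : ℝ)

/-- The names of states, the reward samples and the coordinates of features have length at
most `B`. -/
def SizeLE (B : ℕ) : Prop :=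
  (∀ s, (I.code s).length ≤ B) ∧
  (∀ s a, ∀ x ∈ (I.M.reward s a).support, (ratCode x).length ≤ B) ∧
  (∀ s i, (ratCode (I.featS s i)).length ≤ B) ∧
  (∀ s a i, (ratCode (I.featSA s a i)).length ≤ B)

def stateCode (s : I.S) : List Sym := (I.code s).map .bit

open Classical in
/-- The state named by a string, if there is one. -/
noncomputable def decode (x : List Sym) : Option I.S :=
  if h : ∃ s, I.stateCode s = x then some h.choose else none

end RLOracle

/-- The oracle calls: next state, reward sample, features of a state, features of a state-action
pair. -/
inductive RLCall (k : ℕ) : Type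
  | next (a : Fin k)
  | reward (a : Fin k)
  | featS
  | featSA (a : Fin k)

namespace RLOracle

variable {k d : ℕ} (I : RLOracle k d)

/-- The answers to oracle calls. The string `[sep]` stands for the end state, and is the answer
to every query that is not the name of a state. -/
noncomputable def answer : Oracle (RLCall k) := fun o x =>
  match I.decode x with
  | none => PMF.pure [.sep]
  | some s =>
    match o with
    | .next a => PMF.pure ((I.M.next s a).elim [.sep] I.stateCode)
    | .reward a => (I.M.reward s a).map ratCode
    | .featS => PMF.pure (vecCode (I.featS s))
    | .featSA a => PMF.pure (vecCode (I.featSA s a))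

/-- The input of the algorithm: the dimension, the horizon and the name of the starting state. -/
def input : Store
  | 0 => unary d
  | 1 => unary I.M.horizon
  | 2 => I.stateCode I.M.start
  | _ => []

end RLOracle

/-- Linear-`k`-RL with feature dimension `d`, restricted to instances of horizon at most `κ * d`
and of input and output size at most `b(d)`, can be solved in time `O(t(d))` with error
probability `ε`. -/
def LinearRLSolvable (k : ℕ) (κ : ℝ) (b : Polynomial ℕ) (t : ℕ → ℝ) (ε : ℝ) : Prop :=
  ∃ (p : Cmd (RLCall k)) (K : ℝ), ∀ d : ℕ, 1 ≤ d → ∀ I : RLOracle k d,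
    I.LinearOpt → (I.M.horizon : ℝ) ≤ κ * d → I.SizeLE (b.eval d) →
      HaltsWithin I.answer p I.input ⌊K * t d⌋₊ ∧
      ENNReal.ofReal (1 - ε) ≤ prob (output I.answer p I.input ⌊K * t d⌋₊)
        {y | ∃ l : List (Fin k), y = actionsCode l ∧ I.M.GoodActions l}

/-! ### The problem Unique-3-SAT -/

/-- A clause with three literals: a variable with the value that makes the literal true.
The literals need not be distinct. -/
abbrev Clause (v : ℕ) : Type := Fin 3 → Fin v × Bool

/-- A 3-CNF formula on `v` variables. -/
abbrev Formula (v : ℕ) : Type := List (Clause v)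

def Satisfies {v : ℕ} (w : Fin v → Bool) (φ : Formula v) : Prop :=
  ∀ c ∈ φ, ∃ j, w (c j).1 = (c j).2

def clauseCode {v : ℕ} (c : Clause v) : List Sym :=
  (List.ofFn c).flatMap fun x => .bit x.2 :: (unary x.1 ++ [.sep])

def formulaCode {v : ℕ} (φ : Formula v) : List Sym :=
  unary v ++ .sep :: φ.flatMap clauseCode

/-- The input of the algorithm: the formula. -/
def satInput {v : ℕ} (φ : Formula v) : Store
  | 0 => formulaCode φ
  | _ => []

/-- The outputs that mean YES; all other outputs mean NO. -/
def Yes : Set (List Sym) := {y | y.head? = some (.bit true)}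

/-- Unique-3-SAT on `v` variables and `O(v)` clauses can be solved in time `O(t(v))` with error
probability `ε` on satisfiable formulas and without error on unsatisfiable ones. The time
constant may depend on the constant in the number of clauses, the algorithm does not. -/
def Unique3SATSolvable (t : ℕ → ℝ) (ε : ℝ) : Prop :=
  ∃ p : Cmd Empty, ∀ κ : ℝ, ∃ K : ℝ, ∀ v : ℕ, 1 ≤ v → ∀ φ : Formula v,
    (φ.length : ℝ) ≤ κ * v →
    (∀ w w' : Fin v → Bool, Satisfies w φ → Satisfies w' φ → w = w') →
      HaltsWithin noOracle p (satInput φ) ⌊K * t v⌋₊ ∧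
      ((∃ w, Satisfies w φ) →
        ENNReal.ofReal (1 - ε) ≤ prob (output noOracle p (satInput φ) ⌊K * t v⌋₊) Yes) ∧
      ((¬ ∃ w, Satisfies w φ) →
        prob (output noOracle p (satInput φ) ⌊K * t v⌋₊) Yesᶜ = 1)

end LinRL

namespace LinRL
open Function

/-! The proof is a reduction. Local search for a satisfying assignment is turned into a
deterministic decision process whose optimal values are polynomials of low degree in the state, and
whose informative rewards are too rare to be noticed before a satisfying assignment has been found.

Let `w` satisfy the formula, padded to `n = v + c` variables. A state holds an assignment and the
number of flips made so far, at most `H`. At the first false clause one of its three variables is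
flipped; with two actions, this choice takes an extra state, marked by the phase bit. The process
ends at a satisfying assignment or after `H` flips, with a reward 0 or 1 of mean `(k/(H+n+1))^r`,
where `k` (`lead`) is the number of flips left plus the number of variables that agree with `w`. A
false clause has a literal that is true under `w`; flipping its variable costs one flip and gains
one agreement, while any other flip loses both. So `k` can be kept constant and never grows, and the
formula for the reward also gives the optimal value in phase 0 (`search_bellman`). At a given level
it is the `r`-th power of a linear function of the one-hot assignment, hence linear in its Kronecker
power; in phase 1 it is multiplied by indicators of literals. The assignment `w` enters only through
the parameter vector (`dot_feat`, `searchOracle_linearOpt`).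

Transitions and features are computable from the formula alone. The simulation of the learning
algorithm answers every reward query by 0, and raises a flag if the queried state is satisfying, in
which case the formula is decided. In an unsatisfied state without flips left, `k ≤ n`, so that the
reward differs from 0 with probability at most `ε = (n/(H+n+1))^r ≤ (2n)^(-(r²+r))`. The number of
queries is `O(d^q)` with `d = 3(2n)^(2r+4)`, which is `O((2n)^(r²))` if `r ≥ 2q+2`. For large `n`
the answers are therefore wrong with total probability at most 1/40, and 1/10 + 1/40 = 1/8
(`simulate`, `mul_score_le`, `seven_eighths_le`). The optimal value at the start is at least 1/2,
and a policy that meets no satisfying assignment has value at most `ε ≤ 1/4`; so a good policy leads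
to a satisfying assignment, and following it verifies this (`satState_of_goodActions`). YES is
answered only when a satisfying assignment has been seen. For an unsatisfiable formula, the process
with all rewards zero is a valid instance, which guarantees that the simulation halts in time.

The remaining work is to write the simulation as a stack program. Its time is bounded by a
polynomial fixed before the simulated program, `c` and `r` (`exists_reduction`); therefore the
constant in the exponent is absolute. -/

theorem eval_mono (P : Polynomial ℕ) {a b : ℕ} (h : a ≤ b) : P.eval a ≤ P.eval b := by
  induction P using Polynomial.induction_on' with
  | add p q hp hq => simpa using add_le_add hp hq
  | monomial n c => simpa using Nat.mul_le_mul_left _ (Nat.pow_le_pow_left h n)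

/-! ### Executions, and rules for deterministic programs. -/

section Steps

variable {Q : Type} (O : Oracle Q)

theorem steps_add (a b : ℕ) (c : Config Q) :
    steps O (a + b) c = (steps O a c).bind (steps O b) := by
  induction a generalizing c with
  | zero => simp [steps]
  | succ a ih =>
    rw [Nat.succ_add_eq_add_succ, Nat.add_succ, steps, steps, PMF.bind_bind]
    congr 1
    funext c'
    exact ih c'

theorem steps_nil (n : ℕ) (σ : Store) : steps O n ([], σ) = PMF.pure ([], σ) := by
  induction n with
  | zero => rfl
  | succ n ih => simp [steps, step, ih]

end Steps

/-- The program is deterministic, transforms `σ` into `σ'`, and takes at most `T` steps. -/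
def Runs (p : Cmd Empty) (σ σ' : Store) (T : ℕ) : Prop :=
  ∃ t ≤ T, ∀ K, steps noOracle t (p :: K, σ) = PMF.pure (K, σ')

namespace Runs

variable {p p' : Cmd Empty} {σ σ₁ σ₂ : Store} {T T' : ℕ}

theorem mono (h : Runs p σ σ₁ T) (hT : T ≤ T') : Runs p σ σ₁ T' :=
  let ⟨t, ht, h⟩ := h
  ⟨t, ht.trans hT, h⟩

theorem of_eq (h : Runs p σ σ₁ T) (e : σ₁ = σ₂) (hT : T ≤ T') : Runs p σ σ₂ T' :=
  e ▸ h.mono hT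

theorem push (i : ℕ) (a : Sym) (σ : Store) : Runs (.push i a) σ (update σ i (a :: σ i)) 1 :=
  ⟨1, le_rfl, fun K => by simp [steps, step]⟩

theorem pop (i : ℕ) (σ : Store) : Runs (.pop i) σ (update σ i (σ i).tail) 1 :=
  ⟨1, le_rfl, fun K => by simp [steps, step]⟩

theorem seq (h : Runs p σ σ₁ T) (h' : Runs p' σ₁ σ₂ T') :
    Runs (.seq p p') σ σ₂ (T + T' + 1) := by
  obtain ⟨t, ht, h⟩ := h
  obtain ⟨t', ht', h'⟩ := h'
  refine ⟨1 + (t + t'), by omega, fun K => ?_⟩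
  rw [steps_add]
  simp [steps, step, steps_add, h, h']

theorem ite {i : ℕ} {test : Option Sym → Bool}
    (h : test (σ i).head? = true → Runs p σ σ₁ T) (h' : test (σ i).head? = false → Runs p' σ σ₁ T) :
    Runs (.ite i test p p') σ σ₁ (T + 1) := by
  cases hb : test (σ i).head? with
  | true =>
    obtain ⟨t, ht, h⟩ := h hb
    exact ⟨1 + t, by omega, fun K => by rw [steps_add]; simp [steps, step, hb, h]⟩
  | false =>
    obtain ⟨t, ht, h⟩ := h' hb
    exact ⟨1 + t, by omega, fun K => by rw [steps_add]; simp [steps, step, hb, h]⟩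

theorem while_false {i : ℕ} {test : Option Sym → Bool} (hb : test (σ i).head? = false) :
    Runs (.while i test p) σ σ 1 :=
  ⟨1, le_rfl, fun K => by simp [steps, step, hb]⟩

theorem while_true {i : ℕ} {test : Option Sym → Bool} (hb : test (σ i).head? = true)
    (h : Runs p σ σ₁ T) (h' : Runs (.while i test p) σ₁ σ₂ T') :
    Runs (.while i test p) σ σ₂ (T + T' + 1) := by
  obtain ⟨t, ht, h⟩ := h
  obtain ⟨t', ht', h'⟩ := h'
  refine ⟨1 + (t + t'), by omega, fun K => ?_⟩
  rw [steps_add]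
  simp [steps, step, steps_add, h, h', hb]

end Runs

/-- Branching on the top symbol of a nonempty stack. -/
def caseTop (i : ℕ) (f : Sym → Cmd Empty) : Cmd Empty :=
  .ite i (· = some (.bit true)) (f (.bit true))
    (.ite i (· = some (.bit false)) (f (.bit false)) (f .sep))

theorem caseTop_runs {i : ℕ} {f : Sym → Cmd Empty} {σ σ' : Store} {a : Sym} {l : List Sym} {T : ℕ}
    (hi : σ i = a :: l) (h : Runs (f a) σ σ' T) : Runs (caseTop i f) σ σ' (T + 2) := by
  refine Runs.ite (T := T + 1) (fun hb => ?_) (fun hb => Runs.ite (fun hb' => ?_) (fun hb' => ?_))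
  · rw [hi] at hb; simp at hb; subst hb; exact h.mono (by omega)
  · rw [hi] at hb'; simp at hb'; subst hb'; exact h
  · rw [hi] at hb hb'
    rcases a with (_ | _) | _
    · simp at hb'
    · simp at hb
    · exact h

/-- Empty stack `i`, and execute `f a` for each symbol `a` on it. -/
def drain (i : ℕ) (f : Sym → Cmd Empty) : Cmd Empty :=
  .while i (·.isSome) (caseTop i fun a => .seq (.pop i) (f a))

/-- Loop rule: `Inv l` describes the store when `l` is the unread part of stack `i`. The five extra
steps for each symbol are the pop, the sequencing, at most two branchings and the loop test; the
last step leaves the loop. -/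
theorem drain_runs {i : ℕ} {f : Sym → Cmd Empty} (Inv : List Sym → Store → Prop) (T : ℕ)
    (hi : ∀ l σ, Inv l σ → σ i = l)
    (hf : ∀ a l σ, Inv (a :: l) σ → ∃ σ', Inv l σ' ∧ Runs (f a) (update σ i l) σ' T) :
    ∀ l σ, Inv l σ → ∃ σ', Inv [] σ' ∧ Runs (drain i f) σ σ' (l.length * (T + 5) + 1) := by
  intro l
  induction l with
  | nil =>
    intro σ h
    refine ⟨σ, h, (Runs.while_false ?_).mono (by simp)⟩
    simp [hi _ _ h]
  | cons a l ih =>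
    intro σ h
    obtain ⟨σ', h', hr⟩ := hf a l σ h
    obtain ⟨σ'', h'', hr'⟩ := ih σ' h'
    have hr := (Runs.pop i σ).seq (T' := T) (by simpa [hi _ _ h] using hr)
    refine ⟨σ'', h'', (Runs.while_true ?_ (caseTop_runs (f := fun a => .seq (.pop i) (f a))
      (hi _ _ h) hr) hr').mono ?_⟩
    · simp [hi _ _ h]
    · simp only [List.length_cons]; ring_nf; omega

def clear (i : ℕ) : Cmd Empty := .while i (·.isSome) (.pop i)

theorem clear_runs (i : ℕ) (σ : Store) :
    Runs (clear i) σ (update σ i []) (2 * (σ i).length + 1) := by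
  generalize hl : σ i = l
  induction l generalizing σ with
  | nil =>
    have : update σ i [] = σ := by rw [← hl]; simp
    rw [this]
    exact (Runs.while_false (by simp [hl])).mono (by simp)
  | cons a l ih =>
    have := ih (update σ i l) (by simp)
    rw [update_idem] at this
    refine (Runs.while_true (by simp [hl]) ?_ this).mono (T := 1 + (2 * l.length + 1) + 1)
      (by simp only [List.length_cons]; omega)
    simpa [hl] using Runs.pop i σ

/-- Move the content of stack `i` to stack `j`, reversing it. -/
def move (i j : ℕ) : Cmd Empty := drain i fun a => .push j a

theorem move_runs {i j : ℕ} (hij : i ≠ j) (σ : Store) :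
    Runs (move i j) σ (update (update σ j ((σ i).reverse ++ σ j)) i []) (6 * (σ i).length + 1) := by
  obtain ⟨σ', ⟨k, hk, h⟩, hr⟩ := drain_runs (i := i) (f := fun a => .push j a)
    (fun l τ => ∃ k, k ++ l = σ i ∧ τ = update (update σ j (k.reverse ++ σ j)) i l) 1
    (by rintro l τ ⟨k, hk, rfl⟩; simp)
    (by
      rintro a l τ ⟨k, hk, rfl⟩
      refine ⟨_, ⟨k ++ [a], by simpa using hk, rfl⟩, ?_⟩
      convert Runs.push j a _ using 1
      funext x
      simp only [update_apply]
      split_ifs <;> simp_all) (σ i) σ ⟨[], by simp, by simp⟩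
  simp only [List.append_nil] at hk
  subst hk
  rw [h] at hr
  exact hr.mono (by omega)

/-- Move the content of stack `i` to both stacks `j` and `k`, reversing it. -/
def move₂ (i j k : ℕ) : Cmd Empty := drain i fun a => .seq (.push j a) (.push k a)

theorem move₂_runs {i j k : ℕ} (hij : i ≠ j) (hik : i ≠ k) (hjk : j ≠ k) (σ : Store) :
    Runs (move₂ i j k) σ (update (update (update σ j ((σ i).reverse ++ σ j))
      k ((σ i).reverse ++ σ k)) i []) (8 * (σ i).length + 1) := by
  obtain ⟨σ', ⟨m, hm, h⟩, hr⟩ := drain_runs (i := i) (f := fun a => .seq (.push j a) (.push k a))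
    (fun l τ => ∃ m, m ++ l = σ i ∧ τ = update (update (update σ j (m.reverse ++ σ j))
      k (m.reverse ++ σ k)) i l) 3
    (by rintro l τ ⟨k, hk, rfl⟩; simp)
    (by
      rintro a l τ ⟨m, hm, rfl⟩
      refine ⟨_, ⟨m ++ [a], by simpa using hm, rfl⟩, ?_⟩
      convert (Runs.push j a _).seq (Runs.push k a _) using 1
      funext x
      simp only [update_apply]
      split_ifs <;> simp_all) (σ i) σ ⟨[], by simp, by simp⟩
  simp only [List.append_nil] at hm
  subst hm
  rw [h] at hr
  exact hr.mono (by omega)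

/-- Copy stack `s` to stack `d`, with the scratch stacks `M` and `M + 1`. -/
def copy (s d M : ℕ) : Cmd Empty :=
  .seq (move s M) (.seq (move₂ M s (M + 1)) (.seq (clear d) (.seq (move (M + 1) M) (move M d))))

/-- Each move reverses, so the copy passes through two scratch stacks. It is complete on `M + 1`
before `d` is cleared, so `s = d` is allowed. -/
theorem copy_runs {s d M : ℕ} (hs : s < M) (hd : d < M) (σ : Store) (h0 : σ M = [])
    (h1 : σ (M + 1) = []) :
    Runs (copy s d M) σ (update σ d (σ s)) (40 * ((σ s).length + (σ d).length) + 10) := by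
  have e₁ := move_runs (i := s) (j := M) (by omega) σ
  have e₂ := move₂_runs (i := M) (j := s) (k := M + 1) (by omega) (by omega) (by omega)
    (update (update σ M ((σ s).reverse ++ σ M)) s [])
  have e₂' : update (update (update (update (update σ M ((σ s).reverse ++ σ M)) s [])
      s (((update (update σ M ((σ s).reverse ++ σ M)) s []) M).reverse ++
        (update (update σ M ((σ s).reverse ++ σ M)) s []) s))
      (M + 1) (((update (update σ M ((σ s).reverse ++ σ M)) s []) M).reverse ++
        (update (update σ M ((σ s).reverse ++ σ M)) s []) (M + 1))) M [] =
      update σ (M + 1) (σ s) := by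
    have : M ≠ s := by omega
    have : M + 1 ≠ s := by omega
    funext x
    simp only [update_apply]
    split_ifs <;> simp_all
  rw [e₂'] at e₂
  have e₃ := clear_runs d (update σ (M + 1) (σ s))
  have e₄ := move_runs (i := M + 1) (j := M) (by omega) (update (update σ (M + 1) (σ s)) d [])
  have e₅ := move_runs (i := M) (j := d) (by omega)
    (update (update (update (update σ (M + 1) (σ s)) d []) M
      ((update (update σ (M + 1) (σ s)) d [] (M + 1)).reverse ++
        update (update σ (M + 1) (σ s)) d [] M)) (M + 1) [])
  have hd1 : M + 1 ≠ d := by omega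
  have hd2 : M ≠ d := by omega
  have hs2 : M ≠ s := by omega
  refine (e₁.seq (e₂.seq (e₃.seq (e₄.seq e₅)))).of_eq ?_ ?_
  · funext x
    by_cases hx : x = M
    · subst hx; simp [h0, hd2]
    by_cases hx' : x = M + 1
    · subst hx'; simp [h1, hd1]
    by_cases hx'' : x = d
    · subst hx''; simp [hd1, hd2, hd1.symm, hd2.symm, h0]
    simp [hx, hx', hx'']
  · simp [h0, hd1, hd2, hs2, hd1.symm]
    omega

/-- The total length of a tuple of strings. -/
def size {m : ℕ} (x : Fin m → List Sym) : ℕ := ∑ i, (x i).length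

theorem length_le_size {m : ℕ} (x : Fin m → List Sym) (i : Fin m) : (x i).length ≤ size x :=
  Finset.single_le_sum (f := fun i => (x i).length) (fun _ _ => Nat.zero_le _) (Finset.mem_univ i)

theorem size_succ {m : ℕ} (x : Fin (m + 1) → List Sym) :
    size x = (x 0).length + size fun i => x i.succ :=
  Fin.sum_univ_succ _

theorem size_cons {m : ℕ} (a : List Sym) (x : Fin m → List Sym) :
    size (Fin.cons a x : Fin (m + 1) → List Sym) = a.length + size x := by
  simp [size_succ]

/-- String functions computable in polynomial time: the bounding polynomial is good for all choices
of argument stacks, target stack, and first scratch stack. -/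
def PolyTime {m : ℕ} (f : (Fin m → List Sym) → List Sym) : Prop :=
  ∃ P : Polynomial ℕ, (∀ x, (f x).length ≤ P.eval (size x)) ∧
    ∀ (args : Fin m → ℕ) (dst M : ℕ), (∀ i, args i < M) → dst < M →
      ∃ p : Cmd Empty, ∀ σ : Store, (∀ j, M ≤ j → σ j = []) →
        Runs p σ (update σ dst (f fun i => σ (args i)))
          (P.eval (size (fun i => σ (args i)) + (σ dst).length))

/-! ### Closure properties of polynomial-time string functions: composition, branching, recursion.
-/

namespace PolyTime

variable {m : ℕ} {f g h : (Fin m → List Sym) → List Sym}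

theorem proj (i : Fin m) : PolyTime fun x => x i := by
  refine ⟨40 * Polynomial.X + 10, fun x => ?_, fun args dst M ha hd =>
    ⟨copy (args i) dst M, fun σ h0 => ?_⟩⟩
  · have := length_le_size x i
    simp; omega
  · refine (copy_runs (ha i) hd σ (h0 _ le_rfl) (h0 _ (by omega))).mono ?_
    have := length_le_size (fun i => σ (args i)) i
    simp; omega

theorem nil : PolyTime fun _ : Fin m → List Sym => [] := by
  refine ⟨2 * Polynomial.X + 1, fun x => by simp, fun args dst M ha hd =>
    ⟨clear dst, fun σ h0 => (clear_runs dst σ).mono ?_⟩⟩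
  simp

theorem cons (a : Sym) (hf : PolyTime f) : PolyTime fun x => a :: f x := by
  obtain ⟨P, hP, hp⟩ := hf
  refine ⟨P + 2, fun x => ?_, fun args dst M ha hd => ?_⟩
  · have := hP x
    simp; omega
  · obtain ⟨p, hp⟩ := hp args dst M ha hd
    refine ⟨.seq p (.push dst a), fun σ h0 => ?_⟩
    refine ((hp σ h0).seq (Runs.push dst a _)).of_eq ?_ ?_
    · simp
    · simp

theorem tail (hf : PolyTime f) : PolyTime fun x => (f x).tail := by
  obtain ⟨P, hP, hp⟩ := hf
  refine ⟨P + 2, fun x => ?_, fun args dst M ha hd => ?_⟩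
  · have := hP x
    simp; omega
  · obtain ⟨p, hp⟩ := hp args dst M ha hd
    refine ⟨.seq p (.pop dst), fun σ h0 => ?_⟩
    refine ((hp σ h0).seq (Runs.pop dst _)).of_eq ?_ ?_
    · simp
    · simp

theorem ite (test : Option Sym → Bool) (hf : PolyTime f) (hg : PolyTime g) (hh : PolyTime h) :
    PolyTime fun x => if test (f x).head? then g x else h x := by
  obtain ⟨P, hP, hp⟩ := hf
  obtain ⟨P₁, hP₁, hp₁⟩ := hg
  obtain ⟨P₂, hP₂, hp₂⟩ := hh
  refine ⟨3 * P + P₁ + P₂ + 10, fun x => ?_, fun args dst M ha hd => ?_⟩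
  · have := hP₁ x
    have := hP₂ x
    simp
    split_ifs <;> omega
  · obtain ⟨p, hp⟩ := hp args M (M + 1) (fun i => (ha i).trans (by omega)) (by omega)
    obtain ⟨p₁, hp₁⟩ := hp₁ args dst M ha hd
    obtain ⟨p₂, hp₂⟩ := hp₂ args dst M ha hd
    refine ⟨.seq p (.ite M test (.seq (clear M) p₁) (.seq (clear M) p₂)), fun σ h0 => ?_⟩
    have e := hp σ (fun j hj => h0 j (by omega))
    set x := fun i => σ (args i) with hx
    have c := clear_runs M (update σ M (f x))
    rw [update_idem, ← h0 M le_rfl, update_eq_self] at c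
    have hM : update σ M (f x) M = f x := by simp
    refine (e.seq (Runs.ite (T := (2 * (f x).length + 1) + (P₁.eval (size x + (σ dst).length) +
      P₂.eval (size x + (σ dst).length)) + 1) (fun hb => ?_) fun hb => ?_)).mono ?_
    · rw [hM] at hb
      simp only [hb, if_true]
      have e₁ : Runs p₁ σ (update σ dst (g x)) (P₁.eval (size x + (σ dst).length)) := hp₁ σ h0
      exact (c.seq e₁).mono (by simp only [hM]; omega)
    · rw [hM] at hb
      simp only [hb]
      have e₂ : Runs p₂ σ (update σ dst (h x)) (P₂.eval (size x + (σ dst).length)) := hp₂ σ h0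
      exact (c.seq e₂).mono (by simp only [hM]; omega)
    · have h1 := (hP x).trans (eval_mono P (Nat.le_add_right _ (σ dst).length))
      have h2 := eval_mono P (Nat.le_add_right (size x) (σ dst).length)
      simp [h0 M le_rfl]
      omega

/-- The intermediate value lives on the first scratch stack, and the program for `F` uses the
scratch space above it. Repeating this gives substitution without encoding tuples as strings. -/
theorem let_ (hg : PolyTime g) {F : (Fin (m + 1) → List Sym) → List Sym} (hF : PolyTime F) :
    PolyTime fun x => F (Fin.cons (g x) x) := by
  obtain ⟨P, hP, hp⟩ := hg
  obtain ⟨P₁, hP₁, hp₁⟩ := hF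
  refine ⟨3 * P + P₁.comp (P + Polynomial.X) + 10, fun x => ?_, fun args dst M ha hd => ?_⟩
  · have h1 := hP₁ (Fin.cons (g x) x)
    rw [size_cons] at h1
    have h2 := eval_mono P₁ (Nat.add_le_add_right (hP x) (size x))
    simp
    omega
  · obtain ⟨p, hp⟩ := hp args M (M + 1) (fun i => (ha i).trans (by omega)) (by omega)
    obtain ⟨p₁, hp₁⟩ := hp₁ (Fin.cons M args) dst (M + 1)
      (fun i => by
        refine Fin.cases ?_ (fun i => ?_) i
        · simp
        · have := ha i
          simp; omega) (by omega)
    refine ⟨.seq p (.seq p₁ (clear M)), fun σ h0 => ?_⟩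
    have e := hp σ (fun j hj => h0 j (by omega))
    set x := fun i => σ (args i) with hx
    have e₁ := hp₁ (update σ M (g x)) (fun j hj => by
      rw [update_of_ne (by omega)]; exact h0 j (by omega))
    have ex : (fun i => update σ M (g x) ((Fin.cons M args : Fin (m + 1) → ℕ) i)) =
        Fin.cons (g x) x := by
      funext i
      refine Fin.cases ?_ (fun i => ?_) i
      · simp
      · simp [hx, (ha i).ne]
    rw [ex] at e₁
    have hM : M ≠ dst := by omega
    refine (e.seq (e₁.seq (clear_runs M _))).of_eq ?_ ?_
    · rw [update_comm hM.symm, update_idem, ← h0 M le_rfl, update_eq_self]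
    · rw [size_cons]
      have h1 := hP x
      have h2 := eval_mono P (Nat.le_add_right (size x) (σ dst).length)
      have h3 := eval_mono P₁ (a := (g x).length + size x + (σ dst).length)
        (b := P.eval (size x + (σ dst).length) + (size x + (σ dst).length)) (by omega)
      simp [h0 M le_rfl, hM, hM.symm]
      omega

theorem reindex {k : ℕ} {F : (Fin k → List Sym) → List Sym} (hF : PolyTime F) (ρ : Fin k → Fin m) :
    PolyTime fun x => F fun i => x (ρ i) := by
  obtain ⟨P, hP, hp⟩ := hF
  have key (x : Fin m → List Sym) : size (fun i => x (ρ i)) ≤ k * size x := by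
    refine (Finset.sum_le_sum fun i _ => length_le_size x (ρ i)).trans ?_
    simp
  refine ⟨P.comp (((k + 1 : ℕ) : Polynomial ℕ) * Polynomial.X), fun x => ?_, fun args dst M ha hd => ?_⟩
  · refine (hP _).trans ?_
    simp only [Polynomial.eval_comp, Polynomial.eval_mul, Polynomial.eval_X, Polynomial.eval_natCast]
    exact eval_mono P ((key x).trans (Nat.mul_le_mul_right _ (by simp)))
  · obtain ⟨p, hp⟩ := hp (fun i => args (ρ i)) dst M (fun i => ha _) hd
    refine ⟨p, fun σ h0 => (hp σ h0).mono ?_⟩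
    simp only [Polynomial.eval_comp, Polynomial.eval_mul, Polynomial.eval_X, Polynomial.eval_natCast]
    refine eval_mono P ?_
    have := key fun i => σ (args i)
    simp only [Nat.cast_id]
    nlinarith

/-- Structural recursion on a string, if the values have polynomial length. -/
theorem rec_ {R : List Sym → (Fin m → List Sym) → List Sym} (hb : PolyTime (R []))
    (step : Sym → (Fin (m + 2) → List Sym) → List Sym) (hs : ∀ a, PolyTime (step a))
    (hR : ∀ a l x, R (a :: l) x = step a (Fin.cons l (Fin.cons (R l x) x)))
    (B : Polynomial ℕ) (hB : ∀ l x, (R l x).length ≤ B.eval (l.length + size x)) :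
    PolyTime fun y : Fin (m + 1) → List Sym => R (y 0) fun i => y i.succ := by
  obtain ⟨P, hP, hp⟩ := hb
  choose P₁ hP₁ hp₁ using hs
  set A : Polynomial ℕ := P₁ (.bit true) + P₁ (.bit false) + P₁ .sep with hA
  have hPA (a : Sym) (n : ℕ) : (P₁ a).eval n ≤ A.eval n := by
    rcases a with (_ | _) | _ <;> simp [hA] <;> omega
  -- In the bound `A.comp (X + 2 * B)` for one step of the recursion, the value computed so far
  -- counts twice: as an argument and as the old content of the target stack.
  refine ⟨60 * Polynomial.X + 45 * B + P + Polynomial.X * (A.comp (Polynomial.X + 2 * B) + 10) + 100,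
    fun y => ?_, fun args dst M ha hd => ?_⟩
  · have := hB (y 0) (fun i => y i.succ)
    rw [← size_succ] at this
    simp only [Polynomial.eval_add, Polynomial.eval_mul, Polynomial.eval_ofNat]
    omega
  · obtain ⟨p, hp⟩ := hp (fun i => args i.succ) (M + 2) (M + 3)
      (fun i => (ha _).trans (by omega)) (by omega)
    have key (a : Sym) := hp₁ a (Fin.cons M (Fin.cons (M + 2) fun i => args i.succ)) (M + 2) (M + 3)
      (fun i => by
        refine Fin.cases ?_ (fun i => Fin.cases ?_ (fun i => ?_) i) i
        · simp
        · simp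
        · have := ha i.succ
          simp; omega) (by omega)
    choose q hq using key
    -- The recursion is evaluated from the end of the string: `M + 1` holds the unread part
    -- reversed, `M` the suffix already processed, and `M + 2` the value of `R` on that suffix.
    refine ⟨.seq (copy (args 0) M (M + 1)) (.seq (move M (M + 1)) (.seq p
      (.seq (drain (M + 1) fun a => .seq (q a) (.push M a))
        (.seq (copy (M + 2) dst (M + 3)) (.seq (clear M) (clear (M + 2))))))), fun σ h0 => ?_⟩
    set l := σ (args 0) with hl
    set x := fun i => σ (args (Fin.succ i)) with hx
    have hM := h0 M le_rfl
    have hM1 := h0 (M + 1) (by omega)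
    have hM2 := h0 (M + 2) (by omega)
    have hxa (i : Fin (m + 1)) : args i ≠ M ∧ args i ≠ M + 1 ∧ args i ≠ M + 2 := by
      have := ha i; omega
    have e₁ := copy_runs (s := args 0) (d := M) (M := M + 1) ((ha 0).trans (by omega)) (by omega)
      σ hM1 hM2
    have e₂ := move_runs (i := M) (j := M + 1) (by omega) (update σ M l)
    have e₂' : update (update (update σ M l) (M + 1) ((update σ M l M).reverse ++
        update σ M l (M + 1))) M [] = update σ (M + 1) l.reverse := by
      funext j
      simp only [update_apply]
      split_ifs <;> simp_all
    rw [e₂'] at e₂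
    have e₃ := hp (update σ (M + 1) l.reverse) (fun j hj => by
      rw [update_of_ne (by omega)]; exact h0 j (by omega))
    have ex : (fun i : Fin m => update σ (M + 1) l.reverse (args i.succ)) = x := by
      funext i
      simp [hx, (hxa _).2.1]
    rw [ex] at e₃
    set N := l.length + size x with hN
    obtain ⟨τ, ⟨done, hdone, hτ⟩, e₄⟩ := drain_runs (i := M + 1)
      (f := fun a => .seq (q a) (.push M a))
      (fun rem τ => ∃ done, rem.reverse ++ done = l ∧
        τ = update (update (update σ M done) (M + 2) (R done x)) (M + 1) rem)
      (A.eval (N + 2 * B.eval N) + 2)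
      (by rintro rem τ ⟨done, -, rfl⟩; simp)
      (by
        rintro a rem τ ⟨done, hd, rfl⟩
        refine ⟨_, ⟨a :: done, by simpa using hd, rfl⟩, ?_⟩
        rw [update_idem]
        have e := hq a (update (update (update σ M done) (M + 2) (R done x)) (M + 1) rem)
          (fun j hj => by
            rw [update_of_ne (by omega), update_of_ne (by omega), update_of_ne (by omega)]
            exact h0 j (by omega))
        have ex : (fun i => update (update (update σ M done) (M + 2) (R done x)) (M + 1) rem
            ((Fin.cons M (Fin.cons (M + 2) fun i => args i.succ) : Fin (m + 2) → ℕ) i)) =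
            Fin.cons done (Fin.cons (R done x) x) := by
          funext i
          refine Fin.cases ?_ (fun i => Fin.cases ?_ (fun i => ?_) i) i
          · simp
          · simp
          · simp [hx, hxa i.succ]
        rw [ex, ← hR] at e
        refine (e.seq (Runs.push M a _)).of_eq ?_ ?_
        · funext j
          by_cases h1 : j = M
          · subst h1; simp
          by_cases h2 : j = M + 1
          · subst h2; simp
          by_cases h3 : j = M + 2
          · subst h3; simp
          simp [h1, h2, h3]
        · have hlen : done.length ≤ l.length := by rw [← hd]; simp; omega
          have h1 := (hB done x).trans (eval_mono B (Nat.add_le_add_right hlen _))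
          rw [← hN] at h1
          rw [size_cons, size_cons]
          have h2 := hPA a (done.length + ((R done x).length + size x) + (R done x).length)
          have h3 := eval_mono A (a := done.length + ((R done x).length + size x) + (R done x).length)
            (b := N + 2 * B.eval N) (by omega)
          simp
          omega)
      l.reverse (update (update σ (M + 1) l.reverse) (M + 2) (R [] x))
      ⟨[], by simp, by
        funext j
        simp only [update_apply]
        split_ifs <;> simp_all⟩
    simp only [List.reverse_nil, List.nil_append] at hdone
    subst hdone
    have eτ : τ = update (update σ M l) (M + 2) (R l x) := by
      rw [hτ]
      funext j
      simp only [update_apply]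
      split_ifs <;> simp_all
    rw [eτ] at e₄
    have e₅ := copy_runs (s := M + 2) (d := dst) (M := M + 3) (by omega) (by omega)
      (update (update σ M l) (M + 2) (R l x))
      (by rw [update_of_ne (by omega), update_of_ne (by omega)]; exact h0 _ (by omega))
      (by rw [update_of_ne (by omega), update_of_ne (by omega)]; exact h0 _ (by omega))
    refine (e₁.seq (e₂.seq (e₃.seq (e₄.seq (e₅.seq ((clear_runs M _).seq
      (clear_runs (M + 2) _))))))).of_eq ?_ ?_
    · funext j
      by_cases h1 : j = M
      · subst h1; simp [hM, hd.ne']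
      by_cases h3 : j = M + 2
      · subst h3; simp [hM2, show M + 2 ≠ dst by omega]
      by_cases h2 : j = dst
      · subst h2; simp [h1, h3, hl, hx]
      simp [h1, h2, h3]
    · have hy : size (fun i => σ (args i)) = N := by rw [size_succ]
      rw [hy]
      have h1 := hB l x
      rw [← hN] at h1
      have h2 := eval_mono B (Nat.le_add_right N (σ dst).length)
      have h3 := eval_mono P (a := size x) (b := N + (σ dst).length) (by omega)
      have h4 : l.length * (A.eval (N + 2 * B.eval N) + 2 + 5) ≤
          (N + (σ dst).length) * (A.eval (N + (σ dst).length + 2 * B.eval (N + (σ dst).length)) + 10) :=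
        Nat.mul_le_mul (by omega) (by
          have := eval_mono A (a := N + 2 * B.eval N)
            (b := N + (σ dst).length + 2 * B.eval (N + (σ dst).length)) (by omega)
          omega)
      simp [hM, hM2, show M ≠ dst by omega, show dst ≠ M by omega, show M + 2 ≠ dst by omega,
        show dst ≠ M + 2 by omega, ← hl] at h4 ⊢
      omega

end PolyTime

/-! ### Curried forms of recursion, and basic list operations. -/

namespace PolyTime

variable {m : ℕ} {f g h k : (Fin m → List Sym) → List Sym}

theorem ite_head (a : Sym) (hf : PolyTime f) (hg : PolyTime g) (hh : PolyTime h) :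
    PolyTime fun x => if (f x).head? = some a then g x else h x := by
  simpa using ite (fun o => decide (o = some a)) hf hg hh

theorem ite_nil (hf : PolyTime f) (hg : PolyTime g) (hh : PolyTime h) :
    PolyTime fun x => if f x = [] then g x else h x := by
  simpa using ite (fun o => decide (o = none)) hf hg hh

theorem prepend (c : List Sym) (hf : PolyTime f) : PolyTime fun x => c ++ f x := by
  induction c with
  | nil => exact hf
  | cons a c ih => exact cons a ih

theorem const (c : List Sym) : PolyTime fun _ : Fin m → List Sym => c := by
  simpa using prepend (m := m) c nil

theorem comp₁ {F : List Sym → List Sym} (hF : PolyTime fun y : Fin 1 → List Sym => F (y 0))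
    (hf : PolyTime f) : PolyTime fun x => F (f x) :=
  let_ hf (reindex hF fun _ => 0)

theorem comp₂ {F : List Sym → List Sym → List Sym}
    (hF : PolyTime fun y : Fin 2 → List Sym => F (y 0) (y 1))
    (hf : PolyTime f) (hg : PolyTime g) : PolyTime fun x => F (f x) (g x) :=
  let_ hg (let_ (reindex hf Fin.succ) (reindex hF ![0, 1]))

theorem comp₃ {F : List Sym → List Sym → List Sym → List Sym}
    (hF : PolyTime fun y : Fin 3 → List Sym => F (y 0) (y 1) (y 2))
    (hf : PolyTime f) (hg : PolyTime g) (hh : PolyTime h) : PolyTime fun x => F (f x) (g x) (h x) :=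
  let_ hh (let_ (reindex hg Fin.succ)
    (let_ (reindex hf fun i => i.succ.succ) (reindex hF ![0, 1, 2])))

theorem comp₄ {F : List Sym → List Sym → List Sym → List Sym → List Sym}
    (hF : PolyTime fun y : Fin 4 → List Sym => F (y 0) (y 1) (y 2) (y 3))
    (hf : PolyTime f) (hg : PolyTime g) (hh : PolyTime h) (hk : PolyTime k) :
    PolyTime fun x => F (f x) (g x) (h x) (k x) :=
  let_ hk (let_ (reindex hh Fin.succ) (let_ (reindex hg fun i => i.succ.succ)
    (let_ (reindex hf fun i => i.succ.succ.succ) (reindex hF ![0, 1, 2, 3]))))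

theorem rec₀ {R : List Sym → List Sym} (step : Sym → List Sym → List Sym → List Sym)
    (hs : ∀ a, PolyTime fun z : Fin 2 → List Sym => step a (z 0) (z 1))
    (hR : ∀ a l, R (a :: l) = step a l (R l)) (B : Polynomial ℕ)
    (hB : ∀ l, (R l).length ≤ B.eval l.length) (hf : PolyTime f) : PolyTime fun x => R (f x) :=
  comp₁ (rec_ (R := fun l (_ : Fin 0 → List Sym) => R l) (const _)
    (fun a z => step a (z 0) (z 1)) hs (fun a l _ => hR a l) B
    fun l _ => (hB l).trans (eval_mono B (Nat.le_add_right _ _))) hf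

theorem rec₁ {R : List Sym → List Sym → List Sym}
    (hb : PolyTime fun y : Fin 1 → List Sym => R [] (y 0))
    (step : Sym → List Sym → List Sym → List Sym → List Sym)
    (hs : ∀ a, PolyTime fun z : Fin 3 → List Sym => step a (z 0) (z 1) (z 2))
    (hR : ∀ a l p, R (a :: l) p = step a l (R l p) p) (B : Polynomial ℕ)
    (hB : ∀ l p, (R l p).length ≤ B.eval (l.length + p.length))
    (hf : PolyTime f) (hg : PolyTime g) : PolyTime fun x => R (f x) (g x) :=
  comp₂ (rec_ (R := fun l (x : Fin 1 → List Sym) => R l (x 0)) hb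
    (fun a z => step a (z 0) (z 1) (z 2)) hs (fun a l _ => hR a l _) B
    fun l x => (hB l _).trans (eval_mono B (by simp [size]))) hf hg

theorem rec₂ {R : List Sym → List Sym → List Sym → List Sym}
    (hb : PolyTime fun y : Fin 2 → List Sym => R [] (y 0) (y 1))
    (step : Sym → List Sym → List Sym → List Sym → List Sym → List Sym)
    (hs : ∀ a, PolyTime fun z : Fin 4 → List Sym => step a (z 0) (z 1) (z 2) (z 3))
    (hR : ∀ a l p q, R (a :: l) p q = step a l (R l p q) p q) (B : Polynomial ℕ)
    (hB : ∀ l p q, (R l p q).length ≤ B.eval (l.length + p.length + q.length))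
    (hf : PolyTime f) (hg : PolyTime g) (hh : PolyTime h) :
    PolyTime fun x => R (f x) (g x) (h x) :=
  comp₃ (rec_ (R := fun l (x : Fin 2 → List Sym) => R l (x 0) (x 1)) hb
    (fun a z => step a (z 0) (z 1) (z 2) (z 3)) hs (fun a l _ => hR a l _ _) B
    fun l x => (hB l _ _).trans (eval_mono B (by simp [size, Fin.sum_univ_two, add_assoc]))) hf hg hh

theorem rec₃ {R : List Sym → List Sym → List Sym → List Sym → List Sym}
    (hb : PolyTime fun y : Fin 3 → List Sym => R [] (y 0) (y 1) (y 2))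
    (step : Sym → List Sym → List Sym → List Sym → List Sym → List Sym → List Sym)
    (hs : ∀ a, PolyTime fun z : Fin 5 → List Sym => step a (z 0) (z 1) (z 2) (z 3) (z 4))
    (hR : ∀ a l p q r, R (a :: l) p q r = step a l (R l p q r) p q r) (B : Polynomial ℕ)
    (hB : ∀ l p q r, (R l p q r).length ≤ B.eval (l.length + p.length + q.length + r.length))
    (hf : PolyTime f) (hg : PolyTime g) (hh : PolyTime h) (hk : PolyTime k) :
    PolyTime fun x => R (f x) (g x) (h x) (k x) :=
  comp₄ (rec_ (R := fun l (x : Fin 3 → List Sym) => R l (x 0) (x 1) (x 2)) hb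
    (fun a z => step a (z 0) (z 1) (z 2) (z 3) (z 4)) hs (fun a l _ => hR a l _ _ _) B
    fun l x => (hB l _ _ _).trans (eval_mono B (by simp [size, Fin.sum_univ_three, add_assoc])))
    hf hg hh hk

theorem append (hf : PolyTime f) (hg : PolyTime g) : PolyTime fun x => f x ++ g x :=
  rec₁ (R := fun l p => l ++ p) (proj 0) (fun a _ acc _ => a :: acc) (fun a => (proj 1).cons a)
    (fun _ _ _ => rfl) Polynomial.X (fun l p => by simp) hf hg

theorem flatMap (c : Sym → List Sym) (hf : PolyTime f) : PolyTime fun x => (f x).flatMap c := by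
  refine rec₀ (R := fun l => l.flatMap c) (fun a _ acc => c a ++ acc) (fun a => (proj 1).prepend _)
    (fun a l => by simp)
    ((((c (.bit true)).length + (c (.bit false)).length + (c .sep).length : ℕ) : Polynomial ℕ) *
      Polynomial.X) (fun l => ?_) hf
  induction l with
  | nil => simp
  | cons a l ih =>
    simp only [Polynomial.eval_mul, Polynomial.eval_natCast, Polynomial.eval_X, List.flatMap_cons,
      List.length_append, List.length_cons, Nat.cast_id, mul_add, mul_one] at ih ⊢
    rcases a with (_ | _) | _ <;> omega

theorem reverse (hf : PolyTime f) : PolyTime fun x => (f x).reverse :=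
  rec₀ (R := List.reverse) (fun a _ acc => acc ++ [a]) (fun a => (proj 1).append (const _))
    (fun a l => by simp) Polynomial.X (fun l => by simp) hf

/-- The length of a string serves as a number. -/
theorem drop (hf : PolyTime f) (hg : PolyTime g) : PolyTime fun x => (g x).drop (f x).length :=
  rec₁ (R := fun l p => p.drop l.length) (proj 0) (fun _ _ acc _ => acc.tail)
    (fun _ => (proj 1).tail) (fun _ _ _ => by simp) Polynomial.X (fun l p => by simp; omega) hf hg

theorem take_one (hf : PolyTime f) : PolyTime fun x => (f x).take 1 := by
  convert ite_head (.bit true) hf (const [.bit true]) (ite_head (.bit false) hf (const [.bit false])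
    (ite_head .sep hf (const [.sep]) nil)) using 2 with x
  rcases f x with _ | ⟨(_ | _) | _, l⟩ <;> simp

theorem take (hf : PolyTime f) (hg : PolyTime g) : PolyTime fun x => (g x).take (f x).length :=
  rec₁ (R := fun l p => p.take l.length) (const [])
    (fun _ l acc p => acc ++ (p.drop l.length).take 1)
    (fun _ => (proj 1).append ((proj 0).drop (proj 2)).take_one)
    (fun _ _ _ => by simp [List.take_add]) Polynomial.X (fun l p => by simp) hf hg

end PolyTime

/-- The part of a string before the first separator. -/
def before : List Sym → List Sym
  | [] => []
  | a :: l => if a = .sep then [] else a :: before l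

/-- The part of a string after the first separator. -/
def after : List Sym → List Sym
  | [] => []
  | a :: l => if a = .sep then l else after l

def zeros (l : List Sym) : List Sym := l.flatMap fun _ => [.bit false]

/-- The Kronecker product of two bit strings. -/
def kron : List Sym → List Sym → List Sym
  | [], _ => []
  | a :: l, y => (if a = .bit true then y else zeros y) ++ kron l y

/-- A Kronecker power, truncated to the length of `d`. -/
def kronPow : List Sym → List Sym → List Sym → List Sym
  | [], _, _ => [.bit true]
  | _ :: l, u, d => (kron u (kronPow l u d)).take d.length

/-- Each bit becomes the bit string that indicates its value. -/
def oneHotBits (l : List Sym) : List Sym :=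
  l.flatMap fun a => if a = .bit true then [.bit false, .bit true] else [.bit true, .bit false]

/-- The vector with entries 0 and 1 given by a bit string. -/
def bitVecCode (l : List Sym) : List Sym :=
  l.flatMap fun a => .bit false :: (if a = .bit true then [.bit true] else []) ++
    [.sep, .bit true, .sep]

def allBits : List Sym → List Sym
  | [] => [.bit true]
  | a :: l => if a = .sep then [] else allBits l

def headNe (x y : List Sym) : List Sym := if x.head? = y.head? then [] else [.bit true]

def negHead (y : List Sym) : List Sym :=
  if y.head? = some (.bit true) then .bit false :: y.tail else .bit true :: y.tail

def flipAt (i x : List Sym) : List Sym := x.take i.length ++ negHead (x.drop i.length)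

theorem length_zeros (l : List Sym) : (zeros l).length = l.length := by
  simp [zeros]

theorem length_kron (x y : List Sym) : (kron x y).length = x.length * y.length := by
  induction x with
  | nil => simp [kron]
  | cons a l ih =>
    rw [kron, List.length_append, ih]
    split_ifs <;> simp [length_zeros] <;> ring

/-! ### Polynomial time for separators, Kronecker products and bit flips. -/

namespace PolyTime

variable {m : ℕ} {f g h k : (Fin m → List Sym) → List Sym}

theorem zeros (hf : PolyTime f) : PolyTime fun x => zeros (f x) := hf.flatMap _

theorem oneHotBits (hf : PolyTime f) : PolyTime fun x => oneHotBits (f x) := hf.flatMap _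

theorem bitVecCode (hf : PolyTime f) : PolyTime fun x => bitVecCode (f x) := hf.flatMap _

theorem before (hf : PolyTime f) : PolyTime fun x => before (f x) := by
  refine rec₀ (R := LinRL.before) (fun a _ acc => if a = .sep then [] else a :: acc) (fun a => ?_)
    (fun a l => rfl) Polynomial.X (fun l => ?_) hf
  · split_ifs
    · exact nil
    · exact (proj 1).cons a
  · induction l with
    | nil => simp [LinRL.before]
    | cons a l ih =>
      rw [LinRL.before]
      simp at ih
      split_ifs <;> simp [ih]

theorem length_after_le (l : List Sym) : (LinRL.after l).length ≤ l.length := by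
  induction l with
  | nil => simp [LinRL.after]
  | cons a l ih =>
    rw [LinRL.after]
    split_ifs <;> simp
    omega

theorem after (hf : PolyTime f) : PolyTime fun x => after (f x) := by
  refine rec₀ (R := LinRL.after) (fun a l acc => if a = .sep then l else acc) (fun a => ?_)
    (fun a l => rfl) Polynomial.X (fun l => by simpa using length_after_le l) hf
  split_ifs
  · exact proj 0
  · exact proj 1

theorem kron (hf : PolyTime f) (hg : PolyTime g) : PolyTime fun x => kron (f x) (g x) := by
  refine rec₁ (R := LinRL.kron) (const []) (fun a _ acc p =>
    (if a = .bit true then p else LinRL.zeros p) ++ acc) (fun a => ?_) (fun a l p => rfl)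
    (Polynomial.X * Polynomial.X) (fun l p => ?_) hf hg
  · split_ifs
    · exact (proj 2).append (proj 1)
    · exact (proj 2).zeros.append (proj 1)
  · rw [length_kron]
    simpa using Nat.mul_le_mul (Nat.le_add_right l.length p.length) (Nat.le_add_left p.length l.length)

theorem kronPow (hf : PolyTime f) (hg : PolyTime g) (hh : PolyTime h) :
    PolyTime fun x => kronPow (f x) (g x) (h x) := by
  refine rec₂ (R := LinRL.kronPow) (const _) (fun _ _ acc u d => (LinRL.kron u acc).take d.length)
    (fun _ => (proj 3).take ((proj 2).kron (proj 1))) (fun _ _ _ _ => rfl) (Polynomial.X + 1)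
    (fun l p q => ?_) hf hg hh
  cases l with
  | nil => simp [LinRL.kronPow]
  | cons a l => simp [LinRL.kronPow]; omega

theorem allBits (hf : PolyTime f) : PolyTime fun x => allBits (f x) := by
  refine rec₀ (R := LinRL.allBits) (fun a _ acc => if a = .sep then [] else acc) (fun a => ?_)
    (fun a l => rfl) 1 (fun l => ?_) hf
  · split_ifs
    · exact nil
    · exact proj 1
  · induction l with
    | nil => simp [LinRL.allBits]
    | cons a l ih =>
      rw [LinRL.allBits]
      simp at ih
      split_ifs <;> simp [ih]

theorem headNe (hf : PolyTime f) (hg : PolyTime g) : PolyTime fun x => headNe (f x) (g x) := by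
  convert ite_head (.bit true) hf (ite_head (.bit true) hg nil (const [.bit true]))
    (ite_head (.bit false) hf (ite_head (.bit false) hg nil (const [.bit true]))
    (ite_head .sep hf (ite_head .sep hg nil (const [.bit true]))
    (ite_nil hg nil (const [.bit true])))) using 2 with x
  rcases f x with _ | ⟨(_ | _) | _, l⟩ <;> rcases g x with _ | ⟨(_ | _) | _, l'⟩ <;>
    simp [LinRL.headNe]

theorem negHead (hf : PolyTime f) : PolyTime fun x => negHead (f x) :=
  ite_head _ hf (hf.tail.cons _) (hf.tail.cons _)

theorem flipAt (hf : PolyTime f) (hg : PolyTime g) : PolyTime fun x => flipAt (f x) (g x) :=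
  (hf.take hg).append (hf.drop hg).negHead

end PolyTime
/-! String functions behind the oracle answers. A state is a string `x` with a phase bit followed by
an assignment and a bit for each unit of time; `φ` encodes the clauses; `n`, `h` and `r` are numbers
in unary notation, and `d` is a string whose length is the feature dimension. -/

/-- Nonempty if the literal with code `t` is false in the state `x`. -/
def falseLit (t x : List Sym) : List Sym := headNe t (x.tail.drop t.tail.length)

/-- Nonempty if the first clause in `c` is false in the state `x`. -/
def falseClause (c x : List Sym) : List Sym :=
  if falseLit (before c) x = [] then []
  else if falseLit (before (after c)) x = [] then []
  else falseLit (before (after (after c))) x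

/-- Skip clauses that are true in the state `x`, at most as many as the length of the first
argument. -/
def skipTrue : List Sym → List Sym → List Sym → List Sym
  | [], _, φ => φ
  | _ :: l, x, φ =>
    if falseClause (skipTrue l x φ) x = [] then after (after (after (skipTrue l x φ)))
    else skipTrue l x φ

/-- The clauses from the first one that is false in the state `x`. -/
def firstFalse (x φ : List Sym) : List Sym := skipTrue φ x φ

/-- Nonempty if `x` is the name of a state. -/
def isState (x n h : List Sym) : List Sym :=
  if allBits x = [] then []
  else if x.drop n.length = [] then []
  else if ((x.drop n.length).drop h.length).tail = [] then [.bit true] else []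

/-- Nonempty if `x` is the name of a state with a satisfying assignment. -/
def satState (x φ n h : List Sym) : List Sym :=
  if isState x n h = [] then [] else if firstFalse x φ = [] then [.bit true] else []

def flipState (t x : List Sym) : List Sym :=
  .bit false :: (flipAt t.tail x.tail ++ [.bit true])

def nextCore (a : Fin 2) (x c : List Sym) : List Sym :=
  if x.head? = some (.bit true) then
    if a = 0 then flipState (before (after c)) x else flipState (before (after (after c))) x
  else if a = 0 then flipState (before c) x else .bit true :: x.tail

def nextStr (a : Fin 2) (x φ n h : List Sym) : List Sym :=
  if isState x n h = [] then [.sep]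
  else if firstFalse x φ = [] then [.sep]
  else if (x.drop n.length).drop h.length = [] then nextCore a x (firstFalse x φ)
  else [.sep]

def litVec (t n : List Sym) : List Sym :=
  (zeros t.tail ++ zeros t.tail) ++ (oneHotBits (t.take 1) ++
    (zeros (n.drop t.tail.length).tail ++ zeros (n.drop t.tail.length).tail))

def oneVec (n : List Sym) : List Sym := .bit true :: .bit true :: (zeros n.tail ++ zeros n.tail)

def levelVec (t h : List Sym) : List Sym :=
  zeros t ++ .bit true :: zeros ((.bit true :: h).drop t.length)

def slot (l p q U : List Sym) : List Sym := kron l (kron p (kron q U))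

def level (x n : List Sym) : List Sym := (x.drop n.length).tail

def mainFeat (x n h U : List Sym) : List Sym :=
  slot (levelVec (level x n) h) (oneVec n) (oneVec n) U ++
    (zeros (slot (levelVec (level x n) h) (oneVec n) (oneVec n) U) ++
      zeros (slot (levelVec (level x n) h) (oneVec n) (oneVec n) U))

def midFeat (x n h U b c : List Sym) : List Sym :=
  slot (levelVec (.bit true :: .bit true :: level x n) h) (litVec (negHead b) n)
      (litVec (negHead c) n) U ++
    (slot (levelVec (level x n) h) (litVec (negHead b) n) (litVec c n) U ++
      slot (levelVec (level x n) h) (litVec b n) (oneVec n) U)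

def monomials (x n r d : List Sym) : List Sym := kronPow r (oneHotBits (x.tail.take n.length)) d

def feat (x φ n h r d : List Sym) : List Sym :=
  if x.head? = some (.bit true) then
    if firstFalse x φ = [] then mainFeat x n h (monomials x n r d)
    else if (x.drop n.length).drop h.length = [] then
      midFeat x n h (monomials x n r d) (before (after (firstFalse x φ)))
        (before (after (after (firstFalse x φ))))
    else mainFeat x n h (monomials x n r d)
  else mainFeat x n h (monomials x n r d)

/-- The state at which the action value is read off. -/
def nextOrSelf (a : Fin 2) (x φ n h : List Sym) : List Sym :=
  if (nextStr a x φ n h).head? = some .sep then x else nextStr a x φ n h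

/-- The answers of the oracle, with all rewards zero. -/
def answerStr (o : RLCall 2) (y : Fin 6 → List Sym) : List Sym :=
  match o with
  | .next a => nextStr a (y 0) (y 1) (y 2) (y 3)
  | .reward _ => if isState (y 0) (y 2) (y 3) = [] then [.sep] else
      [.bit false, .sep, .bit true, .sep]
  | .featS => if isState (y 0) (y 2) (y 3) = [] then [.sep] else
      bitVecCode (feat (y 0) (y 1) (y 2) (y 3) (y 4) (y 5))
  | .featSA a => if isState (y 0) (y 2) (y 3) = [] then [.sep] else
      bitVecCode (feat (nextOrSelf a (y 0) (y 1) (y 2) (y 3)) (y 1) (y 2) (y 3) (y 4) (y 5))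

/-- The state after the actions with the given code (in reverse order); satisfying states are not
left. -/
def pathEnd : List Sym → List Sym → List Sym → List Sym → List Sym
  | [], _, n, _ => .bit false :: zeros n
  | a :: l, φ, n, h =>
    if a = .sep then
      if satState (pathEnd l φ n h) φ n h = [] then
        if l.head? = some (.bit true) then nextStr 1 (pathEnd l φ n h) φ n h
        else nextStr 0 (pathEnd l φ n h) φ n h
      else pathEnd l φ n h
    else pathEnd l φ n h

/-- The final output, which depends on the output `y` of the algorithm and on the flag `e`. -/
def verdict (y φ n h e : List Sym) : List Sym :=
  if e = [] then satState (pathEnd y.reverse φ n h) φ n h else [.bit true]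

theorem length_skipTrue_le (l x φ : List Sym) : (skipTrue l x φ).length ≤ φ.length := by
  induction l with
  | nil => simp [skipTrue]
  | cons a l ih =>
    rw [skipTrue]
    split_ifs
    · exact ((PolyTime.length_after_le _).trans ((PolyTime.length_after_le _).trans
        (PolyTime.length_after_le _))).trans ih
    · exact ih

theorem length_flipState_le (t x : List Sym) : (flipState t x).length ≤ x.length + 3 := by
  have h1 : (negHead (x.tail.drop t.tail.length)).length ≤ (x.tail.drop t.tail.length).length + 1 := by
    rw [negHead]; split_ifs <;> simp <;> omega
  simp [flipState, flipAt] at h1 ⊢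
  omega

theorem length_nextStr_le (a : Fin 2) (x φ n h : List Sym) :
    (nextStr a x φ n h).length ≤ n.length + h.length + 5 := by
  have hl (t : List Sym) := length_flipState_le t x
  rw [nextStr]
  split_ifs with h1 h2 h3
  · simp
  · simp
  · have hx : x.length ≤ n.length + h.length + 1 := by
      have := congrArg List.length h3
      simp at this; omega
    rw [nextCore]
    have h1 := hl (before (after (firstFalse x φ)))
    have h2 := hl (before (after (after (firstFalse x φ))))
    have h3 := hl (before (firstFalse x φ))
    split_ifs <;> simp <;> omega
  · simp

theorem length_pathEnd_le (l φ n h : List Sym) :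
    (pathEnd l φ n h).length ≤ n.length + h.length + 5 := by
  induction l with
  | nil => simp [pathEnd, length_zeros]; omega
  | cons a l ih =>
    rw [pathEnd]
    split_ifs
    · exact length_nextStr_le _ _ _ _ _
    · exact length_nextStr_le _ _ _ _ _
    · exact ih
    · exact ih

/-! ### Polynomial time for the oracle answers and the final verdict. -/

namespace PolyTime

variable {m : ℕ} {f g h k f₁ f₂ f₃ : (Fin m → List Sym) → List Sym}

theorem falseLit (hf : PolyTime f) (hg : PolyTime g) : PolyTime fun x => falseLit (f x) (g x) :=
  hf.headNe (hf.tail.drop hg.tail)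

theorem falseClause (hf : PolyTime f) (hg : PolyTime g) :
    PolyTime fun x => falseClause (f x) (g x) :=
  ite_nil (hf.before.falseLit hg) nil
    (ite_nil (hf.after.before.falseLit hg) nil (hf.after.after.before.falseLit hg))

theorem skipTrue (hf : PolyTime f) (hg : PolyTime g) (hh : PolyTime h) :
    PolyTime fun x => skipTrue (f x) (g x) (h x) := by
  refine rec₂ (R := LinRL.skipTrue) (proj 1) (fun _ _ acc x _ =>
    if LinRL.falseClause acc x = [] then LinRL.after (LinRL.after (LinRL.after acc)) else acc)
    (fun _ => ite_nil ((proj 1).falseClause (proj 2)) (proj 1).after.after.after (proj 1))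
    (fun _ _ _ _ => rfl) Polynomial.X (fun l p q => ?_) hf hg hh
  have := length_skipTrue_le l p q
  simp
  omega

theorem firstFalse (hf : PolyTime f) (hg : PolyTime g) :
    PolyTime fun x => firstFalse (f x) (g x) :=
  hg.skipTrue hf hg

theorem isState (hf : PolyTime f) (hg : PolyTime g) (hh : PolyTime h) :
    PolyTime fun x => isState (f x) (g x) (h x) :=
  ite_nil hf.allBits nil (ite_nil (hg.drop hf) nil
    (ite_nil (hh.drop (hg.drop hf)).tail (const _) nil))

theorem satState (hf : PolyTime f) (hg : PolyTime g) (hh : PolyTime h) (hk : PolyTime k) :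
    PolyTime fun x => satState (f x) (g x) (h x) (k x) :=
  ite_nil (hf.isState hh hk) nil (ite_nil (hf.firstFalse hg) (const _) nil)

theorem flipState (hf : PolyTime f) (hg : PolyTime g) :
    PolyTime fun x => flipState (f x) (g x) :=
  ((hf.tail.flipAt hg.tail).append (const _)).cons _

theorem nextCore (a : Fin 2) (hf : PolyTime f) (hg : PolyTime g) :
    PolyTime fun x => nextCore a (f x) (g x) := by
  by_cases ha : a = 0
  · simpa only [LinRL.nextCore, ha, if_true] using
      ite_head (.bit true) hf (hg.after.before.flipState hf) (hg.before.flipState hf)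
  · simpa only [LinRL.nextCore, ha, if_false] using
      ite_head (.bit true) hf (hg.after.after.before.flipState hf) (hf.tail.cons _)

theorem nextStr (a : Fin 2) (hf : PolyTime f) (hg : PolyTime g) (hh : PolyTime h)
    (hk : PolyTime k) : PolyTime fun x => nextStr a (f x) (g x) (h x) (k x) :=
  ite_nil (hf.isState hh hk) (const _) (ite_nil (hf.firstFalse hg) (const _)
    (ite_nil (hk.drop (hh.drop hf)) (hf.nextCore a (hf.firstFalse hg)) (const _)))

theorem litVec (hf : PolyTime f) (hg : PolyTime g) : PolyTime fun x => litVec (f x) (g x) :=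
  (hf.tail.zeros.append hf.tail.zeros).append (hf.take_one.oneHotBits.append
    ((hf.tail.drop hg).tail.zeros.append (hf.tail.drop hg).tail.zeros))

theorem oneVec (hf : PolyTime f) : PolyTime fun x => oneVec (f x) :=
  ((hf.tail.zeros.append hf.tail.zeros).cons _).cons _

theorem levelVec (hf : PolyTime f) (hg : PolyTime g) : PolyTime fun x => levelVec (f x) (g x) :=
  hf.zeros.append ((hf.drop (hg.cons _)).zeros.cons _)

theorem slot (hf : PolyTime f) (hg : PolyTime g) (hh : PolyTime h) (hk : PolyTime k) :
    PolyTime fun x => slot (f x) (g x) (h x) (k x) :=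
  hf.kron (hg.kron (hh.kron hk))

theorem level (hf : PolyTime f) (hg : PolyTime g) : PolyTime fun x => level (f x) (g x) :=
  (hg.drop hf).tail

theorem mainFeat (hf : PolyTime f) (hg : PolyTime g) (hh : PolyTime h) (hk : PolyTime k) :
    PolyTime fun x => mainFeat (f x) (g x) (h x) (k x) := by
  have hs := ((hf.level hg).levelVec hh).slot hg.oneVec hg.oneVec hk
  exact hs.append (hs.zeros.append hs.zeros)

theorem midFeat (hf : PolyTime f) (hg : PolyTime g) (hh : PolyTime h) (hk : PolyTime k)
    (h₁ : PolyTime f₁) (h₂ : PolyTime f₂) :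
    PolyTime fun x => midFeat (f x) (g x) (h x) (k x) (f₁ x) (f₂ x) :=
  (((((hf.level hg).cons _).cons _).levelVec hh).slot (h₁.negHead.litVec hg)
    (h₂.negHead.litVec hg) hk).append
    ((((hf.level hg).levelVec hh).slot (h₁.negHead.litVec hg) (h₂.litVec hg) hk).append
      (((hf.level hg).levelVec hh).slot (h₁.litVec hg) hg.oneVec hk))

theorem monomials (hf : PolyTime f) (hg : PolyTime g) (hh : PolyTime h) (hk : PolyTime k) :
    PolyTime fun x => monomials (f x) (g x) (h x) (k x) :=
  hh.kronPow (hg.take hf.tail).oneHotBits hk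

theorem feat (hf : PolyTime f) (h₁ : PolyTime f₁) (hg : PolyTime g) (hh : PolyTime h)
    (h₂ : PolyTime f₂) (h₃ : PolyTime f₃) :
    PolyTime fun x => feat (f x) (f₁ x) (g x) (h x) (f₂ x) (f₃ x) := by
  have hu := hf.monomials hg h₂ h₃
  have hm := hf.mainFeat hg hh hu
  have hc := hf.firstFalse h₁
  exact ite_head _ hf (ite_nil hc hm (ite_nil (hh.drop (hg.drop hf))
    (hf.midFeat hg hh hu hc.after.before hc.after.after.before) hm)) hm

theorem nextOrSelf (a : Fin 2) (hf : PolyTime f) (hg : PolyTime g) (hh : PolyTime h)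
    (hk : PolyTime k) : PolyTime fun x => nextOrSelf a (f x) (g x) (h x) (k x) :=
  ite_head _ (hf.nextStr a hg hh hk) hf (hf.nextStr a hg hh hk)

theorem answerStr (o : RLCall 2) : PolyTime (answerStr o) := by
  have hs : PolyTime fun y : Fin 6 → List Sym => LinRL.isState (y 0) (y 2) (y 3) :=
    (proj 0).isState (proj 2) (proj 3)
  cases o with
  | next a => exact (proj 0).nextStr a (proj 1) (proj 2) (proj 3)
  | reward a => exact ite_nil hs (const _) (const _)
  | featS =>
    exact ite_nil hs (const _)
      ((proj 0).feat (proj 1) (proj 2) (proj 3) (proj 4) (proj 5)).bitVecCode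
  | featSA a =>
    exact ite_nil hs (const _)
      (((proj 0).nextOrSelf a (proj 1) (proj 2) (proj 3)).feat
        (proj 1) (proj 2) (proj 3) (proj 4) (proj 5)).bitVecCode

theorem pathEnd (hf : PolyTime f) (hg : PolyTime g) (hh : PolyTime h) (hk : PolyTime k) :
    PolyTime fun x => pathEnd (f x) (g x) (h x) (k x) := by
  refine rec₃ (R := LinRL.pathEnd) ((proj 1).zeros.cons _) (fun a l acc φ n h =>
    if a = .sep then
      if LinRL.satState acc φ n h = [] then
        if l.head? = some (.bit true) then LinRL.nextStr 1 acc φ n h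
        else LinRL.nextStr 0 acc φ n h
      else acc
    else acc) (fun a => ?_) (fun _ _ _ _ _ => rfl) (Polynomial.X + 5) (fun l p q r => ?_) hf hg hh hk
  · split_ifs
    · exact ite_nil ((proj 1).satState (proj 2) (proj 3) (proj 4)) (ite_head _ (proj 0)
        ((proj 1).nextStr 1 (proj 2) (proj 3) (proj 4))
        ((proj 1).nextStr 0 (proj 2) (proj 3) (proj 4))) (proj 1)
    · exact proj 1
  · have := length_pathEnd_le l p q r
    simp
    omega

theorem verdict (hf : PolyTime f) (h₁ : PolyTime f₁) (hg : PolyTime g) (hh : PolyTime h)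
    (h₂ : PolyTime f₂) : PolyTime fun x => verdict (f x) (f₁ x) (g x) (h x) (f₂ x) :=
  ite_nil h₂ ((hf.reverse.pathEnd h₁ hg hh).satState h₁ hg hh) (const _)

end PolyTime
-- Probabilities of events under a random continuation.
section Prob

variable {α β : Type}

theorem bind_congr_support (p : PMF α) {f g : α → PMF β} (h : ∀ a ∈ p.support, f a = g a) :
    p.bind f = p.bind g := by
  ext b
  simp only [PMF.bind_apply]
  refine tsum_congr fun a => ?_
  by_cases ha : a ∈ p.support
  · rw [h a ha]
  · rw [(PMF.apply_eq_zero_iff p a).2 ha]; simp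

theorem prob_bind (p : PMF α) (f : α → PMF β) (E : Set β) :
    prob (p.bind f) E = ∑' a, p a * prob (f a) E := by
  simp [prob, PMF.toOuterMeasure_bind_apply]

theorem prob_le_one (p : PMF α) (E : Set α) : prob p E ≤ 1 := by
  calc prob p E ≤ prob p Set.univ := p.toOuterMeasure.mono (Set.subset_univ _)
    _ = 1 := (PMF.toOuterMeasure_apply_eq_one_iff p _).2 (Set.subset_univ _)

theorem prob_mono (p : PMF α) {E E' : Set α} (h : E ⊆ E') : prob p E ≤ prob p E' :=
  p.toOuterMeasure.mono h

theorem prob_pure_of_mem {a : α} {E : Set α} (h : a ∈ E) : prob (PMF.pure a) E = 1 := by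
  simp [prob, h]

theorem prob_pure_of_notMem {a : α} {E : Set α} (h : a ∉ E) : prob (PMF.pure a) E = 0 := by
  simp [prob, h]

/-- Replacing a random answer by its likely value `a` costs at most `ε`: the other outcomes have
total probability at most `ε`, and `g` is at most 1. -/
theorem tsum_mul_le_of_likely (p : PMF α) (g : α → ENNReal) (hg : ∀ a, g a ≤ 1) (a : α)
    {ε : ENNReal} (h : 1 ≤ p a + ε) : ∑' b, p b * g b ≤ g a + ε := by
  classical
  have h1 : ∑' b, p b = p a + ∑' b, if b = a then 0 else p b :=
    ENNReal.tsum_eq_add_tsum_ite a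
  have h2 : ∑' b, p b * g b = p a * g a + ∑' b, if b = a then 0 else p b * g b :=
    ENNReal.tsum_eq_add_tsum_ite a
  rw [PMF.tsum_coe] at h1
  rw [h1, ENNReal.add_le_add_iff_left (PMF.apply_ne_top p a)] at h
  rw [h2]
  have h3 : p a * g a ≤ g a := by
    calc p a * g a ≤ 1 * g a := by gcongr; exact PMF.coe_le_one p a
      _ = g a := one_mul _
  refine add_le_add h3 (le_trans (ENNReal.tsum_le_tsum fun b => ?_) h)
  split_ifs
  · exact le_rfl
  · calc p b * g b ≤ p b * 1 := by gcongr; exact hg b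
      _ = p b := mul_one _

end Prob

/-! ### Simulation of an oracle machine by a machine without oracle. -/

theorem steps_stable {Q : Type} (O : Oracle Q) {T T' : ℕ} {c : Config Q}
    (h : ∀ c' ∈ (steps O T c).support, c'.1 = []) (hT : T ≤ T') :
    steps O T' c = steps O T c := by
  obtain ⟨k, rfl⟩ := Nat.exists_eq_add_of_le hT
  rw [steps_add]
  conv_rhs => rw [← PMF.bind_pure (steps O T c)]
  refine bind_congr_support _ fun c' hc' => ?_
  obtain ⟨K, σ⟩ := c'
  have := h _ hc'
  simp only at this
  subst this
  exact steps_nil O k σ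

/-- After at most `T` steps the computation has halted whatever the random choices are, the
probability of YES is at least `ρ`, and YES is possible only if `B` holds. -/
def Accepts (B : Prop) (c : Config Empty) (T : ℕ) (ρ : ENNReal) : Prop :=
  (∀ c' ∈ (steps noOracle T c).support, c'.1 = [] ∧ (c'.2 0 ∈ Yes → B)) ∧
    ρ ≤ prob ((steps noOracle T c).map fun c => c.2 0) Yes

namespace Accepts

variable {B : Prop} {c c' : Config Empty} {T T' t : ℕ} {ρ ρ' : ENNReal}

theorem mono (h : Accepts B c T ρ) (hT : T ≤ T') : Accepts B c T' ρ := by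
  rw [Accepts, steps_stable noOracle (fun c' hc' => (h.1 c' hc').1) hT]
  exact h

theorem of_steps (hc : steps noOracle t c = PMF.pure c') (h : Accepts B c' T ρ) :
    Accepts B c (t + T) ρ := by
  rw [Accepts, steps_add, hc, PMF.pure_bind]
  exact h

theorem of_step (hc : step noOracle c = PMF.pure c') (h : Accepts B c' T ρ) :
    Accepts B c (T + 1) ρ := by
  rw [add_comm]
  exact of_steps (t := 1) (by simp [steps, hc]) h

theorem of_runs {p : Cmd Empty} {K : List (Cmd Empty)} {σ σ' : Store} (hp : Runs p σ σ' t)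
    (h : Accepts B (K, σ') T ρ) : Accepts B (p :: K, σ) (t + T) ρ := by
  obtain ⟨s, hs, hp⟩ := hp
  exact (of_steps (hp K) h).mono (by omega)

end Accepts

theorem tsum_uniform_bool (g : Bool → ENNReal) :
    ∑' b, PMF.uniformOfFintype Bool b * g b = 2⁻¹ * (g false + g true) := by
  rw [tsum_bool]
  simp [mul_add]

theorem Accepts.flip {B : Prop} {i : ℕ} {K : List (Cmd Empty)} {σ : Store} {T : ℕ}
    {ρ : Bool → ENNReal} (h : ∀ b, Accepts B (K, update σ i (.bit b :: σ i)) T (ρ b)) :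
    Accepts B (.flip i :: K, σ) (T + 1) (2⁻¹ * (ρ false + ρ true)) := by
  rw [Accepts, steps, step, PMF.bind_map]
  refine ⟨fun c' hc' => ?_, ?_⟩
  · obtain ⟨b, -, hb⟩ := (PMF.mem_support_bind_iff _ _ _).1 hc'
    exact (h b).1 c' hb
  · rw [PMF.map_bind, prob_bind, tsum_uniform_bool]
    gcongr
    · exact (h false).2
    · exact (h true).2

/-- All stacks mentioned in the program have index below `N`. -/
def Cmd.Below {Q : Type} (N : ℕ) : Cmd Q → Prop
  | .push i _ => i < N
  | .pop i => i < N
  | .flip i => i < N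
  | .call _ s d => s < N ∧ d < N
  | .seq p p' => p.Below N ∧ p'.Below N
  | .ite i _ p p' => i < N ∧ p.Below N ∧ p'.Below N
  | .while i _ p => i < N ∧ p.Below N

theorem Cmd.Below.mono {Q : Type} {N N' : ℕ} (hN : N ≤ N') {p : Cmd Q} (h : p.Below N) :
    p.Below N' := by
  induction p with
  | push i a => exact lt_of_lt_of_le h hN
  | pop i => exact lt_of_lt_of_le h hN
  | flip i => exact lt_of_lt_of_le h hN
  | call o s d => exact ⟨h.1.trans_le hN, h.2.trans_le hN⟩
  | seq p p' ih ih' => exact ⟨ih h.1, ih' h.2⟩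
  | ite i t p p' ih ih' => exact ⟨h.1.trans_le hN, ih h.2.1, ih' h.2.2⟩
  | _ i t p ih => exact ⟨h.1.trans_le hN, ih h.2⟩

/-- The bound `3 ≤ N` puts the three input stacks among those of the simulated machine. -/
theorem Cmd.exists_below {Q : Type} (p : Cmd Q) : ∃ N, 3 ≤ N ∧ p.Below N := by
  induction p with
  | push i a => exact ⟨i + 3, by omega, show i < i + 3 by omega⟩
  | pop i => exact ⟨i + 3, by omega, show i < i + 3 by omega⟩
  | flip i => exact ⟨i + 3, by omega, show i < i + 3 by omega⟩
  | call o s d => exact ⟨s + d + 3, by omega, by omega, by omega⟩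
  | seq p p' ih ih' =>
    obtain ⟨N, hN, h⟩ := ih
    obtain ⟨N', hN', h'⟩ := ih'
    exact ⟨N + N', by omega, h.mono (by omega), h'.mono (by omega)⟩
  | ite i t p p' ih ih' =>
    obtain ⟨N, hN, h⟩ := ih
    obtain ⟨N', hN', h'⟩ := ih'
    exact ⟨i + 1 + N + N', by omega, by omega, h.mono (by omega), h'.mono (by omega)⟩
  | _ i t p ih =>
    obtain ⟨N, hN, h⟩ := ih
    exact ⟨i + 1 + N, by omega, by omega, h.mono (by omega)⟩

/-- Replace each oracle call by a program. -/
def compile {Q : Type} (c : Q → ℕ → ℕ → Cmd Empty) : Cmd Q → Cmd Empty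
  | .push i a => .push i a
  | .pop i => .pop i
  | .flip i => .flip i
  | .call o s d => c o s d
  | .seq p p' => .seq (compile c p) (compile c p')
  | .ite i t p p' => .ite i t (compile c p) (compile c p')
  | .while i t p => .while i t (compile c p)

/-- The stacks of the simulating machine: below `N` those of the simulated machine, then a flag,
then fixed stacks. -/
def hostStore (N : ℕ) (π σ : Store) (e : List Sym) : Store := fun i =>
  if i < N then σ i else if i = N then e else π i

theorem hostStore_update {N i : ℕ} (hi : i < N) (π σ : Store) (e x : List Sym) :
    update (hostStore N π σ e) i x = hostStore N π (update σ i x) e := by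
  funext j
  by_cases hj : j = i
  · subst hj; simp [hostStore, hi]
  · simp [hostStore, hj]

theorem hostStore_apply {N i : ℕ} (hi : i < N) (π σ : Store) (e : List Sym) :
    hostStore N π σ e i = σ i := by
  simp [hostStore, hi]

/-- The compiled program follows the runs of the oracle machine in which every query `x` receives
the answer `F o x`. A query either is hot, and then the flag makes YES certain, or its answer is
right up to probability `ε`; this gives the loss `n * ε` in `n` steps. As `F o x` lies in the
support of the true answer, halting of the oracle machine on all its runs carries over to the
simulated ones. `X` bounds the stack lengths and grows by at most 1 in a step, since answers have
length at most `A ≤ X`. -/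
theorem simulate {Q : Type} (O : Oracle Q) (F : Q → List Sym → List Sym) (hot : List Sym → Prop)
    (fin : Set (List Sym)) (ε : ENNReal) (B : Prop) (N A : ℕ) (π : Store) (τ : ℕ → ℕ) (hτ : Monotone τ)
    (c : Q → ℕ → ℕ → Cmd Empty) (R : Cmd Empty)
    (hc : ∀ o s d, s < N → d < N → ∀ σ e X, (∀ i < N, (σ i).length ≤ X) → e.length ≤ 1 →
      ∃ e', e'.length ≤ 1 ∧ (e' ≠ [] ↔ e ≠ [] ∨ hot (σ s)) ∧
        Runs (c o s d) (hostStore N π σ e) (hostStore N π (update σ d (F o (σ s))) e') (τ X))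
    (hR : ∀ σ e X, (∀ i < N, (σ i).length ≤ X) → e.length ≤ 1 →
      ∃ σ', Runs R (hostStore N π σ e) σ' (τ X) ∧ (σ' 0 ∈ Yes ↔ e ≠ [] ∨ σ 0 ∈ fin))
    (hA : ∀ o x, (F o x).length ≤ A)
    (hO : ∀ o x, F o x ∈ (O o x).support ∧ (hot x ∨ 1 ≤ O o x (F o x) + ε))
    (hB : ∀ x, hot x → B) (hfin : ∀ y ∈ fin, B) :
    ∀ n K σ e X, (∀ p ∈ K, p.Below N) → (∀ i < N, (σ i).length ≤ X) → A ≤ X → e.length ≤ 1 →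
      (e ≠ [] → B) → (∀ c ∈ (steps O n (K, σ)).support, c.1 = []) →
      ∃ ρ, Accepts B (K.map (compile c) ++ [R], hostStore N π σ e)
          (n * (τ (X + n) + 2) + τ (X + n)) ρ ∧ (e ≠ [] → 1 ≤ ρ) ∧
        prob ((steps O n (K, σ)).map fun c => c.2 0) fin ≤ ρ + n * ε := by
  classical
  -- The simulated machine has halted and only `R`, which computes the verdict, is left.
  have hnil (n : ℕ) (σ : Store) (e : List Sym) (X : ℕ) (hX : ∀ i < N, (σ i).length ≤ X)
      (he : e.length ≤ 1) (heB : e ≠ [] → B) :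
      ∃ ρ, Accepts B ([R], hostStore N π σ e) (n * (τ (X + n) + 2) + τ (X + n)) ρ ∧
        (e ≠ [] → 1 ≤ ρ) ∧
        prob ((steps O n ([], σ)).map fun c => c.2 0) fin ≤ ρ + n * ε := by
    obtain ⟨σ', hr, hy⟩ := hR σ e X hX he
    have key : Accepts B ([], σ') 0 (if e ≠ [] ∨ σ 0 ∈ fin then 1 else 0) := by
      refine ⟨fun c' hc' => ?_, ?_⟩
      · rw [steps, PMF.support_pure, Set.mem_singleton_iff] at hc'
        subst hc'
        refine ⟨rfl, fun h => ?_⟩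
        rcases hy.1 h with h | h
        · exact heB h
        · exact hfin _ h
      · rw [steps, PMF.pure_map]
        split_ifs with h
        · rw [prob_pure_of_mem (hy.2 h)]
        · exact zero_le
    refine ⟨_, (key.of_runs hr).mono ?_, fun h => by simp [h], ?_⟩
    · have := hτ (Nat.le_add_right X n)
      omega
    · rw [steps_nil, PMF.pure_map]
      by_cases h : σ 0 ∈ fin
      · rw [if_pos (Or.inr h)]
        exact (prob_le_one _ _).trans (by simp)
      · rw [prob_pure_of_notMem h]
        exact zero_le
  intro n
  induction n with
  | zero =>
    intro K σ e X hK hX hAX he heB hh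
    have : K = [] := hh (K, σ) (by simp [steps])
    subst this
    simpa using hnil 0 σ e X hX he heB
  | succ n ih =>
    intro K σ e X hK hX hAX he heB hh
    rcases K with _ | ⟨p, K⟩
    · simpa using hnil (n + 1) σ e X hX he heB
    have hpK : p.Below N := hK p (by simp)
    have hK' : ∀ p ∈ K, p.Below N := fun q hq => hK q (by simp [hq])
    have hXn : X + 1 + n = X + (n + 1) := by ring
    have hε : (n : ENNReal) * ε ≤ ((n + 1 : ℕ) : ENNReal) * ε := by gcongr; simp
    have hT : n * (τ (X + (n + 1)) + 2) + τ (X + (n + 1)) + 1 ≤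
        (n + 1) * (τ (X + (n + 1)) + 2) + τ (X + (n + 1)) := by ring_nf; omega
    -- a deterministic step that costs the same on both machines
    have det (K₁ : List (Cmd Q)) (σ₁ : Store) (hs : step O (p :: K, σ) = PMF.pure (K₁, σ₁))
        (hs' : step noOracle (compile c p :: (K.map (compile c) ++ [R]), hostStore N π σ e) =
          PMF.pure (K₁.map (compile c) ++ [R], hostStore N π σ₁ e))
        (hK₁ : ∀ p ∈ K₁, p.Below N) (hX₁ : ∀ i < N, (σ₁ i).length ≤ X + 1) :
        ∃ ρ, Accepts B ((p :: K).map (compile c) ++ [R], hostStore N π σ e)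
          ((n + 1) * (τ (X + (n + 1)) + 2) + τ (X + (n + 1))) ρ ∧ (e ≠ [] → 1 ≤ ρ) ∧
        prob ((steps O (n + 1) (p :: K, σ)).map fun c => c.2 0) fin ≤ ρ + (n + 1 : ℕ) * ε := by
      have e₁ : steps O (n + 1) (p :: K, σ) = steps O n (K₁, σ₁) := by
        rw [steps, hs, PMF.pure_bind]
      rw [e₁] at hh ⊢
      obtain ⟨ρ, h1, h2, h3⟩ := ih K₁ σ₁ e (X + 1) hK₁ hX₁ (by omega) he heB hh
      rw [hXn] at h1
      exact ⟨ρ, (Accepts.of_step hs' h1).mono hT, h2, h3.trans (by gcongr)⟩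
    have hupd (i : ℕ) (y : List Sym) (hy : y.length ≤ X + 1) :
        ∀ j < N, (update σ i y j).length ≤ X + 1 := fun j hj => by
      rw [update_apply]
      split_ifs
      · exact hy
      · exact (hX j hj).trans (by omega)
    cases p with
    | push i a =>
      have hi : i < N := hpK
      exact det K (update σ i (a :: σ i)) rfl
        (by simp [compile, step, hostStore_apply hi, hostStore_update hi]) hK'
        (hupd _ _ (by simpa using hX i hi))
    | pop i =>
      have hi : i < N := hpK
      exact det K (update σ i (σ i).tail) rfl
        (by simp [compile, step, hostStore_apply hi, hostStore_update hi]) hK'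
        (hupd _ _ (by have := hX i hi; simp; omega))
    | seq p p' =>
      exact det (p :: p' :: K) σ rfl (by simp [compile, step])
        (by
          intro q hq
          simp only [List.mem_cons] at hq
          rcases hq with rfl | rfl | hq
          · exact hpK.1
          · exact hpK.2
          · exact hK' q hq)
        fun i hi => (hX i hi).trans (by omega)
    | ite i t p p' =>
      have hi : i < N := hpK.1
      refine det ((if t (σ i).head? then p else p') :: K) σ rfl
        (by simp only [compile, step, hostStore_apply hi]; split_ifs <;> simp)
        (by
          intro q hq
          simp only [List.mem_cons] at hq
          rcases hq with rfl | hq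
          · split_ifs
            · exact hpK.2.1
            · exact hpK.2.2
          · exact hK' q hq)
        fun i hi => (hX i hi).trans (by omega)
    | flip i =>
      have hi : i < N := hpK
      rw [steps, step, PMF.bind_map] at hh ⊢
      have hb (b : Bool) := ih K (update σ i (.bit b :: σ i)) e (X + 1) hK'
        (hupd _ _ (by simpa using hX i hi)) (by omega) he heB
        (fun c' hc' => hh c' ((PMF.mem_support_bind_iff _ _ _).2 ⟨b, by simp, hc'⟩))
      choose ρ h1 h2 h3 using hb
      refine ⟨2⁻¹ * (ρ false + ρ true), ?_, fun h => ?_, ?_⟩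
      · refine (Accepts.flip (ρ := ρ) fun b => ?_).mono hT
        have := h1 b
        rw [hXn] at this
        simpa [hostStore_apply hi, hostStore_update hi] using this
      · calc (1 : ENNReal) = 2⁻¹ * (1 + 1) := by
              rw [one_add_one_eq_two, ENNReal.inv_mul_cancel (by simp) (by simp)]
          _ ≤ _ := by gcongr; exacts [h2 _ h, h2 _ h]
      · rw [PMF.map_bind, prob_bind, tsum_uniform_bool]
        calc _ ≤ 2⁻¹ * ((ρ false + n * ε) + (ρ true + n * ε)) := by
              gcongr
              · exact h3 false
              · exact h3 true
          _ = 2⁻¹ * (ρ false + ρ true) + n * ε := by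
              rw [add_add_add_comm, mul_add, ← two_mul, ← mul_assoc, ENNReal.inv_mul_cancel
                (by simp) (by simp), one_mul]
          _ ≤ _ := by gcongr
    | call o s d =>
      obtain ⟨hs, hd⟩ : s < N ∧ d < N := hpK
      rw [steps, step, PMF.bind_map] at hh ⊢
      obtain ⟨e', he', hee', hr⟩ := hc o s d hs hd σ e X hX he
      obtain ⟨hsup, hlik⟩ := hO o (σ s)
      obtain ⟨ρ, h1, h2, h3⟩ := ih K (update σ d (F o (σ s))) e' (X + 1) hK'
        (hupd _ _ ((hA _ _).trans (by omega))) (by omega) he'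
        (fun h => by
          rcases hee'.1 h with h | h
          · exact heB h
          · exact hB _ h)
        (fun c' hc' => hh c' ((PMF.mem_support_bind_iff _ _ _).2 ⟨_, hsup, hc'⟩))
      rw [hXn] at h1
      refine ⟨ρ, (h1.of_runs hr).mono ?_, fun h => h2 (hee'.2 (Or.inl h)), ?_⟩
      · have := hτ (show X ≤ X + (n + 1) by omega)
        ring_nf at this ⊢; omega
      -- After a hot query the flag forces `1 ≤ ρ`; otherwise one more `ε` is lost.
      · rcases hlik with hlik | hlik
        · exact (prob_le_one _ _).trans ((h2 (hee'.2 (Or.inr hlik))).trans le_self_add)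
        · rw [PMF.map_bind, prob_bind]
          refine (tsum_mul_le_of_likely _ _ (fun _ => prob_le_one _ _) (F o (σ s)) hlik).trans ?_
          calc _ ≤ (ρ + n * ε) + ε := by gcongr; exact h3
            _ = ρ + (n + 1 : ℕ) * ε := by push_cast; ring
    | _ i t p =>
      have hi : i < N := hpK.1
      refine det (if t (σ i).head? then p :: .while i t p :: K else K) σ
        (by simp only [step])
        (by simp only [compile, step, hostStore_apply hi]; split_ifs <;> simp [compile])
        (by
          intro q hq
          split_ifs at hq
          · simp only [List.mem_cons] at hq
            rcases hq with rfl | rfl | hq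
            · exact hpK.2
            · exact hpK
            · exact hK' q hq
          · exact hK' q hq)
        fun i hi => (hX i hi).trans (by omega)

/-! ### The Bellman equation for deterministic processes. -/

namespace DetMDP

variable {S A : Type} (M : DetMDP S A)

theorem trajectory_succ_eq (next : S → A → Option S) (π : S → A) (s : S) (t : ℕ) :
    trajectory next π s (t + 1) = (next s (π s)).bind fun s' => trajectory next π s' t := by
  induction t with
  | zero => cases h : next s (π s) <;> simp [trajectory, h]
  | succ t ih =>
    rw [trajectory, ih]
    cases h : next s (π s) <;> simp [trajectory]

theorem trajectory_eq_none_of_le {next : S → A → Option S} {π : S → A} {s : S} {t t' : ℕ}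
    (h : trajectory next π s t = none) (ht : t ≤ t') : trajectory next π s t' = none := by
  induction ht with
  | refl => exact h
  | step _ ih => rw [trajectory, ih]; rfl

/-- Splitting off the first reward leaves one term less than in the sum for the next state. The
missing term vanishes because the trajectory from `s` ends within the horizon. -/
theorem V_eq_Q (π : S → A) (s : S) : M.V π s = M.Q π s (π s) := by
  obtain ⟨t, ht, hn⟩ := M.ends π s
  have hn := trajectory_eq_none_of_le hn ht
  rw [Q, V]
  obtain ⟨k, hk⟩ : ∃ k, M.horizon = k + 1 := by
    cases h : M.horizon with
    | zero => rw [h] at hn; simp [trajectory] at hn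
    | succ k => exact ⟨k, rfl⟩
  rw [hk, Finset.sum_range_succ', add_comm]
  congr 1
  cases h : M.next s (π s) with
  | none => simp [trajectory_succ_eq, h]
  | some s' =>
    rw [hk, trajectory_succ_eq, h] at hn
    simp only [trajectory_succ_eq, h, Option.bind_some, Option.elim_some] at hn ⊢
    rw [V, hk, Finset.sum_range_succ, hn]
    simp

variable {M} {W : S → ℝ}

/-- Induction on the time at which the trajectory from `s` ends: the next state is one step closer
to the end. -/
theorem V_le (hW : ∀ s a, M.meanReward s a + (M.next s a).elim 0 W ≤ W s) (π : S → A) (s : S) :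
    M.V π s ≤ W s := by
  obtain ⟨t, -, hn⟩ := M.ends π s
  induction t generalizing s with
  | zero => simp [trajectory] at hn
  | succ t ih =>
    refine le_trans ?_ (hW s (π s))
    rw [trajectory_succ_eq] at hn
    rw [V_eq_Q, Q]
    cases h : M.next s (π s) with
    | none => simp
    | some s' =>
      rw [h] at hn
      simpa using ih _ hn

theorem V_eq {π : S → A} (hW : ∀ s, M.meanReward s (π s) + (M.next s (π s)).elim 0 W = W s) (s : S) :
    M.V π s = W s := by
  obtain ⟨t, -, hn⟩ := M.ends π s
  induction t generalizing s with
  | zero => simp [trajectory] at hn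
  | succ t ih =>
    rw [← hW s]
    rw [trajectory_succ_eq] at hn
    rw [V_eq_Q, Q]
    cases h : M.next s (π s) with
    | none => simp
    | some s' =>
      rw [h] at hn
      simpa using ih _ hn

/-- A solution of the Bellman optimality equation is the optimal value function. -/
theorem optV_eq (hW : ∀ s a, M.meanReward s a + (M.next s a).elim 0 W ≤ W s) {π : S → A}
    (hπ : ∀ s, M.meanReward s (π s) + (M.next s (π s)).elim 0 W = W s) (s : S) :
    M.optV s = W s := by
  have : Nonempty (S → A) := ⟨π⟩
  refine le_antisymm (ciSup_le fun π' => V_le hW π' s) ?_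
  rw [← V_eq hπ s]
  exact le_ciSup (f := fun π' => M.V π' s) ⟨W s, by rintro _ ⟨π', rfl⟩; exact V_le hW π' s⟩ π

theorem optQ_eq (hW : ∀ s a, M.meanReward s a + (M.next s a).elim 0 W ≤ W s) {π : S → A}
    (hπ : ∀ s, M.meanReward s (π s) + (M.next s (π s)).elim 0 W = W s) (s : S) (a : A) :
    M.optQ s a = M.meanReward s a + (M.next s a).elim 0 W := by
  have : Nonempty (S → A) := ⟨π⟩
  have key (π' : S → A) : M.Q π' s a ≤ M.meanReward s a + (M.next s a).elim 0 W := by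
    rw [Q]
    cases h : M.next s a with
    | none => simp
    | some s' => simpa using V_le hW π' s'
  refine le_antisymm (ciSup_le key) ?_
  refine le_trans (le_of_eq ?_) (le_ciSup (f := fun π' => M.Q π' s a)
    ⟨_, by rintro _ ⟨π', rfl⟩; exact key π'⟩ π)
  rw [Q]
  cases h : M.next s a with
  | none => simp
  | some s' => simpa using (V_eq hπ s').symm

end DetMDP

/-! ### Bit strings as vectors -/

/-- The inner product of a real vector with a bit string. -/
def dot : List ℝ → List Sym → ℝ
  | t :: ts, a :: l => (if a = .bit true then t else 0) + dot ts l
  | _, _ => 0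

theorem dot_append {ts ts' : List ℝ} {l l' : List Sym} (h : ts.length = l.length) :
    dot (ts ++ ts') (l ++ l') = dot ts l + dot ts' l' := by
  induction ts generalizing l with
  | nil =>
    rw [List.length_nil, eq_comm, List.length_eq_zero_iff] at h
    simp [h, dot]
  | cons t ts ih =>
    cases l with
    | nil => simp at h
    | cons a l => simp [dot, ih (by simpa using h), add_assoc]

theorem dot_replicate_false (ts : List ℝ) (k : ℕ) :
    dot ts (List.replicate k (.bit false)) = 0 := by
  induction k generalizing ts with
  | zero => cases ts <;> simp [dot]
  | succ k ih => cases ts <;> simp [dot, List.replicate_succ, ih]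

theorem zeros_eq (l : List Sym) : zeros l = List.replicate l.length (.bit false) := by
  induction l with
  | nil => simp [zeros]
  | cons a l ih => simpa [zeros, List.replicate_succ] using ih

theorem dot_zeros (ts : List ℝ) (l : List Sym) : dot ts (zeros l) = 0 := by
  rw [zeros_eq, dot_replicate_false]

theorem dot_map_mul (t : ℝ) (ts : List ℝ) (l : List Sym) : dot (ts.map (t * ·)) l = t * dot ts l := by
  induction ts generalizing l with
  | nil => simp [dot]
  | cons s ts ih => cases l <;> simp [dot, ih, mul_add]

/-- Each bit of `x` selects or suppresses a copy of `y`, which meets its own block `F`. The blocks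
are arbitrary, so a one-hot `x` lets the parameter vector depend on the level in any way. -/
theorem dot_flatten_kron (Fs : List (List ℝ)) (x y : List Sym) (h : ∀ F ∈ Fs, F.length = y.length) :
    dot Fs.flatten (kron x y) = dot (Fs.map fun F => dot F y) x := by
  induction Fs generalizing x with
  | nil => simp [dot]
  | cons F Fs ih =>
    cases x with
    | nil => simp [dot, kron]
    | cons a x =>
      rw [kron, List.flatten_cons, dot_append, ih _ fun F hF => h F (by simp [hF]), List.map_cons,
        dot]
      · split_ifs <;> simp [dot_zeros]
      · rw [h F (by simp)]
        split_ifs <;> simp [length_zeros]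

/-- The Kronecker product of two real vectors. -/
def realKron (ts us : List ℝ) : List ℝ := ts.flatMap fun t => us.map (t * ·)

theorem length_realKron (ts us : List ℝ) : (realKron ts us).length = ts.length * us.length := by
  simp [realKron, List.length_flatMap]

theorem dot_realKron (ts us : List ℝ) (x y : List Sym) (h : us.length = y.length) :
    dot (realKron ts us) (kron x y) = dot ts x * dot us y := by
  rw [realKron, List.flatMap, dot_flatten_kron _ _ _ (by simp [h]), List.map_map]
  induction ts generalizing x with
  | nil => simp [dot]
  | cons t ts ih => cases x <;> simp [dot, ih, dot_map_mul, add_mul]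

theorem dot_oneHot (G : List ℝ) (j k : ℕ) :
    dot G (List.replicate j (.bit false) ++ .bit true :: List.replicate k (.bit false)) =
      G.getD j 0 := by
  induction j generalizing G with
  | zero => cases G <;> simp [dot, dot_replicate_false]
  | succ j ih => cases G <;> simp [dot, List.replicate_succ, ih]

theorem sum_eq_dot {d : ℕ} (ts : List ℝ) (l : List Sym) (ht : ts.length = d) (hl : l.length = d) :
    ∑ i : Fin d, ts.getD i 0 * (((if l[(i : ℕ)]? = some (.bit true) then 1 else 0 : ℚ)) : ℝ) =
      dot ts l := by
  subst ht
  induction ts generalizing l with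
  | nil => simp [dot]
  | cons t ts ih =>
    cases l with
    | nil => simp at hl
    | cons a l =>
      have := ih l (by simpa using hl)
      rw [dot, ← this, List.length_cons, Fin.sum_univ_succ]
      simp only [Fin.val_zero, List.getD_cons_zero, List.getElem?_cons_zero, Option.some.injEq,
        Fin.val_succ, List.getD_cons_succ, List.getElem?_cons_succ]
      congr 1
      split_ifs <;> simp

def realPow (ts : List ℝ) : ℕ → List ℝ
  | 0 => [1]
  | r + 1 => realKron ts (realPow ts r)

theorem length_realPow (ts : List ℝ) (r : ℕ) : (realPow ts r).length = ts.length ^ r := by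
  induction r with
  | zero => simp [realPow]
  | succ r ih => rw [realPow, length_realKron, ih, pow_succ']

theorem length_unary (n : ℕ) : (unary n).length = n := by simp [unary]

theorem kronPow_unary_succ (r : ℕ) (u d : List Sym) :
    kronPow (unary (r + 1)) u d = (kron u (kronPow (unary r) u d)).take d.length := rfl

/-- The truncation in `kronPow` is there to keep all lengths polynomial. It has no effect here, as
the powers up to `r` of a nonempty string also fit. -/
theorem length_kronPow {r : ℕ} {u d : List Sym} (h : u.length ^ r ≤ d.length) (hu : u ≠ []) :
    (kronPow (unary r) u d).length = u.length ^ r := by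
  induction r with
  | zero => rfl
  | succ r ih =>
    have h' : u.length ^ r ≤ d.length :=
      (Nat.pow_le_pow_right (List.length_pos_iff.2 hu) (by omega)).trans h
    rw [kronPow_unary_succ, List.length_take, length_kron, ih h', ← pow_succ', min_eq_right h]

theorem dot_realPow {r : ℕ} {u d : List Sym} (ts : List ℝ) (h : u.length ^ r ≤ d.length)
    (hu : u ≠ []) (ht : ts.length = u.length) :
    dot (realPow ts r) (kronPow (unary r) u d) = dot ts u ^ r := by
  induction r with
  | zero => simp [realPow, kronPow, unary, dot]
  | succ r ih =>
    have h' : u.length ^ r ≤ d.length :=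
      (Nat.pow_le_pow_right (List.length_pos_iff.2 hu) (by omega)).trans h
    have hl := length_kronPow h' hu
    rw [kronPow_unary_succ, List.take_of_length_le, realPow, dot_realKron, ih h', pow_succ']
    · rw [length_realPow, hl, ht]
    · rw [length_kron, hl, ← pow_succ']
      exact h

theorem dot_flatMap_range (n : ℕ) (f : ℕ → List ℝ) (g : ℕ → List Sym)
    (h : ∀ i < n, (f i).length = (g i).length) :
    dot ((List.range n).flatMap f) ((List.range n).flatMap g) =
      ∑ i ∈ Finset.range n, dot (f i) (g i) := by
  induction n with
  | zero => simp [dot]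
  | succ n ih =>
    rw [List.range_succ, List.flatMap_append, List.flatMap_append, dot_append,
      ih fun i hi => h i (by omega), Finset.sum_range_succ]
    · simp
    · simp only [List.length_flatMap]
      congr 1
      refine List.map_congr_left fun i hi => h i ?_
      have := List.mem_range.1 hi
      omega

/-! ### The decision process of local search -/

section Strings

variable {v : ℕ}

def bits (x : List Bool) : List Sym := x.map .bit

/-- The value of variable `i` in the state `x`. -/
def bitAt (x : List Bool) (i : ℕ) : Bool := x.getD (i + 1) false

/-- The truth value of a literal under an assignment. -/
def litHolds (w : ℕ → Bool) (ℓ : Fin v × Bool) : Bool := w ℓ.1 == ℓ.2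

def clauseHolds (w : ℕ → Bool) (c : Clause v) : Bool :=
  litHolds w (c 0) || (litHolds w (c 1) || litHolds w (c 2))

/-- The clauses from the first one that is false in the state `x`. -/
def violated (x : List Bool) (φ : Formula v) : Formula v := φ.dropWhile (clauseHolds (bitAt x))

def litCode (ℓ : Fin v × Bool) : List Sym := .bit ℓ.2 :: unary ℓ.1

def clausesCode (φ : Formula v) : List Sym := φ.flatMap clauseCode

theorem before_append (l r : List Sym) (h : .sep ∉ l) : before (l ++ .sep :: r) = l := by
  induction l with
  | nil => simp [before]
  | cons a l ih =>
    simp only [List.mem_cons, not_or] at h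
    simp [before, Ne.symm h.1, ih h.2]

theorem after_append (l r : List Sym) (h : .sep ∉ l) : after (l ++ .sep :: r) = r := by
  induction l with
  | nil => simp [after]
  | cons a l ih =>
    simp only [List.mem_cons, not_or] at h
    simp [after, Ne.symm h.1, ih h.2]

theorem sep_notMem_unary (k : ℕ) : Sym.sep ∉ unary k := by
  simp [unary, List.mem_replicate]

theorem sep_notMem_litCode (ℓ : Fin v × Bool) : Sym.sep ∉ litCode ℓ := by
  simp [litCode, sep_notMem_unary]

theorem clauseCode_append (c : Clause v) (r : List Sym) : clauseCode c ++ r =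
    litCode (c 0) ++ .sep :: (litCode (c 1) ++ .sep :: (litCode (c 2) ++ .sep :: r)) := by
  simp [clauseCode, litCode, List.ofFn_succ]

theorem clausesCode_cons (c : Clause v) (φ : Formula v) : clausesCode (c :: φ) =
    litCode (c 0) ++ .sep :: (litCode (c 1) ++ .sep :: (litCode (c 2) ++ .sep :: clausesCode φ)) := by
  rw [← clauseCode_append]; rfl

theorem before_clausesCode (c : Clause v) (φ : Formula v) :
    before (clausesCode (c :: φ)) = litCode (c 0) ∧
    before (after (clausesCode (c :: φ))) = litCode (c 1) ∧
    before (after (after (clausesCode (c :: φ)))) = litCode (c 2) ∧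
    after (after (after (clausesCode (c :: φ)))) = clausesCode φ := by
  simp [clausesCode_cons, before_append, after_append, sep_notMem_litCode]

theorem length_le_length_clausesCode (φ : Formula v) : φ.length ≤ (clausesCode φ).length := by
  induction φ with
  | nil => simp
  | cons c φ ih => rw [clausesCode_cons]; simp; omega

theorem clausesCode_eq_nil {φ : Formula v} : clausesCode φ = [] ↔ φ = [] := by
  cases φ with
  | nil => simp [clausesCode]
  | cons c φ => simp [clausesCode_cons]

theorem length_bits (x : List Bool) : (bits x).length = x.length := by simp [bits]

theorem bits_drop (x : List Bool) (k : ℕ) : (bits x).drop k = bits (x.drop k) := by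
  simp [bits, List.map_drop]

theorem bits_tail (x : List Bool) : (bits x).tail = bits x.tail := by simp [bits]

/-- The tail of the code is the variable number in unary, so its length locates the variable in the
state; the head is the sign to compare with the bit found there. -/
theorem falseLit_litCode {x : List Bool} {ℓ : Fin v × Bool} (h : (ℓ.1 : ℕ) + 1 < x.length) :
    falseLit (litCode ℓ) (bits x) = [] ↔ litHolds (bitAt x) ℓ = true := by
  obtain ⟨b, x, rfl⟩ := List.exists_cons_of_ne_nil (List.ne_nil_of_length_pos (Nat.zero_lt_of_lt h))
  have h' : (ℓ.1 : ℕ) < x.length := by simpa using h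
  rw [falseLit, headNe, litCode, List.tail_cons, length_unary, bits_tail, bits_drop, litHolds, bitAt,
    List.tail_cons, List.drop_eq_getElem_cons h', List.getD_cons_succ, List.getD_eq_getElem _ _ h']
  cases x[(ℓ.1 : ℕ)] <;> cases ℓ.2 <;> simp [bits]

theorem falseClause_clausesCode {x : List Bool} {c : Clause v} {φ : Formula v}
    (h : v < x.length) :
    falseClause (clausesCode (c :: φ)) (bits x) = [] ↔ clauseHolds (bitAt x) c = true := by
  have hl (j : Fin 3) := falseLit_litCode (x := x) (ℓ := c j) (by have := (c j).1.2; omega)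
  obtain ⟨h1, h2, h3, -⟩ := before_clausesCode c φ
  rw [falseClause, h1, h2, h3, clauseHolds]
  split_ifs with h4 h5
  · simp [(hl 0).1 h4]
  · simp [(hl 1).1 h5]
  · rw [hl 2]
    rw [hl 0] at h4
    rw [hl 1] at h5
    simp [h4, h5]

theorem skipTrue_clausesCode {x : List Bool} (h : v < x.length) (l : List Sym) (φ : Formula v) :
    skipTrue l (bits x) (clausesCode φ) =
      clausesCode ((fun ψ : Formula v => match ψ with
        | [] => []
        | c :: ψ => if clauseHolds (bitAt x) c then ψ else c :: ψ)^[l.length] φ) := by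
  induction l with
  | nil => rfl
  | cons a l ih =>
    rw [skipTrue, ih, List.length_cons, iterate_succ_apply']
    generalize (fun ψ : Formula v => match ψ with
        | [] => []
        | c :: ψ => if clauseHolds (bitAt x) c then ψ else c :: ψ)^[l.length] φ = ψ
    cases ψ with
    | nil => simp [clausesCode, after]
    | cons c ψ =>
      simp only [falseClause_clausesCode h, before_clausesCode c ψ]
      split_ifs <;> rfl

/-- Each round skips at most one clause, and the code has at least as many symbols as there are
clauses, so its length suffices as the number of rounds. -/
theorem firstFalse_bits {x : List Bool} (h : v < x.length) (φ : Formula v) :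
    firstFalse (bits x) (clausesCode φ) = clausesCode (violated x φ) := by
  rw [firstFalse, skipTrue_clausesCode h]
  congr 1
  have key : ∀ k, φ.length ≤ k → (fun ψ : Formula v => match ψ with
        | [] => []
        | c :: ψ => if clauseHolds (bitAt x) c then ψ else c :: ψ)^[k] φ = violated x φ := by
    induction φ with
    | nil =>
      intro k _
      exact iterate_fixed rfl k
    | cons c φ ih =>
      intro k hk
      obtain ⟨k, rfl⟩ : ∃ j, k = j + 1 := ⟨k - 1, by simp at hk; omega⟩
      by_cases hc : clauseHolds (bitAt x) c = true
      · rw [iterate_succ_apply]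
        simp only [hc, if_true]
        rw [ih k (by simpa using hk), violated, violated, List.dropWhile_cons, if_pos hc]
      · rw [iterate_fixed (by simp [hc])]
        rw [violated, List.dropWhile_cons, if_neg hc]
  exact key _ (length_le_length_clausesCode φ)

theorem allBits_bits (x : List Bool) : allBits (bits x) = [.bit true] := by
  induction x with
  | nil => rfl
  | cons b x ih => simpa [bits, allBits] using ih

theorem exists_bits_of_allBits {x : List Sym} (h : allBits x ≠ []) : ∃ y, x = bits y := by
  induction x with
  | nil => exact ⟨[], rfl⟩
  | cons a x ih =>
    rw [allBits] at h
    rcases a with b | _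
    · obtain ⟨y, rfl⟩ := ih (by simpa using h)
      exact ⟨b :: y, rfl⟩
    · simp at h

theorem isState_ne_nil_iff {x : List Sym} {n H : ℕ} : isState x (unary n) (unary H) ≠ [] ↔
    ∃ y : List Bool, x = bits y ∧ n + 1 ≤ y.length ∧ y.length ≤ n + 1 + H := by
  have hn (l : List Sym) : l = [] ↔ l.length = 0 := List.length_eq_zero_iff.symm
  constructor
  · intro h
    rw [isState] at h
    split_ifs at h with h1 h2 h3
    · simp at h
    · simp at h
    · obtain ⟨y, rfl⟩ := exists_bits_of_allBits h1
      refine ⟨y, rfl, ?_⟩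
      rw [hn] at h2 h3
      simp [length_bits, length_unary] at h2 h3
      omega
    · simp at h
  · rintro ⟨y, rfl, h1, h2⟩
    rw [isState, allBits_bits, if_neg (by simp), if_neg, if_pos]
    · simp
    · rw [hn]; simp [length_bits, length_unary]; omega
    · rw [hn]; simp [length_bits, length_unary]; omega

def flipBit (i : ℕ) (x : List Bool) : List Bool := false :: (x.tail.modify i not ++ [true])

def coreNext (a : Fin 2) (x : List Bool) (c : Clause v) : List Bool :=
  if x.head? = some true then
    if a = 0 then flipBit (c 1).1 x else flipBit (c 2).1 x
  else if a = 0 then flipBit (c 0).1 x else true :: x.tail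

theorem length_flipBit {x : List Bool} (hx : x ≠ []) (i : ℕ) :
    (flipBit i x).length = x.length + 1 := by
  have := List.length_pos_iff.2 hx
  simp [flipBit]; omega

theorem length_coreNext {x : List Bool} (hx : x ≠ []) (a : Fin 2) (c : Clause v) :
    x.length ≤ (coreNext a x c).length ∧ (coreNext a x c).length ≤ x.length + 1 := by
  have := List.length_pos_iff.2 hx
  rw [coreNext]
  split_ifs <;> simp [length_flipBit hx]; omega

theorem flipState_litCode {x : List Bool} {ℓ : Fin v × Bool} (h : (ℓ.1 : ℕ) + 1 < x.length) :
    flipState (litCode ℓ) (bits x) = bits (flipBit ℓ.1 x) := by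
  have h' : (ℓ.1 : ℕ) < x.tail.length := by simp; omega
  rw [flipState, flipBit, flipAt, litCode, List.tail_cons, length_unary, bits_tail, bits_drop,
    List.modify_eq_take_drop, List.drop_eq_getElem_cons h']
  cases x.tail[(ℓ.1 : ℕ)] <;> simp [bits, negHead, List.map_take]

theorem nextCore_bits {x : List Bool} {c : Clause v} (φ : Formula v) (a : Fin 2)
    (h : v < x.length) :
    nextCore a (bits x) (clausesCode (c :: φ)) = bits (coreNext a x c) := by
  have hl (j : Fin 3) := flipState_litCode (x := x) (ℓ := c j) (by have := (c j).1.2; omega)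
  obtain ⟨h1, h2, h3, -⟩ := before_clausesCode c φ
  rw [nextCore, h1, h2, h3, hl, hl, hl, coreNext]
  cases x with
  | nil => simp at h
  | cons b x => cases b <;> simp [bits] <;> split_ifs <;> rfl

end Strings

/-- States: a phase bit, an assignment of `n` variables, and a bit for each flip up to now. -/
abbrev State (n H : ℕ) : Type := {x : List Bool // n + 1 ≤ x.length ∧ x.length ≤ n + 1 + H}

/-! ### Transitions, termination and rewards of local search. -/

section Search

variable {v n H : ℕ}

theorem State.ne_nil (x : State n H) : x.1 ≠ [] := by
  have := x.2.1
  intro h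
  simp [h] at this

theorem coreNext_mem (a : Fin 2) (x : State n H) (c : Clause v) (h : x.1.length < n + 1 + H) :
    n + 1 ≤ (coreNext a x.1 c).length ∧ (coreNext a x.1 c).length ≤ n + 1 + H := by
  have := length_coreNext x.ne_nil a c
  have := x.2.1
  omega

/-- Local search: in phase 0 flip the variable of the first literal of the first false clause or go
to phase 1, in phase 1 flip the variable of the second or of the third literal. -/
def searchNext (φ : Formula v) (x : State n H) (a : Fin 2) : Option (State n H) :=
  match violated x.1 φ with
  | [] => none
  | c :: _ => if h : x.1.length < n + 1 + H then some ⟨coreNext a x.1 c, coreNext_mem a x c h⟩ else none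

theorem searchNext_eq_some_iff {φ : Formula v} {x y : State n H} {a : Fin 2} :
    searchNext φ x a = some y ↔ ∃ c ψ, violated x.1 φ = c :: ψ ∧ x.1.length < n + 1 + H ∧
      y.1 = coreNext a x.1 c := by
  rw [searchNext]
  cases violated x.1 φ with
  | nil => simp
  | cons c ψ =>
    by_cases h : x.1.length < n + 1 + H
    · simp only [h, dif_pos, List.cons.injEq]
      constructor
      · intro h
        cases h
        exact ⟨c, ψ, ⟨rfl, rfl⟩, trivial, rfl⟩
      · rintro ⟨c', ψ', ⟨rfl, rfl⟩, -, h⟩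
        exact congrArg some (Subtype.ext h.symm)
    · simp [h]

/-- The states without successor. -/
def Terminal (φ : Formula v) (x : State n H) : Prop := violated x.1 φ = [] ∨ x.1.length = n + 1 + H

instance (φ : Formula v) (x : State n H) : Decidable (Terminal φ x) :=
  decidable_of_iff ((violated x.1 φ).isEmpty = true ∨ x.1.length = n + 1 + H) (by simp [Terminal])

theorem searchNext_eq_none {φ : Formula v} {x : State n H} (h : Terminal φ x) (a : Fin 2) :
    searchNext φ x a = none := by
  cases hy : searchNext φ x a with
  | none => rfl
  | some y =>
    obtain ⟨c, ψ, h1, h2, -⟩ := searchNext_eq_some_iff.1 hy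
    rcases h with h | h
    · simp [h] at h1
    · omega

theorem exists_of_not_terminal {φ : Formula v} {x : State n H} (h : ¬ Terminal φ x) :
    x.1.length < n + 1 + H ∧ ∃ c ψ, violated x.1 φ = c :: ψ ∧
      ∀ a, ∃ y : State n H, searchNext φ x a = some y ∧ y.1 = coreNext a x.1 c := by
  rw [Terminal, not_or] at h
  have hx : x.1.length < n + 1 + H := lt_of_le_of_ne x.2.2 h.2
  obtain ⟨c, ψ, hc⟩ := List.exists_cons_of_ne_nil h.1
  exact ⟨hx, c, ψ, hc, fun a => ⟨⟨_, coreNext_mem a x c hx⟩,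
    searchNext_eq_some_iff.2 ⟨c, ψ, hc, hx, rfl⟩, rfl⟩⟩

theorem nextStr_bits (hv : v ≤ n) (φ : Formula v) (x : State n H) (a : Fin 2) :
    nextStr a (bits x.1) (clausesCode φ) (unary n) (unary H) =
      (searchNext φ x a).elim [.sep] fun y => bits y.1 := by
  have hx := x.2
  have hl : v < x.1.length := by omega
  rw [nextStr, if_neg (isState_ne_nil_iff.2 ⟨x.1, rfl, x.2⟩), firstFalse_bits hl]
  have hlen : ((bits x.1).drop (unary n).length).drop (unary H).length = [] ↔
      x.1.length < n + 1 + H := by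
    rw [← List.length_eq_zero_iff]; simp [length_bits, length_unary]; omega
  by_cases ht : Terminal φ x
  · rw [searchNext_eq_none ht]
    rcases ht with h | h
    · rw [if_pos (clausesCode_eq_nil.2 h)]; rfl
    · split_ifs with h1 h2
      · rfl
      · rw [hlen] at h2; omega
      · rfl
  · obtain ⟨h1, c, ψ, hc, hy⟩ := exists_of_not_terminal ht
    obtain ⟨y, hy, hy'⟩ := hy a
    rw [hy, hc, if_neg (by simp [clausesCode_eq_nil]), if_pos (hlen.2 h1), nextCore_bits ψ a hl, ← hy']
    rfl

theorem satState_bits (hv : v ≤ n) (φ : Formula v) (x : State n H) :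
    satState (bits x.1) (clausesCode φ) (unary n) (unary H) ≠ [] ↔ violated x.1 φ = [] := by
  have hx := x.2
  rw [satState, if_neg (isState_ne_nil_iff.2 ⟨x.1, rfl, x.2⟩), firstFalse_bits (by omega)]
  simp [clausesCode_eq_nil]

/-- The potential that bounds the number of remaining steps. -/
def potential (x : State n H) : ℕ :=
  2 * (n + 1 + H - x.1.length) + if x.1.head? = some true then 0 else 1

/-- A flip lowers twice the number of flips left by 2 and raises the phase term by at most 1; the
passage to phase 1 lowers the phase term. -/
theorem potential_lt {φ : Formula v} {x y : State n H} {a : Fin 2} (h : searchNext φ x a = some y) :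
    potential y < potential x := by
  obtain ⟨c, ψ, -, hx, hy⟩ := searchNext_eq_some_iff.1 h
  have hl (i : ℕ) := length_flipBit x.ne_nil i
  have hh (i : ℕ) : (flipBit i x.1).head? = some false := rfl
  have := x.2.1
  rw [potential, potential, hy, coreNext]
  split_ifs <;> simp_all <;> omega

theorem search_ends (φ : Formula v) (π : State n H → Fin 2) (x : State n H) :
    ∃ t ≤ 2 * H + 2, trajectory (searchNext φ) π x t = none := by
  refine ⟨2 * H + 2, le_rfl, ?_⟩
  have key (t : ℕ) (y : State n H) (h : trajectory (searchNext φ) π x t = some y) :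
      potential y + t ≤ potential x := by
    induction t generalizing y with
    | zero => simp [trajectory] at h; simp [h]
    | succ t ih =>
      rw [trajectory, Option.bind_eq_some_iff] at h
      obtain ⟨z, hz, hy⟩ := h
      have := ih z hz
      have := potential_lt hy
      omega
  cases h : trajectory (searchNext φ) π x (2 * H + 2) with
  | none => rfl
  | some y =>
    have h1 := key _ y h
    have h2 : potential x ≤ 2 * H + 1 := by
      have := x.2.1
      rw [potential]
      split_ifs <;> omega
    omega

/-- The reward that is 1 with probability `p` and 0 otherwise. -/
noncomputable def coin (p : NNReal) : PMF ℚ :=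
  (PMF.ofFintype (fun b : Bool => ((if b then min p 1 else 1 - min p 1 : NNReal) : ENNReal)) (by
    rw [Fintype.sum_bool, ← ENNReal.coe_add]; simp)).map fun b => if b then 1 else 0

theorem coin_support (p : NNReal) : ∀ x ∈ (coin p).support, x = 0 ∨ x = 1 := by
  intro x hx
  rw [coin, PMF.mem_support_map_iff] at hx
  obtain ⟨b, -, rfl⟩ := hx
  cases b <;> simp

theorem coin_zero (p : NNReal) : coin p 0 = ((1 - min p 1 : NNReal) : ENNReal) := by
  rw [coin, PMF.map_apply, tsum_bool]
  simp

theorem coin_one (p : NNReal) : coin p 1 = ((min p 1 : NNReal) : ENNReal) := by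
  rw [coin, PMF.map_apply, tsum_bool]
  simp

theorem coin_mean (p : NNReal) : ∑' x : ℚ, (coin p x).toReal * (x : ℝ) = ((min p 1 : NNReal) : ℝ) := by
  rw [tsum_eq_single 1]
  · rw [coin_one, ENNReal.coe_toReal, Rat.cast_one, mul_one]
  · intro x hx
    by_cases h : x ∈ (coin p).support
    · rcases coin_support p x h with rfl | rfl
      · simp
      · exact absurd rfl hx
    · rw [(PMF.apply_eq_zero_iff _ _).2 h]; simp

theorem pure_zero_mean : ∑' x : ℚ, ((PMF.pure (0 : ℚ)) x).toReal * (x : ℝ) = 0 := by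
  have (x : ℚ) : ((PMF.pure (0 : ℚ)) x).toReal * (x : ℝ) = 0 := by
    rw [PMF.pure_apply]
    split_ifs with h <;> simp [h]
  simp only [this, tsum_zero]

/-- Local search as a decision process, with a given success probability in terminal states. -/
noncomputable def searchMDP (φ : Formula v) (n H : ℕ) (g : List Bool → NNReal) :
    DetMDP (State n H) (Fin 2) where
  start := ⟨List.replicate (n + 1) false, by simp⟩
  reward x _ := if Terminal φ x then coin (g x.1) else PMF.pure 0
  next := searchNext φ
  horizon := 2 * H + 2
  reward_mem x _ y hy := by
    split_ifs at hy
    · rcases coin_support _ y hy with rfl | rfl <;> simp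
    · simp at hy; simp [hy]
  ends := search_ends φ

theorem meanReward_searchMDP (φ : Formula v) (g : List Bool → NNReal) (x : State n H) (a : Fin 2) :
    (searchMDP φ n H g).meanReward x a = if Terminal φ x then ((min (g x.1) 1 : NNReal) : ℝ) else 0 := by
  simp only [DetMDP.meanReward, searchMDP]
  split_ifs
  · simpa using coin_mean (g x.1)
  · exact pure_zero_mean

end Search

/-! ### The optimal value function of local search. -/

section Value

variable {v n H : ℕ}

/-- The number of variables on which the state agrees with `w`. -/
noncomputable def agree (w : ℕ → Bool) (n : ℕ) (x : List Bool) : ℝ :=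
  ∑ i ∈ Finset.range n, if bitAt x i = w i then 1 else 0

/-- The `+ 1` in the denominator keeps the score below 1 even for the largest possible lead `H + n`,
so that the reward 0 is always possible (`score_lt_one`). -/
noncomputable def score (n H r : ℕ) (k : ℝ) : ℝ := (k / (H + n + 1)) ^ r

/-- The number of flips left plus the number of variables with the right value. -/
noncomputable def lead (w : ℕ → Bool) (n H : ℕ) (x : List Bool) : ℝ :=
  n + 1 + H - x.length + agree w n x

theorem agree_nonneg (w : ℕ → Bool) (n : ℕ) (x : List Bool) : 0 ≤ agree w n x :=
  Finset.sum_nonneg fun i _ => by split_ifs <;> simp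

theorem agree_le (w : ℕ → Bool) (n : ℕ) (x : List Bool) : agree w n x ≤ n := by
  refine (Finset.sum_le_sum (g := fun _ => (1 : ℝ)) fun i _ => ?_).trans (by simp)
  split_ifs <;> simp

theorem one_le_agree {w : ℕ → Bool} {x : List Bool} {i : ℕ} (hi : i < n)
    (h : bitAt x i = w i) : 1 ≤ agree w n x := by
  have := Finset.single_le_sum (f := fun i => if bitAt x i = w i then (1 : ℝ) else 0)
    (fun i _ => by split_ifs <;> simp) (Finset.mem_range.2 hi)
  simp only [h, if_true] at this
  exact this

theorem bitAt_flipBit {x : List Bool} (hx : n + 1 ≤ x.length) (i : ℕ) {j : ℕ} (hj : j < n) :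
    bitAt (flipBit i x) j = if j = i then !bitAt x j else bitAt x j := by
  obtain ⟨b, x, rfl⟩ := List.exists_cons_of_ne_nil (List.ne_nil_of_length_pos (by omega : 0 < x.length))
  have h : j < x.length := by simp at hx; omega
  rw [bitAt, bitAt, flipBit, List.getD_cons_succ, List.getD_cons_succ, List.tail_cons,
    List.getD_append _ _ _ _ (by simpa using h), List.getD_eq_getElem _ _ (by simpa using h),
    List.getD_eq_getElem _ _ h, List.getElem_modify]
  simp only [eq_comm]

/-- Since the literal is false in `x`, the state disagrees with `w` at its variable exactly if the
literal is true under `w`. -/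
theorem agree_flipBit (w : ℕ → Bool) {x : List Bool} (hx : n + 1 ≤ x.length) (hv : v ≤ n)
    {ℓ : Fin v × Bool} (h : litHolds (bitAt x) ℓ = false) :
    agree w n (flipBit ℓ.1 x) = agree w n x + if litHolds w ℓ then 1 else -1 := by
  have hi : (ℓ.1 : ℕ) ∈ Finset.range n := Finset.mem_range.2 (by have := ℓ.1.2; omega)
  have : agree w n (flipBit ℓ.1 x) = ∑ j ∈ Finset.range n,
      ((if bitAt x j = w j then 1 else 0) + if j = ℓ.1 then (if litHolds w ℓ then 1 else -1) else 0) := by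
    refine Finset.sum_congr rfl fun j hj => ?_
    rw [bitAt_flipBit hx _ (Finset.mem_range.1 hj)]
    by_cases hji : j = ℓ.1
    · subst hji
      simp only [litHolds, beq_eq_false_iff_ne, ne_eq, beq_iff_eq] at h ⊢
      cases h1 : bitAt x ℓ.1 <;> cases h2 : w ℓ.1 <;> cases h3 : ℓ.2 <;> simp_all
    · simp [hji]
  rw [this, Finset.sum_add_distrib, Finset.sum_ite_eq' , if_pos hi]
  rfl

/-- The appended bit uses up one flip; the agreement makes up for it after a right flip and adds a
second loss after a wrong one. -/
theorem lead_flipBit (w : ℕ → Bool) {x : List Bool} (hx : n + 1 ≤ x.length) (hv : v ≤ n)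
    {ℓ : Fin v × Bool} (h : litHolds (bitAt x) ℓ = false) :
    lead w n H (flipBit ℓ.1 x) = lead w n H x - if litHolds w ℓ then 0 else 2 := by
  rw [lead, lead, agree_flipBit w hx hv h,
    length_flipBit (List.ne_nil_of_length_pos (by omega : 0 < x.length))]
  push_cast
  split_ifs <;> ring

theorem lead_nonneg (w : ℕ → Bool) {x : List Bool} (hx : x.length ≤ n + 1 + H) :
    0 ≤ lead w n H x := by
  have h : (x.length : ℝ) ≤ n + 1 + H := by exact_mod_cast hx
  have := agree_nonneg w n x
  rw [lead]; linarith

theorem lead_le (w : ℕ → Bool) {x : List Bool} (hx : n + 1 ≤ x.length) :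
    lead w n H x ≤ H + n := by
  have h : ((n + 1 : ℕ) : ℝ) ≤ x.length := by exact_mod_cast hx
  have := agree_le w n x
  push_cast at h
  rw [lead]; linarith

theorem score_mono {r : ℕ} {k k' : ℝ} (h0 : 0 ≤ k) (h : k ≤ k') : score n H r k ≤ score n H r k' := by
  rw [score, score]; gcongr

theorem score_nonneg {r : ℕ} {k : ℝ} (h0 : 0 ≤ k) : 0 ≤ score n H r k := by
  rw [score]; positivity

theorem violated_cons {x : List Bool} {φ ψ : Formula v} {c : Clause v} (h : violated x φ = c :: ψ) :
    c ∈ φ ∧ clauseHolds (bitAt x) c = false := by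
  induction φ with
  | nil => simp [violated] at h
  | cons a φ ih =>
    rw [violated, List.dropWhile_cons] at h
    split_ifs at h with ha
    · exact ⟨List.mem_cons_of_mem _ (ih h).1, (ih h).2⟩
    · simp only [List.cons.injEq] at h
      rw [← h.1]
      exact ⟨List.mem_cons_self, by simpa using ha⟩

/-- The optimal value function of local search if `w` is a satisfying assignment. -/
noncomputable def searchValue (φ : Formula v) (w : ℕ → Bool) (r : ℕ) (x : State n H) : ℝ :=
  if x.1.head? = some true ∧ ¬ Terminal φ x then
    match violated x.1 φ with
    | [] => 0
    | c :: _ => score n H r (lead w n H x.1 -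
        if litHolds w (c 1) || litHolds w (c 2) then 0 else 2)
  else score n H r (lead w n H x.1)

/-- Keeps the argument of `score` nonnegative after a wrong flip, where the power is monotone: one
flip is left, and a literal false in `x` and under `w` is an agreement. -/
theorem two_le_lead (w : ℕ → Bool) (hv : v ≤ n) {x : List Bool} (hx : x.length < n + 1 + H)
    {ℓ : Fin v × Bool} (h : litHolds (bitAt x) ℓ = false) (hw : litHolds w ℓ = false) :
    2 ≤ lead w n H x := by
  have h1 : ((x.length + 1 : ℕ) : ℝ) ≤ (n + 1 + H : ℕ) := by exact_mod_cast hx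
  have h2 : 1 ≤ agree w n x := by
    refine one_le_agree (i := ℓ.1) (by have := ℓ.1.2; omega) ?_
    simp only [litHolds, beq_eq_false_iff_ne, ne_eq] at h hw
    cases h1 : bitAt x ℓ.1 <;> cases h2 : w ℓ.1 <;> cases h3 : ℓ.2 <;> simp_all
  push_cast at h1
  rw [lead]; linarith

theorem meanReward_search {φ : Formula v} {w : ℕ → Bool} {r : ℕ} (x : State n H) (a : Fin 2) :
    (searchMDP φ n H fun x => (score n H r (lead w n H x)).toNNReal).meanReward x a =
      if Terminal φ x then score n H r (lead w n H x.1) else 0 := by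
  have h0 := lead_nonneg (H := H) w x.2.2
  have h1 : score n H r (lead w n H x.1) ≤ 1 := by
    refine pow_le_one₀ (by positivity) ?_
    rw [div_le_one (by positivity)]
    linarith [lead_le (H := H) w x.2.1]
  rw [meanReward_searchMDP]
  congr 1
  rw [min_eq_left (by simpa using h1), Real.coe_toNNReal _ (score_nonneg h0)]

/-- The optimal policy of local search. -/
noncomputable def searchPolicy (φ : Formula v) (w : ℕ → Bool) (x : State n H) : Fin 2 :=
  match violated x.1 φ with
  | [] => 0
  | c :: _ => if x.1.head? = some true then (if litHolds w (c 1) then 0 else 1)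
    else if litHolds w (c 0) then 0 else 1

theorem searchValue_of_head (φ : Formula v) (w : ℕ → Bool) (r : ℕ) {y : State n H}
    (h : y.1.head? ≠ some true) : searchValue φ w r y = score n H r (lead w n H y.1) := by
  rw [searchValue, if_neg fun h' => h h'.1]

theorem searchValue_of_terminal {φ : Formula v} (w : ℕ → Bool) (r : ℕ) {y : State n H}
    (h : Terminal φ y) : searchValue φ w r y = score n H r (lead w n H y.1) := by
  rw [searchValue, if_neg fun h' => h'.2 h]

theorem searchValue_of_mid {φ ψ : Formula v} {c : Clause v} (w : ℕ → Bool) (r : ℕ) {y : State n H}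
    (h : y.1.head? = some true) (h' : ¬ Terminal φ y) (hc : violated y.1 φ = c :: ψ) :
    searchValue φ w r y = score n H r (lead w n H y.1 -
        if litHolds w (c 1) || litHolds w (c 2) then 0 else 2) := by
  rw [searchValue, if_pos ⟨h, h'⟩]
  split
  · simp_all
  · simp_all

theorem bitAt_cons_tail (b : Bool) {x : List Bool} (hx : x ≠ []) : bitAt (b :: x.tail) = bitAt x := by
  obtain ⟨a, x, rfl⟩ := List.exists_cons_of_ne_nil hx
  rfl

/-- No flip increases the lead. In phase 0 the first false clause has a literal true under `w`: if
it is the first one, flipping it keeps the lead, and otherwise phase 1 offers a right flip. If in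
phase 1 the second and the third literal are both false under `w`, each action loses 2, as the value
function says. -/
theorem search_bellman {φ : Formula v} {w : ℕ → Bool} (hw : ∀ c ∈ φ, clauseHolds w c = true)
    (hv : v ≤ n) (r : ℕ) (x : State n H) :
    (∀ a, (searchMDP φ n H fun x => (score n H r (lead w n H x)).toNNReal).meanReward x a +
      (searchNext φ x a).elim 0 (searchValue φ w r) ≤ searchValue φ w r x) ∧
    (searchMDP φ n H fun x => (score n H r (lead w n H x)).toNNReal).meanReward x
        (searchPolicy φ w x) +
      (searchNext φ x (searchPolicy φ w x)).elim 0 (searchValue φ w r) = searchValue φ w r x := by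
  simp only [meanReward_search]
  by_cases ht : Terminal φ x
  · simp [searchNext_eq_none ht, ht, searchValue_of_terminal w r ht]
  obtain ⟨hx, c, ψ, hc, hy⟩ := exists_of_not_terminal ht
  choose y hy hy' using hy
  obtain ⟨hcφ, hcx⟩ := violated_cons hc
  have hcw := hw c hcφ
  simp only [clauseHolds, Bool.or_eq_false_iff] at hcx
  obtain ⟨hc0, hc1, hc2⟩ := hcx
  simp only [ht, if_false, zero_add, hy, Option.elim_some]
  -- A flip returns to phase 0, where the value is the plain score, whether the new state is
  -- terminal or not.
  have hflip (z : State n H) (ℓ : Fin v × Bool) (hℓ : litHolds (bitAt x.1) ℓ = false)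
      (hz : z.1 = flipBit ℓ.1 x.1) : searchValue φ w r z =
        score n H r (lead w n H x.1 - if litHolds w ℓ then 0 else 2) := by
    rw [searchValue_of_head, hz, lead_flipBit w x.2.1 hv hℓ]
    rw [hz]; simp [flipBit]
  have hmono (ℓ : Fin v × Bool) (hℓ : litHolds (bitAt x.1) ℓ = false) :
      score n H r (lead w n H x.1 - if litHolds w ℓ then 0 else 2) ≤
        score n H r (lead w n H x.1) := by
    cases hwℓ : litHolds w ℓ with
    | true => simp
    | false =>
      have := two_le_lead w hv hx hℓ hwℓ
      refine score_mono ?_ ?_ <;> simp; linarith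
  by_cases hm : x.1.head? = some true
  · have hy0 : (y 0).1 = flipBit (c 1).1 x.1 := by rw [hy']; simp [coreNext, hm]
    have hy1 : (y 1).1 = flipBit (c 2).1 x.1 := by rw [hy']; simp [coreNext, hm]
    rw [searchValue_of_mid w r hm ht hc]
    have h0 := hflip _ _ hc1 hy0
    have h1 := hflip _ _ hc2 hy1
    have hp : searchPolicy φ w x = if litHolds w (c 1) then 0 else 1 := by
      simp [searchPolicy, hc, hm]
    have m1 := hmono _ hc1
    have m2 := hmono _ hc2
    rw [hp, Fin.forall_fin_two, h0, h1]
    cases hw1 : litHolds w (c 1) <;> cases hw2 : litHolds w (c 2) <;>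
      simp [hw1, hw2, h0, h1] at m1 m2 ⊢ <;> assumption
  · have hy0 : (y 0).1 = flipBit (c 0).1 x.1 := by rw [hy']; simp [coreNext, hm]
    have hy1 : (y 1).1 = true :: x.1.tail := by rw [hy']; simp [coreNext, hm]
    rw [searchValue_of_head φ w r hm]
    have hb : bitAt (y 1).1 = bitAt x.1 := by rw [hy1, bitAt_cons_tail _ x.ne_nil]
    have hl : (y 1).1.length = x.1.length := by
      have := List.length_pos_iff.2 x.ne_nil
      rw [hy1]; simp; omega
    have hvy : violated (y 1).1 φ = c :: ψ := by rw [violated, hb]; exact hc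
    have hty : ¬ Terminal φ (y 1) := by
      rw [Terminal, hvy, hl]; simp; omega
    have hle : lead w n H (y 1).1 = lead w n H x.1 := by rw [lead, lead, agree, agree, hb, hl]
    have h0 := hflip _ _ hc0 hy0
    have h1 := searchValue_of_mid w r (by rw [hy1]; rfl) hty hvy
    rw [hle] at h1
    have hp : searchPolicy φ w x = if litHolds w (c 0) then 0 else 1 := by
      simp [searchPolicy, hc, hm]
    have m0 := hmono _ hc0
    have m1 := hmono _ hc1
    rw [hp, Fin.forall_fin_two, h0, h1]
    simp only [clauseHolds] at hcw
    cases hw0 : litHolds w (c 0) <;> cases hw1 : litHolds w (c 1) <;>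
      cases hw2 : litHolds w (c 2) <;> simp [hw0, hw1, hw2, h0, h1] at m0 m1 hcw ⊢ <;> assumption

end Value

/-! ### Linearity of the optimal value function in the features. -/

section Features

variable {v n H : ℕ}

/-- The vector with inner product 1 with the true literals, in the order of `oneHotBits`. -/
def literalVec (w : ℕ → Bool) (n : ℕ) : List ℝ :=
  (List.range n).flatMap fun i => if w i then [0, 1] else [1, 0]

theorem length_flatMap_pair {α β : Type} (l : List α) (f : α → List β) (h : ∀ a, (f a).length = 2) :
    (l.flatMap f).length = 2 * l.length := by
  simp [List.length_flatMap, h, mul_comm]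

theorem length_literalVec (w : ℕ → Bool) (n : ℕ) : (literalVec w n).length = 2 * n := by
  rw [literalVec, length_flatMap_pair _ _ fun a => by split_ifs <;> rfl, List.length_range]

/-- The vector whose inner product with the assignment gives the score at level `l`. -/
noncomputable def scoreVec (w : ℕ → Bool) (n H l : ℕ) : List ℝ :=
  (List.range n).flatMap fun i =>
    [((if w i then 0 else 1) + ((H : ℝ) - l) / n) / (H + n + 1),
      ((if w i then 1 else 0) + ((H : ℝ) - l) / n) / (H + n + 1)]

theorem length_scoreVec (w : ℕ → Bool) (n H l : ℕ) : (scoreVec w n H l).length = 2 * n := by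
  rw [scoreVec, length_flatMap_pair _ _ fun a => rfl, List.length_range]

def pairBits (b : Bool) : List Sym :=
  if b then [.bit false, .bit true] else [.bit true, .bit false]

theorem oneHotBits_bits (x : List Bool) : oneHotBits (bits x) = x.flatMap pairBits := by
  induction x with
  | nil => rfl
  | cons b x ih =>
    rw [List.flatMap_cons, ← ih]
    cases b <;> rfl

theorem take_tail_eq {x : List Bool} (hx : n + 1 ≤ x.length) :
    x.tail.take n = (List.range n).map (bitAt x) := by
  obtain ⟨b, x, rfl⟩ := List.exists_cons_of_ne_nil (List.ne_nil_of_length_pos (by omega : 0 < x.length))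
  simp only [List.length_cons] at hx
  refine List.ext_getElem (by simp; omega) fun i h1 h2 => ?_
  have h3 : i < x.length := by simp at h1; omega
  rw [List.getElem_take, List.getElem_map, List.getElem_range, bitAt, List.getD_cons_succ,
    List.getD_eq_getElem _ _ h3]
  rfl

theorem assignmentBits_eq {x : List Bool} (hx : n + 1 ≤ x.length) :
    oneHotBits ((bits x).tail.take (unary n).length) =
      (List.range n).flatMap fun i => pairBits (bitAt x i) := by
  rw [bits_tail, length_unary, bits, ← List.map_take, take_tail_eq hx]
  change oneHotBits (bits _) = _
  rw [oneHotBits_bits, List.flatMap_map]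

theorem length_pairBits (b : Bool) : (pairBits b).length = 2 := by cases b <;> rfl

/-- The one-hot encoding selects one entry for each variable; the constant `H - l` is spread evenly
over the `n` variables, so no separate constant coordinate is needed. -/
theorem dot_scoreVec (w : ℕ → Bool) (hn : 1 ≤ n) (l : ℕ) (f : ℕ → Bool) :
    dot (scoreVec w n H l) ((List.range n).flatMap fun i => pairBits (f i)) =
      (∑ i ∈ Finset.range n, (if f i = w i then 1 else 0) + ((H : ℝ) - l)) / (H + n + 1) := by
  have hn' : (n : ℝ) ≠ 0 := by positivity
  rw [scoreVec, dot_flatMap_range _ _ _ fun i _ => by rw [length_pairBits]; rfl]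
  calc _ = ∑ i ∈ Finset.range n, ((if f i = w i then 1 else 0) + ((H : ℝ) - l) / n) / (H + n + 1) := by
        refine Finset.sum_congr rfl fun i _ => ?_
        cases f i <;> cases w i <;> simp [pairBits, dot]
    _ = _ := by
        rw [← Finset.sum_div, Finset.sum_add_distrib]
        simp
        field_simp

theorem literalVec_split (w : ℕ → Bool) (i k : ℕ) : literalVec w (i + (1 + k)) =
    literalVec w i ++ ((if w i then [0, 1] else [1, 0]) ++ literalVec (fun j => w (i + (1 + j))) k) := by
  simp only [literalVec, List.range_add, List.flatMap_append, List.flatMap_map, List.map_append]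
  congr 1
  simp

theorem dot_litVec (w : ℕ → Bool) (hv : v ≤ n) (ℓ : Fin v × Bool) :
    dot (literalVec w n) (litVec (litCode ℓ) (unary n)) = if litHolds w ℓ then 1 else 0 := by
  obtain ⟨k, rfl⟩ : ∃ k, n = ℓ.1 + (1 + k) := ⟨n - ℓ.1 - 1, by have := ℓ.1.2; omega⟩
  rw [literalVec_split, litVec, litCode]
  simp only [List.tail_cons, length_unary]
  rw [dot_append (by rw [length_literalVec]; simp [length_zeros, length_unary]; ring), dot_append (by
      split_ifs <;> cases ℓ.2 <;> rfl)]
  simp only [zeros_eq, ← List.replicate_add, dot_replicate_false, litHolds]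
  rcases Bool.eq_false_or_eq_true (w ℓ.1) with h | h <;>
    rcases Bool.eq_false_or_eq_true ℓ.2 with h' | h' <;> simp [oneHotBits, dot, h, h']

theorem length_litVec (hv : v ≤ n) (ℓ : Fin v × Bool) :
    (litVec (litCode ℓ) (unary n)).length = 2 * n := by
  have := ℓ.1.2
  rw [litVec, litCode]
  cases ℓ.2 <;> simp [oneHotBits, length_zeros, length_unary] <;> omega

/-- Exactly one of the two literals of variable 0 is true under `w`, so their sum represents the
constant 1. -/
theorem dot_oneVec (w : ℕ → Bool) (hn : 1 ≤ n) : dot (literalVec w n) (oneVec (unary n)) = 1 := by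
  obtain ⟨k, rfl⟩ : ∃ k, n = 0 + (1 + k) := ⟨n - 1, by omega⟩
  rw [literalVec_split, oneVec]
  change dot ([] ++ _) ([Sym.bit true, Sym.bit true] ++ _) = 1
  rw [List.nil_append, dot_append (by split_ifs <;> rfl)]
  simp only [zeros_eq]
  cases w 0 <;> simp [dot, dot_replicate_false]

theorem length_oneVec (hn : 1 ≤ n) : (oneVec (unary n)).length = 2 * n := by
  simp [oneVec, length_zeros, length_unary]; omega

theorem levelVec_eq (t : List Sym) : levelVec t (unary H) =
    List.replicate t.length (.bit false) ++ .bit true ::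
      List.replicate (H + 1 - t.length) (.bit false) := by
  rw [levelVec, zeros_eq, zeros_eq]
  congr 3
  simp [length_unary]

theorem length_levelVec (t : List Sym) (ht : t.length ≤ H + 1) :
    (levelVec t (unary H)).length = H + 2 := by
  rw [levelVec_eq t]; simp; omega

/-- Levels run up to `H + 1`, beyond the range of states: a phase 1 state at level `H - 1` needs the
score two levels higher. -/
noncomputable def slotParam (w : ℕ → Bool) (n H r : ℕ) : List ℝ :=
  (List.range (H + 2)).flatMap fun l => realKron (literalVec w n)
    (realKron (literalVec w n) (realPow (scoreVec w n H l) r))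

theorem length_slotParam (w : ℕ → Bool) (n H r : ℕ) :
    (slotParam w n H r).length = (H + 2) * (2 * n) ^ (r + 2) := by
  simp [slotParam, List.length_flatMap, length_realKron, length_literalVec, length_realPow,
    length_scoreVec]
  ring

theorem dot_slot (w : ℕ → Bool) (r : ℕ) {t p q u d : List Sym} (hn : 1 ≤ n)
    (ht : t.length ≤ H + 1) (hp : p.length = 2 * n) (hq : q.length = 2 * n) (hu : u.length = 2 * n)
    (hd : (2 * n) ^ r ≤ d.length) :
    dot (slotParam w n H r) (slot (levelVec t (unary H)) p q (kronPow (unary r) u d)) =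
      dot (literalVec w n) p * dot (literalVec w n) q * dot (scoreVec w n H t.length) u ^ r ∧
    (slot (levelVec t (unary H)) p q (kronPow (unary r) u d)).length = (H + 2) * (2 * n) ^ (r + 2) := by
  have hu' : u ≠ [] := List.ne_nil_of_length_pos (by omega)
  rw [← hu] at hd
  have hlU := length_kronPow hd hu'
  have hls (l : ℕ) : (scoreVec w n H l).length = u.length := by rw [length_scoreVec, hu]
  constructor
  · rw [slotParam, slot, List.flatMap, dot_flatten_kron, levelVec_eq _, dot_oneHot, List.map_map,
      List.getD_eq_getElem _ _ (by simp; omega)]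
    · simp only [List.getElem_map, List.getElem_range, comp_apply]
      rw [dot_realKron, dot_realKron, dot_realPow _ hd hu' (hls _), mul_assoc]
      · rw [length_realPow, hlU, hls]
      · rw [length_realKron, length_kron, length_realPow, hlU, hls, length_literalVec, hq]
    · intro F hF
      obtain ⟨l, -, rfl⟩ := List.mem_map.1 hF
      simp only [length_realKron, length_kron, length_literalVec, length_realPow, hls, hlU, hp, hq]
  · rw [slot, length_kron, length_kron, length_kron, hlU, length_levelVec _ ht, hp, hq, hu]
    ring

theorem score_eq (w : ℕ → Bool) (hn : 1 ≤ n) (r : ℕ) {x : List Bool} (l : ℕ) :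
    dot (scoreVec w n H l) ((List.range n).flatMap fun i => pairBits (bitAt x i)) ^ r =
      score n H r (H - l + agree w n x) := by
  rw [dot_scoreVec w hn, score, agree, add_comm]

theorem negHead_litCode (ℓ : Fin v × Bool) : negHead (litCode ℓ) = litCode (ℓ.1, !ℓ.2) := by
  obtain ⟨i, s⟩ := ℓ
  cases s <;> simp [negHead, litCode]

theorem litHolds_neg (w : ℕ → Bool) (ℓ : Fin v × Bool) : litHolds w (ℓ.1, !ℓ.2) = !litHolds w ℓ := by
  simp only [litHolds]
  cases w ℓ.1 <;> cases ℓ.2 <;> rfl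

noncomputable def featParam (w : ℕ → Bool) (n H r : ℕ) : List ℝ :=
  slotParam w n H r ++ (slotParam w n H r ++ slotParam w n H r)

/-- The optimal value function is linear in the features. -/
theorem dot_feat (φ : Formula v) (w : ℕ → Bool) (hv : v ≤ n) (hn : 1 ≤ n) (r d : ℕ)
    (hd : (2 * n) ^ r ≤ d) (x : State n H) :
    dot (featParam w n H r) (feat (bits x.1) (clausesCode φ) (unary n) (unary H) (unary r) (unary d)) =
      searchValue φ w r x ∧
    (feat (bits x.1) (clausesCode φ) (unary n) (unary H) (unary r) (unary d)).length =
      3 * ((H + 2) * (2 * n) ^ (r + 2)) := by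
  have hx1 := x.2.1
  have hx2 := x.2.2
  have hlen : ((bits x.1).drop (unary n).length).drop (unary H).length = [] ↔
      x.1.length < n + 1 + H := by
    rw [← List.length_eq_zero_iff]; simp [length_bits, length_unary]; omega
  set u := (List.range n).flatMap fun i => pairBits (bitAt x.1 i) with hu
  have hlu : u.length = 2 * n := by
    rw [hu, length_flatMap_pair _ _ fun i => length_pairBits _, List.length_range]
  have hmon : monomials (bits x.1) (unary n) (unary r) (unary d) = kronPow (unary r) u (unary d) := by
    rw [monomials, assignmentBits_eq x.2.1]
  have hd' : (2 * n) ^ r ≤ (unary d).length := by rwa [length_unary]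
  have hlev : (level (bits x.1) (unary n)).length = x.1.length - (n + 1) := by
    simp [level, length_bits, length_unary]
  have hlead : (H : ℝ) - (level (bits x.1) (unary n)).length + agree w n x.1 = lead w n H x.1 := by
    rw [hlev, Nat.cast_sub x.2.1, lead]; push_cast; ring
  have hmain : dot (featParam w n H r) (mainFeat (bits x.1) (unary n) (unary H)
        (kronPow (unary r) u (unary d))) = score n H r (lead w n H x.1) ∧
      (mainFeat (bits x.1) (unary n) (unary H) (kronPow (unary r) u (unary d))).length =
        3 * ((H + 2) * (2 * n) ^ (r + 2)) := by
    obtain ⟨h1, h2⟩ := dot_slot (H := H) w r hn (t := level (bits x.1) (unary n)) (by rw [hlev]; omega)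
      (length_oneVec hn) (length_oneVec hn) hlu hd'
    constructor
    · rw [featParam, mainFeat, dot_append (by rw [h2, length_slotParam]), dot_append (by
        rw [length_zeros, h2, length_slotParam]), dot_zeros, h1, dot_oneVec w hn, score_eq w hn, hlead]
      simp
    · simp only [mainFeat, List.length_append, length_zeros, h2]; ring
  rw [feat, hmon, firstFalse_bits (by omega)]
  have hhead : (bits x.1).head? = some (.bit true) ↔ x.1.head? = some true := by
    cases h : x.1 <;> simp [bits]
  by_cases hm : x.1.head? = some true
  swap
  · rw [if_neg (by rwa [hhead]), searchValue_of_head _ _ _ hm]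
    exact hmain
  rw [if_pos (by rwa [hhead])]
  by_cases ht : Terminal φ x
  · rw [searchValue_of_terminal _ _ ht]
    rcases ht with ht | ht
    · rw [if_pos (clausesCode_eq_nil.2 ht)]
      exact hmain
    · split_ifs with h1 h2
      · exact hmain
      · rw [hlen] at h2; omega
      · exact hmain
  obtain ⟨hxl, c, ψ, hc, -⟩ := exists_of_not_terminal ht
  obtain ⟨-, e1, e2, -⟩ := before_clausesCode c ψ
  rw [searchValue_of_mid w r hm ht hc, hc, if_neg (by simp [clausesCode_eq_nil]), if_pos (hlen.2 hxl),
    e1, e2, midFeat, negHead_litCode, negHead_litCode]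
  -- The three slots are the disjoint cases for `w`: second and third literal false, only the third
  -- of them true, second true. In the first case the lead drops by 2, which is the same as a level
  -- higher by 2; this stays at most `H + 1` because the state is not terminal.
  obtain ⟨a1, a2⟩ := dot_slot (H := H) w r hn (t := .bit true :: .bit true :: level (bits x.1) (unary n))
    (by simp only [List.length_cons]; rw [hlev]; omega)
    (length_litVec hv ((c 1).1, !(c 1).2)) (length_litVec hv ((c 2).1, !(c 2).2)) hlu hd'
  obtain ⟨b1, b2⟩ := dot_slot (H := H) w r hn (t := level (bits x.1) (unary n)) (by rw [hlev]; omega)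
    (length_litVec hv ((c 1).1, !(c 1).2)) (length_litVec hv (c 2)) hlu hd'
  obtain ⟨d1, d2⟩ := dot_slot (H := H) w r hn (t := level (bits x.1) (unary n)) (by rw [hlev]; omega)
    (length_litVec hv (c 1)) (length_oneVec hn) hlu hd'
  constructor
  · rw [featParam, dot_append (by rw [a2, length_slotParam]), dot_append (by
      rw [b2, length_slotParam]), a1, b1, d1, score_eq w hn, score_eq w hn, hlead, dot_oneVec w hn]
    simp only [dot_litVec w hv, litHolds_neg]
    have h2 : (H : ℝ) - ((Sym.bit true :: Sym.bit true :: level (bits x.1) (unary n)).length : ℕ) +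
        agree w n x.1 = lead w n H x.1 - 2 := by
      rw [← hlead]; simp only [List.length_cons]; push_cast; ring
    rw [h2]
    cases litHolds w (c 1) <;> cases litHolds w (c 2) <;> simp
  · simp only [List.length_append, a2, b2, d2]; ring

end Features

/-! ### The search process as an instance, and the strings that replace its answers. -/

section Oracle

variable {v n H : ℕ}

/-- The vector with entries 0 and 1 given by a bit string. -/
def bitVec (d : ℕ) (l : List Sym) (i : Fin d) : ℚ := if l[(i : ℕ)]? = some (.bit true) then 1 else 0

def stateFeat (φ : Formula v) (r d : ℕ) (x : State n H) : List Sym :=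
  feat (bits x.1) (clausesCode φ) (unary n) (unary H) (unary r) (unary d)

/-- The local search process as an instance of Linear-2-RL. -/
noncomputable def searchOracle (φ : Formula v) (n H r d : ℕ) (g : List Bool → NNReal) :
    RLOracle 2 d where
  S := State n H
  M := searchMDP φ n H g
  code := Subtype.val
  code_injective := Subtype.val_injective
  featS x := bitVec d (stateFeat φ r d x)
  featSA x a := bitVec d (stateFeat φ r d ((searchNext φ x a).getD x))

noncomputable def successProb (w : ℕ → Bool) (n H r : ℕ) (x : List Bool) : NNReal :=
  (score n H r (lead w n H x)).toNNReal

theorem searchOracle_linearOpt {φ : Formula v} {w : ℕ → Bool} (hw : ∀ c ∈ φ, clauseHolds w c = true)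
    (hv : v ≤ n) (hn : 1 ≤ n) {r d : ℕ} (hd : d = 3 * ((H + 2) * (2 * n) ^ (r + 2))) :
    (searchOracle φ n H r d (successProb w n H r)).LinearOpt ∧
      ∀ x, (searchMDP φ n H (successProb w n H r)).optV x = searchValue φ w r x := by
  have hb := search_bellman hw hv r (H := H)
  have hV := DetMDP.optV_eq (M := searchMDP φ n H (successProb w n H r)) (fun x => (hb x).1)
    fun x => (hb x).2
  have hQ := DetMDP.optQ_eq (M := searchMDP φ n H (successProb w n H r)) (fun x => (hb x).1)
    fun x => (hb x).2
  have hd' : (2 * n) ^ r ≤ d := by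
    have h1 : (2 * n) ^ r ≤ (2 * n) ^ (r + 2) := Nat.pow_le_pow_right (by omega) (by omega)
    rw [hd]
    nlinarith
  have hf (x : State n H) : searchValue φ w r x =
      ∑ i : Fin d, (featParam w n H r).getD i 0 * (bitVec d (stateFeat φ r d x) i : ℝ) := by
    obtain ⟨h1, h2⟩ := dot_feat φ w hv hn r d hd' x
    rw [← h1]
    refine (sum_eq_dot _ _ ?_ (by rw [h2, hd])).symm
    simp only [featParam, List.length_append, length_slotParam]
    rw [hd]; ring
  -- Without a successor the action value is the mean terminal reward, which is the value of the
  -- state itself; this is the role of the default `x`.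
  have hQ' (x : State n H) (a : Fin 2) : (searchMDP φ n H (successProb w n H r)).optQ x a =
      searchValue φ w r ((searchNext φ x a).getD x) := by
    have hm : (searchMDP φ n H (successProb w n H r)).meanReward x a = _ := meanReward_search x a
    rw [hQ, hm]
    change _ + (searchNext φ x a).elim 0 (searchValue φ w r) = _
    by_cases ht : Terminal φ x
    · simp [searchNext_eq_none ht, ht, searchValue_of_terminal w r ht]
    · obtain ⟨-, c, ψ, -, hy⟩ := exists_of_not_terminal ht
      obtain ⟨y, hy, -⟩ := hy a
      simp [hy, ht]
  exact ⟨⟨fun i => (featParam w n H r).getD i 0, fun x => (hV x).trans (hf x),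
    fun x a => (hQ' x a).trans (hf _)⟩, hV⟩

/-- For unsatisfiable formulas there is no `w` to define rewards, and the algorithm need only halt
in time on valid instances. Zero rewards give one, with parameter vector 0. -/
theorem searchOracle_zero_linearOpt (φ : Formula v) (r d : ℕ) :
    (searchOracle φ n H r d 0).LinearOpt := by
  have hm (x : State n H) (a : Fin 2) : (searchMDP φ n H 0).meanReward x a = 0 := by
    rw [meanReward_searchMDP]; simp
  have hb (x : State n H) (a : Fin 2) : (searchMDP φ n H 0).meanReward x a +
      ((searchMDP φ n H 0).next x a).elim 0 (0 : State n H → ℝ) = 0 := by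
    rw [hm]; cases (searchMDP φ n H 0).next x a <;> simp
  have hV (x : State n H) : (searchMDP φ n H 0).optV x = 0 :=
    DetMDP.optV_eq (W := 0) (fun x a => (hb x a).le) (π := fun _ => 0) (fun x => hb x _) x
  have hQ (x : State n H) (a : Fin 2) : (searchMDP φ n H 0).optQ x a = 0 :=
    (DetMDP.optQ_eq (W := 0) (fun x a => (hb x a).le) (π := fun _ => 0) (fun x => hb x _) x a).trans
      (hb x a)
  refine ⟨0, fun x => (hV x).trans ?_, fun x a => (hQ x a).trans ?_⟩ <;> simp

theorem ratCode_zero : ratCode 0 = [.bit false, .sep, .bit true, .sep] := by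
  simp [ratCode, natCode]

theorem ratCode_one : ratCode 1 = [.bit false, .bit true, .sep, .bit true, .sep] := by
  simp [ratCode, natCode]

theorem ratCode_bitVec_length (d : ℕ) (l : List Sym) (i : Fin d) :
    (ratCode (bitVec d l i)).length ≤ 5 := by
  rw [bitVec]
  split_ifs
  · simp [ratCode_one]
  · simp [ratCode_zero]

theorem searchOracle_sizeLE (φ : Formula v) (r : ℕ) {d B : ℕ} (g : List Bool → NNReal)
    (h5 : 5 ≤ B) (hB : n + 1 + H ≤ B) : (searchOracle φ n H r d g).SizeLE B := by
  refine ⟨fun x => x.2.2.trans hB, fun (x : State n H) a y hy => ?_, fun x i => ?_, fun x a i => ?_⟩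
  · have hy : y ∈ (if Terminal φ x then coin (g x.1) else PMF.pure 0).support := hy
    have : y = 0 ∨ y = 1 := by
      split_ifs at hy
      · exact coin_support _ y hy
      · left; simpa using hy
    rcases this with rfl | rfl
    · rw [ratCode_zero]; simp; omega
    · rw [ratCode_one]; simp; omega
  · exact (ratCode_bitVec_length _ _ _).trans h5
  · exact (ratCode_bitVec_length _ _ _).trans h5

theorem bits_injective : Injective bits := fun x y h =>
  (List.map_injective_iff.2 fun a b h => by simpa using h) h

section Answers

variable (φ : Formula v) (r d : ℕ) (g : List Bool → NNReal)

theorem decode_bits (x : State n H) : (searchOracle φ n H r d g).decode (bits x.1) = some x := by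
  have h : ∃ s, (searchOracle φ n H r d g).stateCode s = bits x.1 := ⟨x, rfl⟩
  rw [RLOracle.decode, dif_pos h]
  have := h.choose_spec
  exact congrArg some (Subtype.ext (bits_injective this))

theorem decode_of_not_state {x : List Sym} (h : isState x (unary n) (unary H) = []) :
    (searchOracle φ n H r d g).decode x = none := by
  rw [RLOracle.decode, dif_neg]
  rintro ⟨s, hs⟩
  exact isState_ne_nil_iff.2 ⟨s.1, hs.symm, s.2⟩ h

theorem vecCode_bitVec {l : List Sym} (h : l.length = d) : vecCode (bitVec d l) = bitVecCode l := by
  have : List.ofFn (bitVec d l) = l.map fun a => if a = .bit true then (1 : ℚ) else 0 := by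
    refine List.ext_getElem (by simp [h]) fun i h1 h2 => ?_
    have h3 : i < l.length := by simpa using h2
    simp [bitVec, h3]
  rw [vecCode, this, List.flatMap_map, bitVecCode]
  congr 1
  funext a
  split_ifs with ha
  · simp [ratCode_one]
  · simp [ratCode_zero]

/-- The tuple of arguments of the answer function. -/
def queryArgs (φ : Formula v) (n H r d : ℕ) (x : List Sym) : Fin 6 → List Sym :=
  ![x, clausesCode φ, unary n, unary H, unary r, unary d]

theorem le_map_apply {α β : Type} (D : PMF α) (f : α → β) (a : α) : D a ≤ (D.map f) (f a) := by
  classical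
  rw [PMF.map_apply]
  refine le_trans ?_ (ENNReal.le_tsum a)
  simp

/-- Only the rewards of terminal states are random. Such a state is either satisfying, so that the
query is hot, or it has no flips left, and then the reward 0 has probability at least `1 - ε`. The
condition `g < 1` puts the answer 0 into the support even for satisfying states. -/
theorem answer_searchOracle (hv : v ≤ n) (hn : 1 ≤ n) (hd : d = 3 * ((H + 2) * (2 * n) ^ (r + 2)))
    (ε : NNReal) (hg1 : ∀ x : State n H, g x.1 < 1)
    (hg : ∀ x : State n H, x.1.length = n + 1 + H → g x.1 ≤ ε) (o : RLCall 2) (x : List Sym) :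
    answerStr o (queryArgs φ n H r d x) ∈ ((searchOracle φ n H r d g).answer o x).support ∧
    (satState x (clausesCode φ) (unary n) (unary H) ≠ [] ∨ 1 ≤
      (searchOracle φ n H r d g).answer o x (answerStr o (queryArgs φ n H r d x)) + ε) := by
  have pure_case (y : List Sym) (h : (searchOracle φ n H r d g).answer o x = PMF.pure y)
      (h' : answerStr o (queryArgs φ n H r d x) = y) :
      answerStr o (queryArgs φ n H r d x) ∈ ((searchOracle φ n H r d g).answer o x).support ∧
      (satState x (clausesCode φ) (unary n) (unary H) ≠ [] ∨ 1 ≤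
        (searchOracle φ n H r d g).answer o x (answerStr o (queryArgs φ n H r d x)) + ε) := by
    rw [h, h']
    simp
  have hd' : (2 * n) ^ r ≤ d := by
    have h1 : (2 * n) ^ r ≤ (2 * n) ^ (r + 2) := Nat.pow_le_pow_right (by omega) (by omega)
    rw [hd]
    nlinarith
  -- The length of the features does not involve `w`, so any assignment serves.
  have hfeat (x : State n H) : (stateFeat φ r d x).length = d :=
    (dot_feat φ (fun _ => true) hv hn r d hd' x).2.trans hd.symm
  by_cases hx : isState x (unary n) (unary H) = []
  · refine pure_case [.sep] ?_ ?_
    · rw [RLOracle.answer, decode_of_not_state φ r d g hx]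
    · cases o <;> simp [answerStr, queryArgs, hx, nextStr]
  obtain ⟨y, rfl, hy⟩ := isState_ne_nil_iff.1 hx
  have hdec := decode_bits φ r d g ⟨y, hy⟩
  change (searchOracle φ n H r d g).decode (bits y) = _ at hdec
  cases o with
  | next a =>
    refine pure_case _ (by rw [RLOracle.answer, hdec]) ?_
    exact nextStr_bits hv φ ⟨y, hy⟩ a
  | featS =>
    refine pure_case _ (by rw [RLOracle.answer, hdec]) ?_
    refine Eq.trans ?_ (vecCode_bitVec d (hfeat ⟨y, hy⟩)).symm
    simp [answerStr, queryArgs, hx, stateFeat]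
  | featSA a =>
    refine pure_case _ (by rw [RLOracle.answer, hdec]) ?_
    refine Eq.trans ?_ (vecCode_bitVec d (hfeat ((searchNext φ ⟨y, hy⟩ a).getD ⟨y, hy⟩))).symm
    have h1 := nextStr_bits hv φ ⟨y, hy⟩ a
    simp only [answerStr, queryArgs, stateFeat]
    simp only [Matrix.cons_val, hx, if_false, nextOrSelf, h1]
    cases h2 : searchNext φ ⟨y, hy⟩ a with
    | none => simp
    | some z =>
      obtain ⟨b, z', hz⟩ := List.exists_cons_of_ne_nil z.ne_nil
      have : (bits z.1).head? ≠ some .sep := by rw [hz]; simp [bits]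
      simp [this]
  | reward a =>
    have hans : (searchOracle φ n H r d g).answer (.reward a) (bits y) =
        (if Terminal φ (⟨y, hy⟩ : State n H) then coin (g y) else PMF.pure 0).map ratCode := by
      rw [RLOracle.answer, hdec]
      rfl
    have hstr : answerStr (.reward a) (queryArgs φ n H r d (bits y)) = ratCode 0 := by
      simp [answerStr, queryArgs, hx, ratCode_zero]
    by_cases ht : Terminal φ (⟨y, hy⟩ : State n H)
    swap
    · refine pure_case (ratCode 0) ?_ hstr
      rw [hans, if_neg ht, PMF.pure_map]
    rw [hans, hstr, if_pos ht]
    have h0 := le_map_apply (coin (g y)) ratCode 0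
    have hlt : g y < 1 := hg1 ⟨y, hy⟩
    rw [coin_zero, min_eq_left hlt.le] at h0
    constructor
    · rw [PMF.mem_support_iff]
      intro h
      rw [h] at h0
      have : 1 - g y = 0 := by exact_mod_cast le_antisymm h0 zero_le
      exact absurd (tsub_eq_zero_iff_le.1 this) (not_le.2 hlt)
    · rcases ht with ht | ht
      · exact Or.inl ((satState_bits hv φ ⟨y, hy⟩).2 ht)
      · right
        refine le_trans ?_ (add_le_add_left h0 _)
        rw [← ENNReal.coe_add, ENNReal.one_le_coe_iff]
        have := hg ⟨y, hy⟩ ht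
        calc (1 : NNReal) = 1 - g y + g y := (tsub_add_cancel_of_le hlt.le).symm
          _ ≤ _ := by gcongr

end Answers

theorem exists_satisfies_of_satState {φ : Formula v} (hv : v ≤ n) {x : List Sym}
    (h : satState x (clausesCode φ) (unary n) (unary H) ≠ []) : ∃ w, Satisfies w φ := by
  have hx : isState x (unary n) (unary H) ≠ [] := by
    intro h'
    rw [satState, if_pos h'] at h
    exact h rfl
  obtain ⟨y, rfl, hy⟩ := isState_ne_nil_iff.1 hx
  have h1 := (satState_bits hv φ (⟨y, hy⟩ : State n H)).1 h
  refine ⟨fun i => bitAt y i, fun c hc => ?_⟩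
  have h2 := List.dropWhile_eq_nil_iff.1 h1 c hc
  simp only [clauseHolds, litHolds, Bool.or_eq_true, beq_iff_eq] at h2
  rcases h2 with h2 | h2 | h2
  · exact ⟨0, h2⟩
  · exact ⟨1, h2⟩
  · exact ⟨2, h2⟩

/-! ### Verification of the policy found by the algorithm. -/

section Path

variable {φ : Formula v}

/-- The code of each action ends with a separator. In the reversed string a separator is therefore
followed by `bit true` for action 1, and by another separator or nothing for action 0. -/
theorem pathEnd_append_action (l : List (Fin 2)) (a : Fin 2) (c n h : List Sym) :
    pathEnd (actionsCode (l ++ [a])).reverse c n h =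
      if satState (pathEnd (actionsCode l).reverse c n h) c n h = [] then
        nextStr a (pathEnd (actionsCode l).reverse c n h) c n h
      else pathEnd (actionsCode l).reverse c n h := by
  have e : (actionsCode (l ++ [a])).reverse =
      .sep :: ((unary a).reverse ++ (actionsCode l).reverse) := by
    simp [actionsCode]
  have hs : (actionsCode l).reverse.head? ≠ some (.bit true) := by
    rcases List.eq_nil_or_concat l with rfl | ⟨l', b, rfl⟩
    · simp [actionsCode]
    · simp [actionsCode]
  rw [e]
  fin_cases a
  · simp only [List.head?_reverse] at hs
    simp [unary, pathEnd, hs]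
  · simp [unary, pathEnd]

theorem satState_pathEnd_append (l l' : List (Fin 2)) (c n h : List Sym)
    (hs : satState (pathEnd (actionsCode l).reverse c n h) c n h ≠ []) :
    satState (pathEnd (actionsCode (l ++ l')).reverse c n h) c n h ≠ [] := by
  induction l' using List.reverseRecOn with
  | nil => simpa using hs
  | append_singleton l' a ih =>
    rw [← List.append_assoc, pathEnd_append_action, if_neg ih]
    exact ih

/-- Rewards are paid in terminal states only, and a trajectory that meets no satisfying assignment
ends in a state without flips left. -/
theorem V_le_of_not_satisfied {g : List Bool → NNReal} {ε : NNReal}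
    (hg : ∀ x : State n H, x.1.length = n + 1 + H → g x.1 ≤ ε) (π : State n H → Fin 2) (x : State n H)
    (h : ∀ t y, trajectory (searchNext φ) π x t = some y → violated y.1 φ ≠ []) :
    (searchMDP φ n H g).V π x ≤ ε := by
  obtain ⟨t, -, hn⟩ := search_ends φ π x
  induction t generalizing x with
  | zero => simp [trajectory] at hn
  | succ t ih =>
    rw [DetMDP.V_eq_Q, DetMDP.Q, meanReward_searchMDP]
    change _ + (searchNext φ x (π x)).elim 0 _ ≤ _
    by_cases ht : Terminal φ x
    · rw [if_pos ht, searchNext_eq_none ht]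
      have h0 := h 0 x rfl
      have := hg x (ht.resolve_left h0)
      simp only [Option.elim_none, add_zero, NNReal.coe_le_coe]
      exact (min_le_left _ _).trans this
    · obtain ⟨-, c, ψ, -, hy⟩ := exists_of_not_terminal ht
      obtain ⟨y, hy, -⟩ := hy (π x)
      rw [if_neg ht, hy, zero_add]
      rw [DetMDP.trajectory_succ_eq, hy] at hn
      refine ih y (fun t z hz => h (t + 1) z ?_) hn
      rw [DetMDP.trajectory_succ_eq, hy]
      exact hz

/-- If the end of the path is not satisfying, no earlier state on it is, since satisfying states are
not left. Then the path follows the trajectory of the policy, whose value is at most `ε`, while the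
optimal value is at least `score n H r H ≥ ε + 1/4`. -/
theorem satState_of_goodActions {w : ℕ → Bool} (hw : ∀ c ∈ φ, clauseHolds w c = true) (hv : v ≤ n)
    (hn : 1 ≤ n) (r : ℕ) (ε : NNReal)
    (hg : ∀ x : State n H, x.1.length = n + 1 + H → successProb w n H r x.1 ≤ ε)
    (hε : (ε : ℝ) + 1 / 4 ≤ score n H r H) {l : List (Fin 2)}
    (hl : (searchMDP φ n H (successProb w n H r)).GoodActions l) :
    satState (pathEnd (actionsCode l).reverse (clausesCode φ) (unary n) (unary H)) (clausesCode φ)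
      (unary n) (unary H) ≠ [] := by
  intro hns
  obtain ⟨π, hπ, hV⟩ := hl
  set x₀ : State n H := (searchMDP φ n H (successProb w n H r)).start with hx₀
  have htake (t : ℕ) : satState (pathEnd (actionsCode (l.take t)).reverse (clausesCode φ) (unary n)
      (unary H)) (clausesCode φ) (unary n) (unary H) = [] := by
    by_contra h
    refine satState_pathEnd_append (l.take t) (l.drop t) _ _ _ h ?_
    rwa [List.take_append_drop]
  have key (t : ℕ) (y : State n H) (hy : trajectory (searchNext φ) π x₀ t = some y) :
      pathEnd (actionsCode (l.take t)).reverse (clausesCode φ) (unary n) (unary H) = bits y.1 := by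
    induction t generalizing y with
    | zero =>
      simp only [trajectory, Option.some.injEq] at hy
      subst hy
      change _ = bits (List.replicate (n + 1) false)
      simp [actionsCode, pathEnd, bits, zeros_eq, length_unary, List.replicate_succ]
    | succ t ih =>
      rw [trajectory, Option.bind_eq_some_iff] at hy
      obtain ⟨z, hz, hy⟩ := hy
      have h1 := hπ t z hz
      have h2 : l.take (t + 1) = l.take t ++ [π z] := by
        rw [List.take_add_one, h1]; rfl
      rw [h2, pathEnd_append_action, if_pos (htake t), ih z hz, nextStr_bits hv, hy]
      rfl
  have hle : (searchMDP φ n H (successProb w n H r)).V π x₀ ≤ ε := by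
    refine V_le_of_not_satisfied hg π x₀ fun t y hy h => ?_
    have h1 := htake t
    rw [key t y hy] at h1
    exact (satState_bits hv φ y).2 h h1
  rw [(searchOracle_linearOpt hw hv hn rfl).2, searchValue_of_head] at hV
  swap
  · rw [hx₀]; simp [searchMDP, List.replicate_succ]
  have h0 : score n H r H ≤ score n H r (lead w n H x₀.1) := by
    refine score_mono (by positivity) ?_
    have h1 : x₀.1.length = n + 1 := by rw [hx₀]; simp [searchMDP]
    have := agree_nonneg w n x₀.1
    rw [lead, h1]; push_cast; linarith
  linarith

end Path

end Oracle

/-- The new value of the flag when the oracle is asked about the state `x`. -/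
def raiseFlag (x φ n h e : List Sym) : List Sym := if satState x φ n h = [] then e else [.bit true]

theorem PolyTime.raiseFlag {m : ℕ} {f f₁ f₂ f₃ f₄ : (Fin m → List Sym) → List Sym} (hf : PolyTime f)
    (h₁ : PolyTime f₁) (h₂ : PolyTime f₂) (h₃ : PolyTime f₃) (h₄ : PolyTime f₄) :
    PolyTime fun x => raiseFlag (f x) (f₁ x) (f₂ x) (f₃ x) (f₄ x) :=
  ite_nil (hf.satState h₁ h₂ h₃) h₄ (const _)

/-! ### Programs for the oracle calls, the parameters and the whole reduction. -/

section Host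

variable {v : ℕ}

/-- The stacks above the flag: the formula and the parameters. -/
def hostParams (N : ℕ) (φ : Formula v) (n H r d : ℕ) : Store := fun i =>
  if i = N + 1 then clausesCode φ else if i = N + 2 then unary n else if i = N + 3 then unary H
  else if i = N + 4 then unary r else if i = N + 5 then unary d else []

def paramSize (φ : Formula v) (n H r d : ℕ) : ℕ := (clausesCode φ).length + n + H + r + d

theorem hostStore_empty {N : ℕ} (φ : Formula v) (n H r d : ℕ) (σ : Store) (e : List Sym) (j : ℕ)
    (hj : N + 6 ≤ j) : hostStore N (hostParams N φ n H r d) σ e j = [] := by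
  simp [hostStore, hostParams, show ¬ j < N by omega, show j ≠ N by omega, show j ≠ N + 1 by omega,
    show j ≠ N + 2 by omega, show j ≠ N + 3 by omega, show j ≠ N + 4 by omega,
    show j ≠ N + 5 by omega]

theorem hostStore_flag (N : ℕ) (π σ : Store) (e e' : List Sym) :
    update (hostStore N π σ e) N e' = hostStore N π σ e' := by
  funext j
  by_cases hj : j = N
  · subst hj; simp [hostStore]
  · simp [hostStore, hj]

theorem hostStore_query {N s : ℕ} (hs : s < N) (φ : Formula v) (n H r d : ℕ) (σ : Store)
    (e : List Sym) :
    (fun i => hostStore N (hostParams N φ n H r d) σ e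
      ((![s, N + 1, N + 2, N + 3, N + 4, N + 5] : Fin 6 → ℕ) i)) =
        queryArgs φ n H r d (σ s) := by
  funext i
  fin_cases i <;> simp [hostStore, hostParams, hs, queryArgs]

theorem hostStore_flagArgs {N s : ℕ} (hs : s < N) (φ : Formula v) (n H r d : ℕ) (σ : Store)
    (e : List Sym) :
    (fun i => hostStore N (hostParams N φ n H r d) σ e
      ((![s, N + 1, N + 2, N + 3, N] : Fin 5 → ℕ) i)) =
        ![σ s, clausesCode φ, unary n, unary H, e] := by
  funext i
  fin_cases i <;> simp [hostStore, hostParams, hs]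

theorem size_queryArgs (φ : Formula v) (n H r d : ℕ) (x : List Sym) :
    size (queryArgs φ n H r d x) = x.length + paramSize φ n H r d := by
  simp [size, queryArgs, Fin.sum_univ_succ, length_unary, paramSize]
  ring

theorem size_flagArgs (φ : Formula v) (n H r d : ℕ) (x e : List Sym) :
    size ![x, clausesCode φ, unary n, unary H, e] ≤ x.length + paramSize φ n H r d + e.length := by
  simp [size, Fin.sum_univ_succ, length_unary, paramSize]
  omega

theorem answerStr_of_not_state (o : RLCall 2) (φ : Formula v) {n H : ℕ} (r d : ℕ) {x : List Sym}
    (h : isState x (unary n) (unary H) = []) : answerStr o (queryArgs φ n H r d x) = [.sep] := by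
  cases o <;> simp [answerStr, queryArgs, h, nextStr]

/-- The programs that replace the oracle calls, and the program that computes the output. -/
theorem exists_host : ∃ P : Polynomial ℕ,
    (∀ (v : ℕ) (φ : Formula v) (n H r d : ℕ) (o : RLCall 2) (x : List Sym),
      (answerStr o (queryArgs φ n H r d x)).length ≤ P.eval (n + 1 + H + paramSize φ n H r d) + 1) ∧
    ∀ N : ℕ, 3 ≤ N → ∃ (c : RLCall 2 → ℕ → ℕ → Cmd Empty) (R : Cmd Empty),
      ∀ (v : ℕ) (φ : Formula v) (n H r d : ℕ),
      (∀ o s t, s < N → t < N → ∀ σ e X, (∀ i < N, (σ i).length ≤ X) → e.length ≤ 1 →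
        ∃ e', e'.length ≤ 1 ∧
          (e' ≠ [] ↔ e ≠ [] ∨ satState (σ s) (clausesCode φ) (unary n) (unary H) ≠ []) ∧
        Runs (c o s t) (hostStore N (hostParams N φ n H r d) σ e)
          (hostStore N (hostParams N φ n H r d)
            (update σ t (answerStr o (queryArgs φ n H r d (σ s)))) e')
          (P.eval (2 * X + paramSize φ n H r d + 2) + 1)) ∧
      ∀ σ e X, (∀ i < N, (σ i).length ≤ X) → e.length ≤ 1 →
        ∃ σ', Runs R (hostStore N (hostParams N φ n H r d) σ e) σ'
          (P.eval (2 * X + paramSize φ n H r d + 2) + 1) ∧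
          (σ' 0 ∈ Yes ↔ e ≠ [] ∨ satState (pathEnd (σ 0).reverse (clausesCode φ) (unary n) (unary H))
            (clausesCode φ) (unary n) (unary H) ≠ []) := by
  obtain ⟨Pf, -, hf⟩ : PolyTime fun y : Fin 5 → List Sym => raiseFlag (y 0) (y 1) (y 2) (y 3) (y 4) :=
    (PolyTime.proj 0).raiseFlag (.proj 1) (.proj 2) (.proj 3) (.proj 4)
  obtain ⟨Pv, -, hv⟩ : PolyTime fun y : Fin 5 → List Sym => verdict (y 0) (y 1) (y 2) (y 3) (y 4) :=
    (PolyTime.proj 0).verdict (.proj 1) (.proj 2) (.proj 3) (.proj 4)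
  choose Pa hal ha using PolyTime.answerStr
  set A : Polynomial ℕ := Pa .featS + (Pa (.next 0) + Pa (.next 1)) +
    (Pa (.reward 0) + Pa (.reward 1)) + (Pa (.featSA 0) + Pa (.featSA 1)) with hA
  have hPA (o : RLCall 2) (k : ℕ) : (Pa o).eval k ≤ A.eval k := by
    rw [hA]
    simp only [Polynomial.eval_add]
    rcases o with a | a | _ | a
    · fin_cases a <;> simp <;> omega
    · fin_cases a <;> simp <;> omega
    · omega
    · fin_cases a <;> simp <;> omega
  refine ⟨Pf + Pv + A, fun v φ n H r d o x => ?_, fun N hN => ?_⟩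
  -- The bound must not depend on the length of the query: only names of states, whose length is
  -- bounded, have answers other than the separator.
  · by_cases hx : isState x (unary n) (unary H) = []
    · rw [answerStr_of_not_state o φ r d hx]; simp
    · obtain ⟨y, rfl, hy⟩ := isState_ne_nil_iff.1 hx
      have h1 := hal o (queryArgs φ n H r d (bits y))
      have h2 := hPA o (n + 1 + H + paramSize φ n H r d)
      have h3 := eval_mono (Pa o) (a := size (queryArgs φ n H r d (bits y)))
        (b := n + 1 + H + paramSize φ n H r d) (by rw [size_queryArgs, length_bits]; omega)
      simp only [Polynomial.eval_add]
      omega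
  have h6 (s : ℕ) (hs : s < N) (i : Fin 6) :
      (![s, N + 1, N + 2, N + 3, N + 4, N + 5] : Fin 6 → ℕ) i < N + 6 := by
    fin_cases i <;> simp; omega
  have h5 (s : ℕ) (hs : s < N) (i : Fin 5) :
      (![s, N + 1, N + 2, N + 3, N] : Fin 5 → ℕ) i < N + 6 := by
    fin_cases i <;> simp; omega
  have hcall (o : RLCall 2) (s t : ℕ) : ∃ p : Cmd Empty, s < N → t < N → ∀ (v : ℕ) (φ : Formula v)
      (n H r d : ℕ) (σ : Store) (e : List Sym) (X : ℕ), (∀ i < N, (σ i).length ≤ X) → e.length ≤ 1 →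
        ∃ e', e'.length ≤ 1 ∧
          (e' ≠ [] ↔ e ≠ [] ∨ satState (σ s) (clausesCode φ) (unary n) (unary H) ≠ []) ∧
        Runs p (hostStore N (hostParams N φ n H r d) σ e)
          (hostStore N (hostParams N φ n H r d)
            (update σ t (answerStr o (queryArgs φ n H r d (σ s)))) e')
          ((Pf + Pv + A).eval (2 * X + paramSize φ n H r d + 2) + 1) := by
    by_cases hst : s < N ∧ t < N
    swap
    · exact ⟨.pop 0, fun hs ht => absurd ⟨hs, ht⟩ hst⟩
    obtain ⟨hs, ht⟩ := hst
    obtain ⟨p₁, hp₁⟩ := hf ![s, N + 1, N + 2, N + 3, N] N (N + 6) (h5 s hs) (by omega)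
    obtain ⟨p₂, hp₂⟩ := ha o ![s, N + 1, N + 2, N + 3, N + 4, N + 5] t (N + 6) (h6 s hs) (by omega)
    -- The flag is updated first, because the answer may overwrite the query when `s = t`.
    refine ⟨.seq p₁ p₂, fun _ _ v φ n H r d σ e X hX he => ?_⟩
    have e₁ := hp₁ _ (hostStore_empty φ n H r d σ e)
    rw [hostStore_flagArgs hs, hostStore_flag] at e₁
    set e' := raiseFlag (σ s) (clausesCode φ) (unary n) (unary H) e with he'
    have e₂ := hp₂ _ (hostStore_empty φ n H r d σ e')
    rw [hostStore_query hs, hostStore_update ht, hostStore_apply ht, size_queryArgs] at e₂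
    refine ⟨e', ?_, ?_, (e₁.seq e₂).mono ?_⟩
    · rw [he', raiseFlag]
      split_ifs
      · exact he
      · simp
    · rw [he', raiseFlag]
      split_ifs with h <;> simp [h]
    · have hflag : hostStore N (hostParams N φ n H r d) σ e N = e := by simp [hostStore]
      rw [hflag]
      have h1 := size_flagArgs φ n H r d (σ s) e
      have h2 := hX s hs
      have h3 := hX t ht
      have h4 := eval_mono Pf (a := size ![σ s, clausesCode φ, unary n, unary H, e] + e.length)
        (b := 2 * X + paramSize φ n H r d + 2) (by omega)
      have h5 := eval_mono (Pa o) (a := (σ s).length + paramSize φ n H r d + (σ t).length)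
        (b := 2 * X + paramSize φ n H r d + 2) (by omega)
      have h6 := hPA o (2 * X + paramSize φ n H r d + 2)
      simp only [Polynomial.eval_add]
      omega
  choose c hc using hcall
  obtain ⟨R, hR⟩ := hv ![0, N + 1, N + 2, N + 3, N] 0 (N + 6) (h5 0 (by omega)) (by omega)
  refine ⟨c, R, fun v φ n H r d => ⟨fun o s t hs ht σ e X hX he =>
    hc o s t hs ht v φ n H r d σ e X hX he, fun σ e X hX he => ?_⟩⟩
  have h0 : 0 < N := by omega
  have e₁ := hR _ (hostStore_empty φ n H r d σ e)
  rw [hostStore_flagArgs h0, hostStore_apply h0] at e₁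
  refine ⟨_, e₁.mono ?_, ?_⟩
  · have h1 := size_flagArgs φ n H r d (σ 0) e
    have h2 := hX 0 h0
    have h4 := eval_mono Pv (a := size ![σ 0, clausesCode φ, unary n, unary H, e] + (σ 0).length)
      (b := 2 * X + paramSize φ n H r d + 2) (by omega)
    simp only [Polynomial.eval_add]
    omega
  · rw [update_self]
    change (verdict (σ 0) (clausesCode φ) (unary n) (unary H) e).head? = some (.bit true) ↔ _
    rw [verdict]
    by_cases he0 : e = []
    · rw [if_pos he0, satState]
      split_ifs <;> simp [he0]
    · simp [he0]

end Host

/-- Execute `p` exactly `k` times. -/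
def iter : ℕ → Cmd Empty → Cmd Empty
  | 0, _ => .while 0 (fun _ => false) (.pop 0)
  | k + 1, p => .seq p (iter k p)

theorem iter_runs {p : Cmd Empty} {T : ℕ} (k : ℕ) (σ : ℕ → Store)
    (h : ∀ j < k, Runs p (σ j) (σ (j + 1)) T) :
    Runs (iter k p) (σ 0) (σ k) (k * (T + 1) + 1) := by
  induction k generalizing σ with
  | zero => exact (Runs.while_false rfl).mono (by simp)
  | succ k ih =>
    refine ((h 0 (by omega)).seq (ih (fun j => σ (j + 1)) fun j hj => h (j + 1) (by omega))).mono ?_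
    rw [Nat.succ_mul]; omega

/-- The three input stacks, and the five parameter stacks above stack `N`. -/
def stackIdx (N : ℕ) : Fin 8 → ℕ := ![0, 1, 2, N + 1, N + 2, N + 3, N + 4, N + 5]

def place (N : ℕ) (y : Fin 8 → List Sym) : Store := fun j =>
  if j = 0 then y 0 else if j = 1 then y 1 else if j = 2 then y 2 else if j = N + 1 then y 3
  else if j = N + 2 then y 4 else if j = N + 3 then y 5 else if j = N + 4 then y 6
  else if j = N + 5 then y 7 else []

theorem place_stackIdx {N : ℕ} (hN : 3 ≤ N) (y : Fin 8 → List Sym) (k : Fin 8) :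
    place N y (stackIdx N k) = y k := by
  fin_cases k <;> simp [place, stackIdx, show N + 1 ≠ 2 by omega]
    <;> intros <;> omega

theorem update_place {N : ℕ} (hN : 3 ≤ N) (y : Fin 8 → List Sym) (k : Fin 8) (a : List Sym) :
    update (place N y) (stackIdx N k) a = place N (update y k a) := by
  funext j
  have h1 : ∀ j, (∀ k, j ≠ stackIdx N k) → ∀ y, place N y j = [] := by
    intro j hj y
    simp [place, show j ≠ 0 from hj 0, show j ≠ 1 from hj 1, show j ≠ 2 from hj 2,
      show j ≠ N + 1 from hj 3, show j ≠ N + 2 from hj 4, show j ≠ N + 3 from hj 5,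
      show j ≠ N + 4 from hj 6, show j ≠ N + 5 from hj 7]
  have hinj : ∀ i k, stackIdx N i = stackIdx N k → i = k := by
    intro i k h
    fin_cases i <;> fin_cases k <;> simp [stackIdx] at h ⊢ <;> omega
  by_cases hj : ∃ i, j = stackIdx N i
  · obtain ⟨i, rfl⟩ := hj
    rw [place_stackIdx hN]
    by_cases hik : i = k
    · subst hik; simp
    · rw [update_of_ne hik, update_of_ne fun h => hik (hinj _ _ h), place_stackIdx hN]
  · push Not at hj
    rw [h1 j hj, update_of_ne (hj k), h1 j hj]

/-- The polynomial is fixed before `N`, hence before the simulated program. The factor 9 in its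
argument counts eight stacks and the old content of the target. -/
theorem PolyTime.exists_assign {F : (Fin 8 → List Sym) → List Sym} (hF : PolyTime F) (k : Fin 8) :
    ∃ P : Polynomial ℕ, ∀ N, 3 ≤ N → ∃ p : Cmd Empty, ∀ (y : Fin 8 → List Sym) (S : ℕ),
      (∀ i, (y i).length ≤ S) →
        Runs p (place N y) (place N (update y k (F y))) (P.eval S) := by
  obtain ⟨P, -, hP⟩ := hF
  refine ⟨P.comp (9 * Polynomial.X), fun N hN => ?_⟩
  have hlt (i : Fin 8) : stackIdx N i < N + 6 := by fin_cases i <;> simp [stackIdx]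
  obtain ⟨p, hp⟩ := hP (stackIdx N) (stackIdx N k) (N + 6) hlt (hlt k)
  refine ⟨p, fun y S hS => ?_⟩
  have h0 (j : ℕ) (hj : N + 6 ≤ j) : place N y j = [] := by
    simp [place, show j ≠ 0 by omega, show j ≠ 1 by omega, show j ≠ 2 by omega,
      show j ≠ N + 1 by omega, show j ≠ N + 2 by omega, show j ≠ N + 3 by omega,
      show j ≠ N + 4 by omega, show j ≠ N + 5 by omega]
  have e := hp _ h0
  simp only [place_stackIdx hN, update_place hN] at e
  refine e.mono ?_
  rw [Polynomial.eval_comp, Polynomial.eval_mul, Polynomial.eval_X, Polynomial.eval_ofNat]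
  refine eval_mono P ?_
  have h1 : size y ≤ 8 * S := by
    refine (Finset.sum_le_sum fun i _ => hS i).trans ?_
    simp
  have := hS k
  change size y + _ ≤ _
  omega

theorem unary_append (a b : ℕ) : unary a ++ unary b = unary (a + b) := by
  rw [unary, unary, unary, List.replicate_append_replicate]

theorem cons_unary (a : ℕ) : .bit true :: unary a = unary (a + 1) := rfl

theorem kron_unary (a b : ℕ) : kron (unary a) (unary b) = unary (a * b) := by
  induction a with
  | zero => simp [kron, unary]
  | succ a ih =>
    rw [← cons_unary, kron, if_pos rfl, ih, unary_append]
    congr 1; ring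

/-- The program that computes the parameters and the input of the simulated algorithm. -/
theorem exists_setup : ∃ P : Polynomial ℕ, ∀ N c r : ℕ, 3 ≤ N → ∃ p : Cmd Empty,
    ∀ (v : ℕ) (φ : Formula v) (H d S : ℕ), 1 ≤ v + c → H + 2 = (2 * (v + c)) ^ (r + 2) →
      d = 3 * ((H + 2) * (2 * (v + c)) ^ (r + 2)) → (formulaCode φ).length ≤ S → d ≤ S → r ≤ S →
      ∀ g, Runs p (satInput φ)
        (hostStore N (hostParams N φ (v + c) H r d) (searchOracle φ (v + c) H r d g).input [])
        ((c + r + 20) * (P.eval S + 2)) := by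
  obtain ⟨P₁, h₁⟩ := (PolyTime.proj (m := 8) 0).after.exists_assign 3
  obtain ⟨P₂, h₂⟩ := (PolyTime.proj (m := 8) 0).before.exists_assign 4
  obtain ⟨P₃, h₃⟩ := ((PolyTime.proj (m := 8) 4).cons (.bit true)).exists_assign 4
  obtain ⟨P₄, h₄⟩ := ((PolyTime.proj (m := 8) 4).append (.proj 4)).exists_assign 0
  obtain ⟨P₅, h₅⟩ := (PolyTime.const (m := 8) [.bit true]).exists_assign 5
  obtain ⟨P₆, h₆⟩ := ((PolyTime.proj (m := 8) 0).kron (.proj 5)).exists_assign 5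
  obtain ⟨P₇, h₇⟩ := (((PolyTime.proj (m := 8) 5).kron (.proj 5)).append
    (((PolyTime.proj 5).kron (.proj 5)).append ((PolyTime.proj 5).kron (.proj 5)))).exists_assign 7
  obtain ⟨P₈, h₈⟩ := (PolyTime.proj (m := 8) 5).tail.tail.exists_assign 5
  obtain ⟨P₉, h₉⟩ := ((PolyTime.proj (m := 8) 6).cons (.bit true)).exists_assign 6
  obtain ⟨P₁₀, h₁₀⟩ := (PolyTime.proj (m := 8) 7).exists_assign 0
  obtain ⟨P₁₁, h₁₁⟩ := ((((PolyTime.proj (m := 8) 5).append (.proj 5)).cons (.bit true)).cons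
    (.bit true)).exists_assign 1
  obtain ⟨P₁₂, h₁₂⟩ := ((PolyTime.proj (m := 8) 4).zeros.cons (.bit false)).exists_assign 2
  refine ⟨P₁ + P₂ + P₃ + P₄ + P₅ + P₆ + P₇ + P₈ + P₉ + P₁₀ + P₁₁ + P₁₂, fun N c r hN => ?_⟩
  obtain ⟨p₁, h₁⟩ := h₁ N hN
  obtain ⟨p₂, h₂⟩ := h₂ N hN
  obtain ⟨p₃, h₃⟩ := h₃ N hN
  obtain ⟨p₄, h₄⟩ := h₄ N hN
  obtain ⟨p₅, h₅⟩ := h₅ N hN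
  obtain ⟨p₆, h₆⟩ := h₆ N hN
  obtain ⟨p₇, h₇⟩ := h₇ N hN
  obtain ⟨p₈, h₈⟩ := h₈ N hN
  obtain ⟨p₉, h₉⟩ := h₉ N hN
  obtain ⟨p₁₀, h₁₀⟩ := h₁₀ N hN
  obtain ⟨p₁₁, h₁₁⟩ := h₁₁ N hN
  obtain ⟨p₁₂, h₁₂⟩ := h₁₂ N hN
  -- The constants `c` and `r` are hard-wired as numbers of repetitions: `c` increments turn `v`
  -- into `n`, and `r + 2` multiplications by `2n` give `H + 2` on stack `N + 3`. Three times its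
  -- square is `d`, and removing two symbols leaves `H`.
  refine ⟨.seq p₁ (.seq p₂ (.seq (iter c p₃) (.seq p₄ (.seq p₅ (.seq (iter (r + 2) p₆) (.seq p₇
    (.seq p₈ (.seq (iter r p₉) (.seq p₁₀ (.seq p₁₁ p₁₂)))))))))),
    fun v φ H d S hn hH hd hφ hdS hrS g => ?_⟩
  set n := v + c with hn'
  set B := 2 * n with hB
  set ψ := formulaCode φ with hψ
  set κ := clausesCode φ with hκ
  have hψ' : ψ = unary v ++ .sep :: κ := rfl
  have hB1 : 1 ≤ B := by omega
  have hBH : B ≤ H + 2 := hH ▸ Nat.le_self_pow (by omega) B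
  have hHd : (H + 2) * 3 ≤ d := by
    rw [hd, ← hH]
    nlinarith
  have hκS : κ.length ≤ S := by
    refine le_trans ?_ hφ
    rw [hψ']; simp; omega
  have hlu := length_unary
  have i₀ : satInput φ = place N ![ψ, [], [], [], [], [], [], []] := by
    funext j
    rcases j with _ | j
    · rfl
    · have : satInput φ (j + 1) = [] := rfl
      rw [this]; simp [place]
  have b1 : ∀ i, ((![ψ, [], [], [], [], [], [], []] : Fin 8 → List Sym) i).length ≤ S := by
    intro i; fin_cases i <;> simp [hφ]
  have e₁ := h₁ _ S b1
  have u₁ : update ![ψ, [], [], [], [], [], [], []] 3 (after ψ) =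
      (![ψ, [], [], κ, [], [], [], []] : Fin 8 → List Sym) := by
    rw [hψ', after_append _ _ (sep_notMem_unary v)]
    funext i; fin_cases i <;> rfl
  replace e₁ : Runs p₁ _ (place N (update _ 3 (after ψ))) _ := e₁
  rw [u₁] at e₁
  have e₂ := h₂ ![ψ, [], [], κ, [], [], [], []] S
    (by intro i; fin_cases i <;> simp [hφ, hκS])
  replace e₂ : Runs p₂ _ (place N (update _ 4 (before ψ))) _ := e₂
  have u₂ : update ![ψ, [], [], κ, [], [], [], []] 4 (before ψ) =
      (![ψ, [], [], κ, unary v, [], [], []] : Fin 8 → List Sym) := by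
    rw [hψ', before_append _ _ (sep_notMem_unary v)]
    funext i; fin_cases i <;> rfl
  rw [u₂] at e₂
  have e₃ := iter_runs (p := p₃) c (fun j => place N ![ψ, [], [], κ, unary (v + j), [], [], []])
    (T := P₃.eval S) (fun j hj => by
      have := h₃ ![ψ, [], [], κ, unary (v + j), [], [], []] S
        (by intro i; fin_cases i <;> simp [hφ, hκS, hlu]; omega)
      convert this using 2
      funext i; fin_cases i <;> rfl)
  have e₄ := h₄ ![ψ, [], [], κ, unary n, [], [], []] S
    (by intro i; fin_cases i <;> simp [hφ, hκS, hlu]; omega)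
  replace e₄ : Runs p₄ _ (place N (update _ 0 (unary n ++ unary n))) _ := e₄
  have u₄ : update ![ψ, [], [], κ, unary n, [], [], []] 0 (unary n ++ unary n) =
      (![unary B, [], [], κ, unary n, [], [], []] : Fin 8 → List Sym) := by
    rw [unary_append, ← two_mul]
    funext i; fin_cases i <;> rfl
  rw [u₄] at e₄
  have e₅ := h₅ ![unary B, [], [], κ, unary n, [], [], []] S
    (by intro i; fin_cases i <;> simp [hκS, hlu] <;> omega)
  replace e₅ : Runs p₅ _ (place N (update _ 5 [.bit true])) _ := e₅
  have u₅ : update ![unary B, [], [], κ, unary n, [], [], []] 5 [.bit true] =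
      (![unary B, [], [], κ, unary n, unary (B ^ 0), [], []] : Fin 8 → List Sym) := by
    funext i; fin_cases i <;> rfl
  rw [u₅] at e₅
  have e₆ := iter_runs (p := p₆) (r + 2)
    (fun j => place N ![unary B, [], [], κ, unary n, unary (B ^ j), [], []])
    (T := P₆.eval S) (fun j hj => by
      have hj' : B ^ j ≤ H + 2 := hH ▸ Nat.pow_le_pow_right hB1 hj.le
      have := h₆ ![unary B, [], [], κ, unary n, unary (B ^ j), [], []] S
        (by intro i; fin_cases i <;> simp [hκS, hlu] <;> omega)
      replace this : Runs p₆ _ (place N (update _ 5 (kron (unary B) (unary (B ^ j))))) _ := this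
      rw [kron_unary, ← pow_succ'] at this
      convert this using 2
      funext i; fin_cases i <;> rfl)
  rw [← hH] at e₆
  have e₇ := h₇ ![unary B, [], [], κ, unary n, unary (H + 2), [], []] S
    (by intro i; fin_cases i <;> simp [hκS, hlu] <;> omega)
  replace e₇ : Runs p₇ _ (place N (update _ 7 (kron (unary (H + 2)) (unary (H + 2)) ++
    (kron (unary (H + 2)) (unary (H + 2)) ++ kron (unary (H + 2)) (unary (H + 2)))))) _ := e₇
  have u₇ : update ![unary B, [], [], κ, unary n, unary (H + 2), [], []] 7
      (kron (unary (H + 2)) (unary (H + 2)) ++ (kron (unary (H + 2)) (unary (H + 2)) ++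
        kron (unary (H + 2)) (unary (H + 2)))) =
      (![unary B, [], [], κ, unary n, unary (H + 2), [], unary d] : Fin 8 → List Sym) := by
    have : (H + 2) * (H + 2) + ((H + 2) * (H + 2) + (H + 2) * (H + 2)) = d := by
      rw [hd, ← hH]; ring
    rw [kron_unary, unary_append, unary_append, this]
    funext i; fin_cases i <;> rfl
  rw [u₇] at e₇
  have e₈ := h₈ ![unary B, [], [], κ, unary n, unary (H + 2), [], unary d] S
    (by intro i; fin_cases i <;> simp [hκS, hlu] <;> omega)
  have u₈ : update ![unary B, [], [], κ, unary n, unary (H + 2), [], unary d] 5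
      (unary (H + 2)).tail.tail =
      (![unary B, [], [], κ, unary n, unary H, unary 0, unary d] : Fin 8 → List Sym) := by
    funext i; fin_cases i <;> rfl
  replace e₈ : Runs p₈ _ (place N (update _ 5 (unary (H + 2)).tail.tail)) _ := e₈
  rw [u₈] at e₈
  have e₉ := iter_runs (p := p₉) r
    (fun j => place N ![unary B, [], [], κ, unary n, unary H, unary j, unary d])
    (T := P₉.eval S) (fun j hj => by
      have := h₉ ![unary B, [], [], κ, unary n, unary H, unary j, unary d] S
        (by intro i; fin_cases i <;> simp [hκS, hlu] <;> omega)
      convert this using 2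
      funext i; fin_cases i <;> rfl)
  have e₁₀ := h₁₀ ![unary B, [], [], κ, unary n, unary H, unary r, unary d] S
    (by intro i; fin_cases i <;> simp [hκS, hlu] <;> omega)
  have u₁₀ : update ![unary B, [], [], κ, unary n, unary H, unary r, unary d] 0 (unary d) =
      (![unary d, [], [], κ, unary n, unary H, unary r, unary d] : Fin 8 → List Sym) := by
    funext i; fin_cases i <;> rfl
  replace e₁₀ : Runs p₁₀ _ (place N (update _ 0 (unary d))) _ := e₁₀
  rw [u₁₀] at e₁₀
  have e₁₁ := h₁₁ ![unary d, [], [], κ, unary n, unary H, unary r, unary d] S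
    (by intro i; fin_cases i <;> simp [hκS, hlu] <;> omega)
  have u₁₁ : update ![unary d, [], [], κ, unary n, unary H, unary r, unary d] 1
      (.bit true :: .bit true :: (unary H ++ unary H)) =
      (![unary d, unary (2 * H + 2), [], κ, unary n, unary H, unary r, unary d] :
        Fin 8 → List Sym) := by
    rw [unary_append, cons_unary, cons_unary, ← two_mul]
    funext i; fin_cases i <;> rfl
  replace e₁₁ : Runs p₁₁ _ (place N (update _ 1 (.bit true :: .bit true :: (unary H ++ unary H)))) _ :=
    e₁₁
  rw [u₁₁] at e₁₁
  have e₁₂ := h₁₂ ![unary d, unary (2 * H + 2), [], κ, unary n, unary H, unary r, unary d] S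
    (by intro i; fin_cases i <;> simp [hκS, hlu] <;> omega)
  have u₁₂ : update ![unary d, unary (2 * H + 2), [], κ, unary n, unary H, unary r, unary d] 2
      (.bit false :: zeros (unary n)) =
      (![unary d, unary (2 * H + 2), bits (List.replicate (n + 1) false), κ, unary n, unary H,
        unary r, unary d] : Fin 8 → List Sym) := by
    rw [zeros_eq, length_unary]
    have : bits (List.replicate (n + 1) false) = .bit false :: List.replicate n (.bit false) := by
      simp [bits, List.replicate_succ]
    rw [this]
    funext i; fin_cases i <;> rfl
  replace e₁₂ : Runs p₁₂ _ (place N (update _ 2 (.bit false :: zeros (unary n)))) _ := e₁₂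
  rw [u₁₂] at e₁₂
  have hfin : place N ![unary d, unary (2 * H + 2), bits (List.replicate (n + 1) false), κ, unary n,
      unary H, unary r, unary d] =
      hostStore N (hostParams N φ n H r d) (searchOracle φ n H r d g).input [] := by
    funext j
    by_cases h3 : j < 3
    · interval_cases j
      · simp [hostStore, place, show 0 < N by omega, RLOracle.input]
      · simp [hostStore, place, show 1 < N by omega, RLOracle.input]; rfl
      · simp [hostStore, place, show 2 < N by omega, RLOracle.input]; rfl
    · have hI : (searchOracle φ n H r d g).input j = [] := by
        obtain ⟨j, rfl⟩ : ∃ k, j = k + 3 := ⟨j - 3, by omega⟩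
        rfl
      simp only [hostStore, hostParams, place, hI, show j ≠ 0 by omega, show j ≠ 1 by omega,
        show j ≠ 2 by omega, if_false]
      split_ifs <;> first | rfl | omega
  rw [i₀, ← hfin]
  refine (e₁.seq (e₂.seq (e₃.seq (e₄.seq (e₅.seq (e₆.seq (e₇.seq (e₈.seq (e₉.seq (e₁₀.seq
    (e₁₁.seq e₁₂))))))))))).mono ?_
  simp only [Polynomial.eval_add]
  have k₃ : c * (P₃.eval S + 1) ≤ c * (P₁.eval S + P₂.eval S + P₃.eval S + P₄.eval S + P₅.eval S +
    P₆.eval S + P₇.eval S + P₈.eval S + P₉.eval S + P₁₀.eval S + P₁₁.eval S + P₁₂.eval S + 2) :=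
      Nat.mul_le_mul_left _ (by omega)
  have k₉ : r * (P₆.eval S + 1) + r * (P₉.eval S + 1) ≤ r * (P₁.eval S + P₂.eval S + P₃.eval S +
      P₄.eval S + P₅.eval S +
    P₆.eval S + P₇.eval S + P₈.eval S + P₉.eval S + P₁₀.eval S + P₁₁.eval S + P₁₂.eval S + 2) := by
      rw [← mul_add]
      exact Nat.mul_le_mul_left _ (by omega)
  rw [add_mul (r : ℕ) 2]
  rw [add_mul (c + r) 20, add_mul c r]
  omega

/-- Setup, compiled program and verdict in sequence. The polynomial is chosen before `p`, `c` and
`r`; they contribute to the time only through its argument. -/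
theorem exists_reduction : ∃ P : Polynomial ℕ, ∀ (p : Cmd (RLCall 2)) (c r : ℕ),
    ∃ p' : Cmd Empty, ∀ (v : ℕ) (φ : Formula v) (n H d T : ℕ), n = v + c → 1 ≤ n →
      H + 2 = (2 * n) ^ (r + 2) → d = 3 * ((H + 2) * (2 * n) ^ (r + 2)) →
      ∀ (g : List Bool → NNReal) (ε : NNReal), (∀ x : State n H, g x.1 < 1) →
      (∀ x : State n H, x.1.length = n + 1 + H → g x.1 ≤ ε) →
      HaltsWithin (searchOracle φ n H r d g).answer p (searchOracle φ n H r d g).input T →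
      ∃ ρ, Accepts (∃ w, Satisfies w φ) ([p'], satInput φ)
          (P.eval ((formulaCode φ).length + d + T + r + c)) ρ ∧
        prob (output (searchOracle φ n H r d g).answer p (searchOracle φ n H r d g).input T)
          {y | satState (pathEnd y.reverse (clausesCode φ) (unary n) (unary H)) (clausesCode φ)
            (unary n) (unary H) ≠ []} ≤ ρ + T * ε := by
  obtain ⟨P, hPA, hP⟩ := exists_host
  obtain ⟨Ps, hs⟩ := exists_setup
  refine ⟨(Polynomial.X + 20) * (Ps + 2) + 2 + (Polynomial.X + 1) *
    (P.comp (2 * P.comp (3 * Polynomial.X) + 8 * Polynomial.X + 4) + 3), fun p c r => ?_⟩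
  obtain ⟨N, hN, hpN⟩ := Cmd.exists_below p
  obtain ⟨h, R, hh⟩ := hP N hN
  obtain ⟨s, hs⟩ := hs N c r hN
  refine ⟨.seq s (.seq (compile h p) R), ?_⟩
  rintro v φ n H d T rfl hn hH hd g ε hg1 hg hT
  set n := v + c with hn'
  set f := (formulaCode φ).length with hf
  set U := f + d + T + r + c with hU
  set I := searchOracle φ n H r d g with hI
  have hB1 : 1 ≤ 2 * n := by omega
  have hBH : 2 * n ≤ H + 2 := hH ▸ Nat.le_self_pow (by omega) (2 * n)
  have hHd : (H + 2) * 3 ≤ d := by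
    rw [hd, ← hH]
    nlinarith
  have hκ : (clausesCode φ).length ≤ f := by
    have : formulaCode φ = unary v ++ .sep :: clausesCode φ := rfl
    rw [hf, this]; simp; omega
  obtain ⟨hc, hR⟩ := hh v φ n H r d
  have hps : paramSize φ n H r d ≤ 2 * U := by
    rw [paramSize]; omega
  have hps' : n + 1 + H + paramSize φ n H r d ≤ 3 * U := by
    rw [paramSize]; omega
  have hin (i : ℕ) : (I.input i).length ≤ U := by
    have hlu := length_unary
    rcases i with _ | _ | _ | i
    · change (unary d).length ≤ U
      rw [hlu]; omega
    · change (unary (2 * H + 2)).length ≤ U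
      rw [hlu]; omega
    · change (bits (List.replicate (n + 1) false)).length ≤ U
      rw [length_bits, List.length_replicate]; omega
    · exact Nat.zero_le _
  obtain ⟨ρ, h1, -, h3⟩ := simulate I.answer (fun o x => answerStr o (queryArgs φ n H r d x))
    (fun x => satState x (clausesCode φ) (unary n) (unary H) ≠ [])
    {y | satState (pathEnd y.reverse (clausesCode φ) (unary n) (unary H)) (clausesCode φ)
            (unary n) (unary H) ≠ []} ε (∃ w, Satisfies w φ) N
    (P.eval (n + 1 + H + paramSize φ n H r d) + 1) (hostParams N φ n H r d)
    (fun X => P.eval (2 * X + paramSize φ n H r d + 2) + 1)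
    (fun a b hab => Nat.succ_le_succ (eval_mono P (by omega))) h R hc hR
    (hPA v φ n H r d) (answer_searchOracle φ r d g (by omega) hn hd ε hg1 hg)
    (fun x hx => exists_satisfies_of_satState (by omega) hx)
    (fun y hy => exists_satisfies_of_satState (by omega) hy)
    T [p] I.input [] (P.eval (3 * U) + 1 + U) (by simpa using hpN)
    (fun i _ => (hin i).trans (by omega))
    (by have := eval_mono P hps'; omega) (by simp) (by simp) hT
  refine ⟨ρ, ?_, h3⟩
  have hsetup := hs v φ H d U hn hH hd (by omega) (by omega) (by omega) g
  have h2 : Accepts (∃ w, Satisfies w φ) ([.seq (compile h p) R],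
      hostStore N (hostParams N φ n H r d) I.input []) _ ρ := Accepts.of_step (by simp [step]) h1
  have h4 : Accepts (∃ w, Satisfies w φ) ([s, .seq (compile h p) R], satInput φ) _ ρ :=
    Accepts.of_runs hsetup h2
  refine (Accepts.of_step (c := ([.seq s (.seq (compile h p) R)], satInput φ))
    (by simp [step]) h4).mono ?_
  simp only [Polynomial.eval_add, Polynomial.eval_mul, Polynomial.eval_comp, Polynomial.eval_X,
    Polynomial.eval_ofNat, Polynomial.eval_one]
  have k1 := eval_mono P (a := 2 * (P.eval (3 * U) + 1 + U + T) + paramSize φ n H r d + 2)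
    (b := 2 * P.eval (3 * U) + 8 * U + 4) (by omega)
  set W := P.eval (2 * P.eval (3 * U) + 8 * U + 4)
  set W' := P.eval (2 * (P.eval (3 * U) + 1 + U + T) + paramSize φ n H r d + 2)
  have k2 : T * (W' + 1 + 2) ≤ U * (W + 3) := Nat.mul_le_mul (by omega) (by omega)
  have k3 : (c + r + 20) * (Ps.eval U + 2) ≤ (U + 20) * (Ps.eval U + 2) :=
    Nat.mul_le_mul_right _ (by omega)
  rw [add_mul U 1]
  omega

theorem exists_eval_le (P : Polynomial ℕ) : ∃ a e : ℕ, ∀ k, P.eval k ≤ a * (k + 1) ^ e := by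
  induction P using Polynomial.induction_on' with
  | add p q hp hq =>
    obtain ⟨a, e, hp⟩ := hp
    obtain ⟨a', e', hq⟩ := hq
    refine ⟨a + a', e + e', fun k => ?_⟩
    rw [Polynomial.eval_add, add_mul]
    refine add_le_add ((hp k).trans ?_) ((hq k).trans ?_) <;>
    · refine Nat.mul_le_mul_left _ (Nat.pow_le_pow_right (by omega) (by omega))
  | monomial n c =>
    refine ⟨c, n, fun k => ?_⟩
    rw [Polynomial.eval_monomial]
    exact Nat.mul_le_mul_left _ (Nat.pow_le_pow_left (by omega) _)

/-! ### Numerical estimates for the choice of the parameters. -/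

section Estimates

variable {n H r : ℕ}

theorem score_small (hn : 1 ≤ n) (hH : H + 2 = (2 * n) ^ (r + 2)) :
    score n H r n ≤ 1 / (2 * n : ℝ) ^ (r ^ 2 + r) := by
  have hn' : (1 : ℝ) ≤ n := by exact_mod_cast hn
  have hH' : (H : ℝ) + 2 = (2 * n) ^ (r + 2) := by exact_mod_cast hH
  have hB : (0 : ℝ) < 2 * n := by linarith
  have key : (n : ℝ) / (H + n + 1) ≤ 1 / (2 * n) ^ (r + 1) := by
    rw [div_le_div_iff₀ (by positivity) (by positivity), one_mul]
    have : (2 * n : ℝ) ^ (r + 2) = 2 * n * (2 * n) ^ (r + 1) := by ring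
    have h1 : (0 : ℝ) < (2 * n) ^ (r + 1) := by positivity
    nlinarith
  calc score n H r n ≤ (1 / (2 * n) ^ (r + 1)) ^ r := by
        rw [score]; gcongr
    _ = 1 / (2 * n : ℝ) ^ (r ^ 2 + r) := by
        rw [div_pow, one_pow, ← pow_mul]; congr 2; ring

/-- Bernoulli's inequality for `(1 - (n+1)/(H+n+1))^r`: by `2r ≤ (2n)^(r+1)` and `n + 1 ≤ 2n`, the
denominator is at least `2r(n+1)`. -/
theorem half_le_score (hn : 1 ≤ n) (hH : H + 2 = (2 * n) ^ (r + 2)) : 1 / 2 ≤ score n H r H := by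
  have hn' : (1 : ℝ) ≤ n := by exact_mod_cast hn
  have hH' : (H : ℝ) + 2 = (2 * n) ^ (r + 2) := by exact_mod_cast hH
  have hpos : (0 : ℝ) < H + n + 1 := by positivity
  have h1 : (2 * r : ℝ) ≤ (2 * n) ^ (r + 1) := by
    have : r < 2 ^ r := Nat.lt_two_pow_self
    have : 2 * r ≤ (2 * n) ^ (r + 1) := by
      calc 2 * r ≤ 2 ^ (r + 1) := by rw [pow_succ]; omega
        _ ≤ _ := Nat.pow_le_pow_left (by omega) _
    exact_mod_cast this
  have h2 : (2 * r : ℝ) * (n + 1) ≤ H + n + 1 := by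
    have : (2 * n : ℝ) ^ (r + 2) = (2 * n) ^ (r + 1) * (2 * n) := by ring
    have h3 : (2 * r : ℝ) * (n + 1) ≤ (2 * n) ^ (r + 1) * (2 * n) :=
      mul_le_mul h1 (by linarith) (by positivity) (by positivity)
    linarith
  have h4 : (H : ℝ) / (H + n + 1) = 1 + -((n + 1) / (H + n + 1)) := by
    field_simp; ring
  have h5 : ((n : ℝ) + 1) / (H + n + 1) ≤ 1 := by
    rw [div_le_one hpos]
    have : (0 : ℝ) ≤ H := by positivity
    linarith
  have h6 := one_add_mul_le_pow (a := -(((n : ℝ) + 1) / (H + n + 1))) (by linarith) r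
  rw [score, h4]
  refine le_trans ?_ h6
  have h7 : (r : ℝ) * ((n + 1) / (H + n + 1)) ≤ 1 / 2 := by
    rw [← mul_div_assoc, div_le_iff₀ hpos]
    linarith
  linarith

theorem score_lt_one {k : ℝ} (hr : r ≠ 0) (h0 : 0 ≤ k) (hk : k ≤ H + n) : score n H r k < 1 := by
  rw [score]
  refine pow_lt_one₀ (by positivity) ?_ hr
  rw [div_lt_one (by positivity)]
  linarith

theorem length_clauseCode_le {v : ℕ} (c : Clause v) : (clauseCode c).length ≤ 3 * (v + 2) := by
  have h (j : Fin 3) := (c j).1.2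
  have h0 := h 0
  have h1 := h 1
  have h2 := h 2
  simp [clauseCode, List.ofFn_succ, length_unary]
  omega

theorem length_formulaCode_le {v : ℕ} (φ : Formula v) :
    (formulaCode φ).length ≤ v + 1 + φ.length * (3 * (v + 2)) := by
  have h : (φ.flatMap clauseCode).length ≤ φ.length * (3 * (v + 2)) := by
    induction φ with
    | nil => simp
    | cons c φ ih =>
      have := length_clauseCode_le c
      rw [List.flatMap_cons, List.length_append, List.length_cons, Nat.succ_mul]
      omega
  simp only [formulaCode, List.length_append, length_unary, List.length_cons]
  omega

end Estimates

/-- From `r ≥ 2q + 2` follows `(2r+4)q ≤ (r+2)(r-2) ≤ r²`, so the time is at most `K * 3^q *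
(2n)^(r²)`. The score is smaller than the inverse of this power by at least one more factor `2n`,
which absorbs `K * 3^q`. -/
theorem mul_score_le {n H r d T : ℕ} {K q : ℝ} (hK : 0 ≤ K) (hq : 1 ≤ q) (hr : 2 * q + 2 ≤ r)
    (hn : 1 ≤ n) (hH : H + 2 = (2 * n) ^ (r + 2)) (hd : d = 3 * ((H + 2) * (2 * n) ^ (r + 2)))
    (hT : (T : ℝ) ≤ K * (d : ℝ) ^ q) (hKn : 40 * K * 3 ^ q ≤ n) :
    T * score n H r n ≤ 1 / 40 := by
  have hn' : (1 : ℝ) ≤ n := by exact_mod_cast hn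
  have hB : (1 : ℝ) ≤ 2 * n := by linarith
  have hB0 : (0 : ℝ) < 2 * n := by linarith
  have hd' : (d : ℝ) = 3 * (2 * n : ℝ) ^ ((2 * r + 4 : ℕ) : ℝ) := by
    rw [hd, hH, Real.rpow_natCast]; push_cast; ring
  have h1 : (d : ℝ) ^ q ≤ 3 ^ q * (2 * n : ℝ) ^ (r ^ 2) := by
    rw [hd', Real.mul_rpow (by norm_num) (by positivity), ← Real.rpow_mul hB0.le]
    gcongr
    rw [← Real.rpow_natCast (2 * n : ℝ) (r ^ 2)]
    refine Real.rpow_le_rpow_of_exponent_le hB ?_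
    push_cast
    nlinarith
  have h2 : (2 * n : ℝ) ^ (r ^ 2 + 1) ≤ (2 * n : ℝ) ^ (r ^ 2 + r) := by
    refine pow_le_pow_right₀ hB ?_
    have : (1 : ℝ) ≤ r := by linarith
    have : 1 ≤ r := by exact_mod_cast this
    omega
  have h3 : score n H r n ≤ 1 / (2 * n : ℝ) ^ (r ^ 2 + 1) :=
    (score_small hn hH).trans (one_div_le_one_div_of_le (by positivity) h2)
  calc T * score n H r n ≤ (K * (3 ^ q * (2 * n : ℝ) ^ (r ^ 2))) * (1 / (2 * n : ℝ) ^ (r ^ 2 + 1)) := by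
        gcongr
        · exact score_nonneg (by positivity)
        · exact hT.trans (by gcongr)
    _ = K * 3 ^ q / (2 * n) := by
        rw [pow_succ (2 * n : ℝ)]
        have : (2 * n : ℝ) ^ (r ^ 2) ≠ 0 := by positivity
        generalize (2 * n : ℝ) ^ (r ^ 2) = x at this ⊢
        field_simp
    _ ≤ 1 / 40 := by
        rw [div_le_iff₀ hB0]; linarith

theorem seven_eighths_le {ρ : ENNReal} {T : ℕ} {ε : NNReal} (hε : T * (ε : ℝ) ≤ 1 / 40)
    (h : ENNReal.ofReal (1 - 1 / 10) ≤ ρ + T * ε) : ENNReal.ofReal (1 - 1 / 8) ≤ ρ := by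
  have h1 : (T : ENNReal) * ε ≤ ENNReal.ofReal (1 / 40) := by
    have : (T : ENNReal) * ε = ENNReal.ofReal (T * (ε : ℝ)) := by
      rw [ENNReal.ofReal_mul (by positivity)]; simp
    rw [this]
    exact ENNReal.ofReal_le_ofReal hε
  have h2 : ENNReal.ofReal (1 - 1 / 8) = ENNReal.ofReal (1 - 1 / 10) - ENNReal.ofReal (1 / 40) := by
    rw [← ENNReal.ofReal_sub _ (by norm_num)]; norm_num
  rw [h2, tsub_le_iff_right]
  exact h.trans (by gcongr)

theorem exists_assignment {v : ℕ} {φ : Formula v} (h : ∃ w, Satisfies w φ) :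
    ∃ w : ℕ → Bool, ∀ c ∈ φ, clauseHolds w c = true := by
  obtain ⟨w, hw⟩ := h
  refine ⟨fun i => if hi : i < v then w ⟨i, hi⟩ else false, fun c hc => ?_⟩
  obtain ⟨j, hj⟩ := hw c hc
  fin_cases j <;> simp_all [clauseHolds, litHolds]

/-- Time and space of the reduction, in terms of the number of variables. -/
theorem instance_size_le {v c r f d T : ℕ} {m κ K q : ℝ} (hv : 1 ≤ v) (hq : 1 ≤ q)
    (hr : r ≤ 2 * q + 3) (hκ : 0 ≤ κ) (hK : 0 ≤ K) (hm : m ≤ κ * v)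
    (hf : (f : ℝ) ≤ v + 1 + m * (3 * (v + 2)))
    (hd : d = 3 * ((2 * (v + c)) ^ (r + 2) * (2 * (v + c)) ^ (r + 2)))
    (hT : (T : ℝ) ≤ K * (d : ℝ) ^ q) :
    ((f + d + T + r + c : ℕ) : ℝ) + 1 ≤
      (2 + 9 * κ + 3 * (2 * (1 + c)) ^ (2 * r + 4) + K * (3 * (2 * (1 + c)) ^ (2 * r + 4)) ^ q +
        r + c + 1) * (v : ℝ) ^ (14 * q ^ 2) := by
  have hv' : (1 : ℝ) ≤ v := by exact_mod_cast hv
  set w := (v : ℝ) ^ (14 * q ^ 2) with hw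
  set D : ℝ := 3 * (2 * (1 + c)) ^ (2 * r + 4) with hD
  have hD0 : 0 ≤ D := by positivity
  have hw1 : 1 ≤ w := Real.one_le_rpow hv' (by positivity)
  have hw2 : (v : ℝ) ^ 2 ≤ w := by
    rw [hw, ← Real.rpow_natCast]
    refine Real.rpow_le_rpow_of_exponent_le hv' ?_
    push_cast; nlinarith
  have hd' : (d : ℝ) ≤ D * (v : ℝ) ^ (14 * q) := by
    have h1 : (d : ℝ) = 3 * (2 * (v + c)) ^ (2 * r + 4) := by
      rw [hd]; push_cast; ring
    have h2 : (2 * (v + c) : ℝ) ≤ 2 * (1 + c) * v := by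
      have : (c : ℝ) ≤ c * v := le_mul_of_one_le_right (by positivity) hv'
      linarith
    -- Here `2r + 4 ≤ 4q + 10 ≤ 14q`, the source of the constant 14.
    have h3 : (v : ℝ) ^ (2 * r + 4) ≤ (v : ℝ) ^ (14 * q) := by
      rw [← Real.rpow_natCast]
      refine Real.rpow_le_rpow_of_exponent_le hv' ?_
      push_cast; linarith
    calc (d : ℝ) ≤ 3 * (2 * (1 + c) * v) ^ (2 * r + 4) := by rw [h1]; gcongr
      _ = D * (v : ℝ) ^ (2 * r + 4) := by rw [mul_pow, hD]; ring
      _ ≤ _ := by gcongr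
  have hdw : (d : ℝ) ≤ D * w := by
    refine hd'.trans ?_
    gcongr
    refine Real.rpow_le_rpow_of_exponent_le hv' ?_
    nlinarith
  have hTw : (T : ℝ) ≤ K * D ^ q * w := by
    have : (d : ℝ) ^ q ≤ D ^ q * w := by
      calc (d : ℝ) ^ q ≤ (D * (v : ℝ) ^ (14 * q)) ^ q := by gcongr
        _ = D ^ q * w := by
          rw [Real.mul_rpow hD0 (by positivity), ← Real.rpow_mul (by positivity), hw]
          ring_nf
    calc (T : ℝ) ≤ K * (d : ℝ) ^ q := hT
      _ ≤ K * (D ^ q * w) := by gcongr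
      _ = _ := by ring
  have hfw : (f : ℝ) ≤ (2 + 9 * κ) * w := by
    have h1 : m * (3 * (v + 2)) ≤ κ * v * (9 * v) := by
      calc m * (3 * (v + 2)) ≤ κ * v * (3 * (v + 2)) := by gcongr
        _ ≤ _ := mul_le_mul_of_nonneg_left (by linarith) (by positivity)
    have h2 : (f : ℝ) ≤ (2 + 9 * κ) * (v : ℝ) ^ 2 := by nlinarith
    exact h2.trans (by gcongr)
  have hrc : (r : ℝ) + c + 1 ≤ (r + c + 1) * w := le_mul_of_one_le_right (by positivity) hw1
  push_cast
  linarith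

end LinRL

/-! ### The proposition. -/

open LinRL

theorem proposition2 :
    ∃ C : ℝ, ∀ (κ : ℝ) (b : Polynomial ℕ), 0 < κ → (∀ d : ℕ, d ≤ b.eval d) →
      ∀ q : ℝ, 1 ≤ q →
        LinRL.LinearRLSolvable 2 κ b (fun d => (d : ℝ) ^ q) (1 / 10) →
        LinRL.Unique3SATSolvable (fun v => (v : ℝ) ^ (C * q ^ 2)) (1 / 8) := by
  obtain ⟨P, hP⟩ := exists_reduction
  obtain ⟨a, e, hPe⟩ := exists_eval_le P
  -- The dimension is `O(v^(14q))` and the simulated time `O(v^(14q²))`; the reduction raises this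
  -- to the absolute power `e`.
  refine ⟨14 * e, fun κ b hκ hb q hq ⟨p, K, hp⟩ => ?_⟩
  -- The lower bound on `r` makes the false rewards rare, the upper bound keeps the dimension small.
  obtain ⟨r, hr1, hr2⟩ : ∃ r : ℕ, 2 * q + 2 ≤ r ∧ r ≤ 2 * q + 3 :=
    ⟨⌈2 * q⌉₊ + 2, by push_cast; linarith [Nat.le_ceil (2 * q)],
      by push_cast; linarith [Nat.ceil_lt_add_one (show 0 ≤ 2 * q by linarith)]⟩
  have hr0 : r ≠ 0 := by
    rintro rfl
    norm_num at hr1; linarith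
  -- The padding makes `n` large even for small `v`: 4 for `ε ≤ 1/4`, `1/κ` for the horizon bound
  -- `2H + 2 ≤ κd`, and the last term for the total error 1/40.
  obtain ⟨c, hc4, hcκ, hcK⟩ : ∃ c : ℕ, 4 ≤ c ∧ 1 / κ ≤ c ∧ 40 * |K| * 3 ^ q ≤ c := by
    have h1 := Nat.le_ceil (1 / κ)
    have h2 := Nat.le_ceil (40 * |K| * 3 ^ q)
    refine ⟨⌈1 / κ⌉₊ + ⌈40 * |K| * 3 ^ q⌉₊ + 4, by omega, ?_, ?_⟩ <;> push_cast <;>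
      linarith [Nat.cast_nonneg (α := ℝ) ⌈1 / κ⌉₊, Nat.cast_nonneg (α := ℝ) ⌈40 * |K| * 3 ^ q⌉₊]
  obtain ⟨p', hp'⟩ := hP p c r
  refine ⟨p', fun κ' => ⟨a * (2 + 9 * |κ'| + 3 * (2 * (1 + c)) ^ (2 * r + 4) +
    |K| * (3 * (2 * (1 + c)) ^ (2 * r + 4)) ^ q + r + c + 1) ^ e, fun v hv φ hφ _ => ?_⟩⟩
  obtain ⟨n, hn⟩ : ∃ n, n = v + c := ⟨_, rfl⟩
  have hcn : (c : ℝ) ≤ n := by exact_mod_cast (by omega : c ≤ n)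
  have hn1 : (1 : ℝ) ≤ n := by exact_mod_cast (by omega : 1 ≤ n)
  obtain ⟨H, hH⟩ : ∃ H, H + 2 = (2 * n) ^ (r + 2) :=
    ⟨(2 * n) ^ (r + 2) - 2, Nat.sub_add_cancel
      ((by omega : 2 ≤ 2 * n).trans (Nat.le_self_pow (by omega) _))⟩
  obtain ⟨d, hd⟩ : ∃ d, d = 3 * ((H + 2) * (2 * n) ^ (r + 2)) := ⟨_, rfl⟩
  have hBH : 2 * n ≤ H + 2 := hH ▸ Nat.le_self_pow (by omega) (2 * n)
  have hHd : (H + 2) * (2 * n) * 3 ≤ d := by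
    rw [hd, ← hH, mul_comm 3]
    gcongr
  have hHd' : (H + 2) * 3 ≤ d := by nlinarith
  have hbd := hb d
  obtain ⟨T, hT⟩ : ∃ T, T = ⌊K * (d : ℝ) ^ q⌋₊ := ⟨_, rfl⟩
  have hT' : (T : ℝ) ≤ |K| * (d : ℝ) ^ q := by
    rcases le_or_gt 0 (K * (d : ℝ) ^ q) with h | h
    · exact hT ▸ (Nat.floor_le h).trans (by gcongr; exact le_abs_self K)
    · rw [hT, Nat.floor_of_nonpos h.le]
      simpa using by positivity
  have hhor : ((2 * H + 2 : ℕ) : ℝ) ≤ κ * d := by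
    have h1 : 1 ≤ κ * (2 * n) := by
      have := (div_le_iff₀ hκ).1 (hcκ.trans hcn)
      nlinarith
    have h2 : ((H : ℝ) + 2) * (2 * n) * 3 ≤ d := by exact_mod_cast hHd
    have h3 : (0 : ℝ) ≤ H := by positivity
    calc ((2 * H + 2 : ℕ) : ℝ) ≤ (H + 2) * 3 * 1 := by push_cast; linarith
      _ ≤ (H + 2) * 3 * (κ * (2 * n)) := by gcongr
      _ = κ * ((H + 2) * (2 * n) * 3) := by ring
      _ ≤ _ := by gcongr
  have hsolve (g : List Bool → NNReal) (hg : (searchOracle φ n H r d g).LinearOpt) :=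
    hp d (by omega) (searchOracle φ n H r d g) hg hhor
      (searchOracle_sizeLE φ r g (by omega) (by omega))
  rw [← hT] at hsolve
  -- The program and its time bound are the same in both cases; only the instance with which the
  -- simulated run is compared differs.
  have key : ∃ ρ, Accepts (∃ w, Satisfies w φ) ([p'], satInput φ)
      (P.eval ((formulaCode φ).length + d + T + r + c)) ρ ∧
      ((∃ w, Satisfies w φ) → ENNReal.ofReal (1 - 1 / 8) ≤ ρ) := by
    by_cases hsat : ∃ w, Satisfies w φ
    · obtain ⟨w, hw⟩ := exists_assignment hsat
      obtain ⟨hhalt, hprob⟩ := hsolve _ (searchOracle_linearOpt hw (by omega) (by omega) hd).1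
      have hsmall := mul_score_le (abs_nonneg K) hq hr1 (by omega) hH hd hT' (hcK.trans hcn)
      have hε1 : score n H r n ≤ 1 / 4 := by
        refine (score_small (by omega) hH).trans (one_div_le_one_div_of_le (by norm_num) ?_)
        have hn4 : (4 : ℝ) ≤ n := by exact_mod_cast (by omega : 4 ≤ n)
        have := le_self_pow₀ (a := (2 * n : ℝ)) (by linarith) (n := r ^ 2 + r) (by positivity)
        linarith
      have hε0 : 0 ≤ score n H r n := score_nonneg (by positivity)
      have hg1 (x : State n H) : successProb w n H r x.1 < 1 := by
        rw [successProb, Real.toNNReal_lt_one]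
        exact score_lt_one hr0 (lead_nonneg w x.2.2) (lead_le w x.2.1)
      have hg (x : State n H) (hx : x.1.length = n + 1 + H) :
          successProb w n H r x.1 ≤ (score n H r n).toNNReal := by
        refine Real.toNNReal_le_toNNReal (score_mono (lead_nonneg w x.2.2) ?_)
        have := agree_le w n x.1
        rw [lead, hx]
        push_cast
        linarith
      obtain ⟨ρ, h1, h2⟩ := hp' v φ n H d T hn (by omega) hH hd _ _ hg1 hg hhalt
      refine ⟨ρ, h1, fun _ => seven_eighths_le (ε := (score n H r n).toNNReal) ?_
        (hprob.trans ((prob_mono _ ?_).trans h2))⟩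
      · rwa [Real.coe_toNNReal _ hε0]
      · rintro y ⟨l, rfl, hl⟩
        refine satState_of_goodActions hw (by omega) (by omega) r _ hg ?_ hl
        rw [Real.coe_toNNReal _ hε0]
        linarith [half_le_score (by omega : 1 ≤ n) hH]
    · obtain ⟨hhalt, -⟩ := hsolve 0 (searchOracle_zero_linearOpt φ r d)
      obtain ⟨ρ, h1, -⟩ := hp' v φ n H d T hn (by omega) hH hd 0 0 (by simp) (by simp) hhalt
      exact ⟨ρ, h1, fun h => absurd h hsat⟩
  obtain ⟨ρ, hacc, hρ⟩ := key
  set G : ℝ := 2 + 9 * |κ'| + 3 * (2 * (1 + c)) ^ (2 * r + 4) +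
    |K| * (3 * (2 * (1 + c)) ^ (2 * r + 4)) ^ q + r + c + 1 with hG
  have htime : P.eval ((formulaCode φ).length + d + T + r + c) ≤
      ⌊a * G ^ e * (v : ℝ) ^ (14 * e * q ^ 2)⌋₊ := by
    refine Nat.le_floor ?_
    have h1 : ((formulaCode φ).length : ℝ) ≤ v + 1 + φ.length * (3 * (v + 2)) := by
      exact_mod_cast length_formulaCode_le φ
    have h2 := instance_size_le (c := c) (f := (formulaCode φ).length) hv hq hr2 (abs_nonneg κ')
      (abs_nonneg K) (hφ.trans (by gcongr; exact le_abs_self κ')) h1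
      (by rw [hd, hH, hn]) hT'
    rw [← hG] at h2
    have h3 : ((v : ℝ) ^ (14 * q ^ 2)) ^ e = (v : ℝ) ^ (14 * e * q ^ 2) := by
      rw [← Real.rpow_natCast, ← Real.rpow_mul (by positivity)]
      ring_nf
    calc ((P.eval ((formulaCode φ).length + d + T + r + c) : ℕ) : ℝ)
        ≤ a * (((formulaCode φ).length + d + T + r + c : ℕ) + 1 : ℝ) ^ e := by
          exact_mod_cast hPe _
      _ ≤ a * (G * (v : ℝ) ^ (14 * q ^ 2)) ^ e := by gcongr
      _ = _ := by rw [mul_pow, h3]; ring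
  have hacc := hacc.mono htime
  refine ⟨fun c' hc' => (hacc.1 c' hc').1, fun h => (hρ h).trans hacc.2, fun h => ?_⟩
  rw [prob, PMF.toOuterMeasure_apply_eq_one_iff]
  intro y hy
  rw [output, PMF.support_map] at hy
  obtain ⟨c', hc', rfl⟩ := hy
  exact fun hY => h ((hacc.1 c' hc').2 hY)
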